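/- Write $e(x)=\exp(2\pi i x)$, let $\Lambda$ be the von Mangoldt function and $\pi(X)$ the number of primes $p\le X$; $r\sim R$ means $R\le r<2R$, all of $a,q,r,d,l,n,N$ are integers ($N\ge 0$, the others positive), and $a\asymp q$ means $cq\le a\le Cq$ for fixed constants $0<c\le C$. Then the following two statements hold. (i) (Corollary 13.) Let $\rho,\eta>0$ and $\alpha\in\mathbb R$ satisfy $\alpha+\rho+2\eta<\frac13$ and $\rho+3\eta<\frac16$. For $X\ge 2$ put $\xi=X^{-\rho}$ and $Y=\lfloor 3\xi^{-1}X^{\eta}\rfloor$, and suppose that $(a,q)=1$, $a\asymp q$ and $q\asymp X^{\frac13+\rho+\eta}$. Then $$\sum_{d\le X^{\alpha}}\frac{\xi}{d}\,\max_{N\le X}\,\sum_{l=1}^{dY}\Bigl|\sum_{n\le N}\Lambda(n)\,e\Bigl(\frac{anl}{dq}\Bigr)\Bigr|\ll \xi\,\pi(X)\,X^{-\eta},$$ where the implied constant depends only on $\rho,\eta,\alpha$ and on the constants in the two relations $\asymp$. In particular, for any fixed $0<\rho<\frac16$ and any $\alpha$ with $\alpha+\rho<\frac13$ this holds for every sufficiently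 small $\eta>0$. (ii) (Lemma 12.) Let $\varepsilon>0$, $X,R,L\ge 1$, $T=\max\{L,R\}$, and suppose that $(a,q)=1$, $a\asymp q$ and $\frac{TX^{1/3}}{R}<q<X^{2/3}$. Then $$\sum_{r\sim R}\max_{N\le X}\sum_{l\sim L}\Bigl|\sum_{n\le N}\Lambda(n)\,e\Bigl(\frac{anl}{rq}\Bigr)\Bigr|\ll X^{\varepsilon}\Bigl(X^{\frac23}TR+X^{\frac{11}{12}}(TR)^{\frac12}\Bigr),$$ where the implied constant depends only on $\varepsilon$ and on the constants in $a\asymp q$. -/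

import Mathlib

namespace PrimeExpSum

/-- `e(x) = exp(2πix)`. -/
noncomputable def e (x : ℝ) : ℂ := Complex.exp (2 * Real.pi * Complex.I * (x : ℂ))

/-- `∑_{n ≤ N} Λ(n) e(nθ)`, where `Λ` is the von Mangoldt function. -/
noncomputable def S (N : ℕ) (θ : ℝ) : ℂ :=
  ∑ n ∈ Finset.Icc 1 N, (ArithmeticFunction.vonMangoldt n : ℂ) * e (n * θ)

/-- `max_{N ≤ X} ∑_{l ∈ I} |∑_{n ≤ N} Λ(n) e(nlθ)|`, the maximum being over the integers
`0 ≤ N ≤ X`. -/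
noncomputable def maxS (X : ℝ) (I : Finset ℕ) (θ : ℝ) : ℝ :=
  (Finset.range (⌊X⌋₊ + 1)).sup' Finset.nonempty_range_add_one
    (fun N => ∑ l ∈ I, ‖S N (l * θ)‖)

/-- The integers `r ∼ R`, that is, `R ≤ r < 2R`. -/
noncomputable def dyadic (R : ℝ) : Finset ℕ := Finset.Ico ⌈R⌉₊ ⌈2 * R⌉₊

/-- `ξ = X^{-ρ}`. -/
noncomputable def xi (ρ X : ℝ) : ℝ := X ^ (-ρ)

/-- `Y = ⌊3 ξ⁻¹ X^η⌋`. -/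
noncomputable def Y (ρ η X : ℝ) : ℕ := ⌊3 * (xi ρ X)⁻¹ * X ^ η⌋₊

end PrimeExpSum

/-! Write X = u^12, so that the cut points X^(1/6), X^(1/3), X^(2/3) are u^2, u^4, u^8. The maxima
over N are attained at some N_r depending only on r, so the second statement bounds a triple sum
over r, l, n with cut-offs N_r (`errSum`). A single parameter B dominates every divisor function,
logarithm and constant; the argument loses B^24, which becomes X^ε at the end.

The function Λ is decomposed by the Heath-Brown identity of order three. Let M be the Möbius
function cut at u^2 and E = 1 - ζM, which is supported beyond u^2. Expanding E^3 Λ with Λζ = log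
gives Λ = 3 M log - 3 M^2 log ζ + M^3 log ζ^2 + E^3 Λ. Split E = G + H at u^4: then H^3 lives beyond
u^12 = X and drops out, and the rest of E^3 has a factor G supported on (u^2, u^4]. Factors in the
remaining products are regrouped in the same way. Either some factor or subproduct lies in (u^2,
u^4], which gives a bilinear sum, or at most two smooth variables remain beside a factor at most
u^2. In the second case the hyperbola method leaves one long smooth variable, and the others have
product m at most u^8.

Linear sums: the long variable is a geometric sum, of size at most min(X/m, 1/‖m l a/(rq)‖). With k
= lm, a divisor bound for the multiplicity, and the reduced denominator rq/(a,r), the sum over k is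
classical. The average of (a,r) over r is harmless, and T X^(1/3) ≪ Rq controls the multiples of the
denominator (`sum_cap_le`).

Bilinear sums: put k = lm again and apply Cauchy–Schwarz with n outside. It remains to count pairs
(r,k), (r',k') for which a(kr' - k'r)/(q r r') is within δ of an integer j (`Ctx.card_near_le`). If
j = 0, then a ≍ q forces the determinant kr' - k'r to be ≪ δR^2, and divisor bounds suffice. If j ≠
0, the condition says that z = a(kr' - k'r) - q j r r' is small, so j r r' lies in a residue class
modulo a determined by z. One counts z and j r r', recovers r, r', j as divisors, and treats the gcd
of r and r' by summing over its size. When R exceeds a multiple of X the phases n a/(rq) do not wrap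
around, and a direct large-sieve argument suffices (`errSum_le_of_large`).

The first statement follows from the second, in a form with constants in the hypotheses, by
splitting d and l dyadically. There T ≪ R X^(ρ+η), the size of q is exactly what the lower bound on
q requires, and the two inequalities on the exponents make the two terms of the bound acceptable.
Chebyshev's lower bound replaces X^(1-ε) by π(X). -/

namespace PrimeExpSum

open Finset

/-! ### Distance to the nearest integer, geometric sums, partial summation -/

/-- The distance to the nearest integer. -/
noncomputable def nd (x : ℝ) : ℝ := |x - round x|

lemma nd_nonneg (x : ℝ) : 0 ≤ nd x := abs_nonneg _

lemma nd_le_half (x : ℝ) : nd x ≤ 1 / 2 := abs_sub_round x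

lemma nd_le (x : ℝ) (j : ℤ) : nd x ≤ |x - j| := round_le x j

lemma nd_add_int (x : ℝ) (j : ℤ) : nd (x + j) = nd x := by
  unfold nd; rw [round_add_intCast]; push_cast; congr 1; ring

lemma nd_of_abs_le_half {x : ℝ} (hx : |x| ≤ 1 / 2) : nd x = |x| := by
  apply le_antisymm
  · simpa using nd_le x 0
  · by_contra! h
    have h1 : nd x < 1 / 2 := lt_of_lt_of_le h hx
    have h2 : |(round x : ℝ)| < 1 := by
      have : (round x : ℝ) = x - (x - round x) := by ring
      rw [this]
      refine (abs_sub _ _).trans_lt ?_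
      unfold nd at h1; linarith
    have h3 : round x = 0 := by
      rw [← Int.abs_lt_one_iff]; exact_mod_cast h2
    unfold nd at h; rw [h3] at h; simp at h

lemma norm_e (x : ℝ) : ‖e x‖ = 1 := by
  unfold e
  rw [show (2 * Real.pi * Complex.I * (x : ℂ)) = ((2 * Real.pi * x : ℝ) : ℂ) * Complex.I by
    push_cast; ring]
  exact Complex.norm_exp_ofReal_mul_I _

lemma e_add (x y : ℝ) : e (x + y) = e x * e y := by
  unfold e; rw [← Complex.exp_add]; congr 1; push_cast; ring

lemma e_conj (x : ℝ) : (starRingEnd ℂ) (e x) = e (-x) := by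
  unfold e
  rw [← Complex.exp_conj]; congr 1
  simp
  left; exact Complex.conj_ofNat 2

lemma e_natCast_mul (n : ℕ) (x : ℝ) : e (n * x) = e x ^ n := by
  unfold e; rw [← Complex.exp_nat_mul]; congr 1; push_cast; ring

lemma e_int (j : ℤ) : e j = 1 := by
  unfold e
  rw [Complex.exp_eq_one_iff]
  exact ⟨j, by push_cast; ring⟩

/-- The chord has length 2|sin(πx)|, and Jordan's inequality bounds the sine below by its secant on
[-π/2, π/2]. -/
lemma four_mul_nd_le (x : ℝ) : 4 * nd x ≤ ‖e x - 1‖ := by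
  set y := x - round x with hy
  have h1 : e x = e y := by
    rw [show x = y + ((round x : ℤ) : ℝ) by rw [hy]; ring, e_add, e_int, mul_one]
  have h2 : nd x = |y| := rfl
  have hy2 : |y| ≤ 1 / 2 := abs_sub_round x
  rw [h1, h2]
  have h3 : ‖e y - 1‖ = ‖2 * Real.sin (2 * Real.pi * y / 2)‖ := by
    rw [← Complex.norm_exp_I_mul_ofReal_sub_one]
    unfold e; congr 3; push_cast; ring
  rw [h3, Real.norm_eq_abs, abs_mul, abs_two]
  have h4 : 2 / Real.pi * |Real.pi * y| ≤ |Real.sin (Real.pi * y)| := by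
    apply Real.mul_abs_le_abs_sin
    rw [abs_mul, abs_of_pos Real.pi_pos]; nlinarith [Real.pi_pos]
  rw [abs_mul, abs_of_pos Real.pi_pos] at h4
  have h5 : 2 / Real.pi * (Real.pi * |y|) = 2 * |y| := by
    field_simp
  rw [show 2 * Real.pi * y / 2 = Real.pi * y by ring]
  linarith

lemma norm_sum_e_le_card (s : Finset ℕ) (x : ℝ) : ‖∑ n ∈ s, e (n * x)‖ ≤ s.card := by
  refine (norm_sum_le _ _).trans ?_
  simp [norm_e]

lemma norm_sum_Ico_e_le (A B : ℕ) {x : ℝ} (hx : 0 < nd x) :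
    ‖∑ n ∈ Ico A B, e (n * x)‖ ≤ 1 / (2 * nd x) := by
  rcases le_total B A with h | h
  · rw [Ico_eq_empty_of_le h]; simp only [sum_empty, norm_zero]; positivity
  have h4 := four_mul_nd_le x
  have hne : e x ≠ 1 := by
    intro h0; rw [h0] at h4; simp at h4; linarith
  simp only [e_natCast_mul]
  rw [geom_sum_Ico hne h, norm_div, div_le_div_iff₀ (norm_pos_iff.2 (sub_ne_zero.2 hne)) (by positivity)]
  have : ‖e x ^ B - e x ^ A‖ ≤ 2 := by
    refine (norm_sub_le _ _).trans ?_
    simp [norm_pow, norm_e]; norm_num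
  nlinarith [nd_nonneg x]

/-- A dyadic-free majorant of `min(V, 1/‖x‖)`. -/
noncomputable def cnt (V : ℕ) (x : ℝ) : ℕ := #{h ∈ (Icc 1 V : Finset ℕ) | ((h : ℕ) : ℝ) * nd x ≤ 1}

/-- The geometric sum is at most min(v, 1/(2‖x‖)). The factor 1/2 pays for rounding 1/‖x‖ down, as
1/‖x‖ ≥ 2. The majorant is a sum of indicators of ‖x‖ ≤ 1/h, so that averaging it over pairs of
frequencies becomes counting close pairs at every scale. -/
lemma norm_sum_Icc_e_le_cnt {v V : ℕ} (hv : v ≤ V) (x : ℝ) :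
    ‖∑ n ∈ Icc 1 v, e (n * x)‖ ≤ cnt V x := by
  by_cases hx : (V : ℝ) * nd x ≤ 1
  · have : cnt V x = V := by
      unfold cnt
      rw [filter_true_of_mem]
      · simp
      · intro h hh
        have : (h : ℝ) ≤ V := by exact_mod_cast (mem_Icc.1 hh).2
        exact (mul_le_mul_of_nonneg_right this (nd_nonneg x)).trans hx
    rw [this]
    refine (norm_sum_e_le_card _ x).trans ?_
    simpa using hv
  · push Not at hx
    have hpos : 0 < nd x := by
      rcases (nd_nonneg x).lt_or_eq with h | h
      · exact h
      · rw [← h] at hx; norm_num at hx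
    have hset : Icc 1 v = Ico 1 (v + 1) := by ext; simp
    rw [hset]
    refine (norm_sum_Ico_e_le 1 (v + 1) hpos).trans ?_
    have h2 : 2 ≤ 1 / nd x := by
      rw [le_div_iff₀ hpos]; linarith [nd_le_half x]
    have hfl : ⌊1 / nd x⌋₊ ≤ cnt V x := by
      unfold cnt
      rw [show ⌊1 / nd x⌋₊ = #(Icc 1 ⌊1 / nd x⌋₊) by simp]
      apply card_le_card
      intro h hh
      rw [mem_Icc] at hh
      have h3 : (h : ℝ) ≤ 1 / nd x := (Nat.le_floor_iff (by positivity)).1 hh.2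
      rw [le_div_iff₀ hpos] at h3
      rw [mem_filter, mem_Icc]
      refine ⟨⟨hh.1, ?_⟩, h3⟩
      have : (h : ℝ) ≤ V := by
        by_contra! hc
        nlinarith
      exact_mod_cast this
    have h5 : 1 / nd x < ⌊1 / nd x⌋₊ + 1 := Nat.lt_floor_add_one _
    have h6 : (⌊1 / nd x⌋₊ : ℝ) ≤ cnt V x := by exact_mod_cast hfl
    have h7 : 1 / (2 * nd x) = (1 / nd x) / 2 := by field_simp
    rw [h7]; linarith

/-- Partial summation for a monotone weight. -/
lemma norm_sum_Ico_monotone_mul_le {f : ℕ → ℝ} (hf : Monotone f) (hf0 : ∀ n, 0 ≤ f n) (g : ℕ → ℂ)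
    {G : ℝ} (A B : ℕ) (hG : ∀ C ≤ B, ‖∑ n ∈ Ico C B, g n‖ ≤ G) :
    ‖∑ n ∈ Ico A B, (f n : ℂ) * g n‖ ≤ f B * G := by
  have hG0 : 0 ≤ G := (norm_nonneg _).trans (hG B le_rfl)
  rcases le_total B A with h | h
  · rw [Ico_eq_empty_of_le h]; simpa using mul_nonneg (hf0 B) hG0
  -- Summation by parts against tail sums: the coefficients f(A) and f(n+1) - f(n) are all
  -- nonnegative and add up to f(B).
  have key : ∀ k A, A + k = B → ∑ n ∈ Ico A B, (f n : ℂ) * g n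
      = (f A : ℂ) * ∑ n ∈ Ico A B, g n +
        ∑ n ∈ Ico A B, ((f (n + 1) - f n : ℝ) : ℂ) * ∑ j ∈ Ico (n + 1) B, g j := by
    intro k
    induction k with
    | zero => intro A hA; simp at hA; subst hA; simp
    | succ k ih =>
      intro A hA
      have hAB : A < B := by omega
      rw [sum_eq_sum_Ico_succ_bot hAB, sum_eq_sum_Ico_succ_bot hAB, sum_eq_sum_Ico_succ_bot hAB,
        ih (A + 1) (by omega)]
      push_cast; ring
  rw [key (B - A) A (by omega)]
  have h1 : ‖(f A : ℂ) * ∑ n ∈ Ico A B, g n‖ ≤ f A * G := by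
    rw [norm_mul, Complex.norm_real, Real.norm_of_nonneg (hf0 A)]
    exact mul_le_mul_of_nonneg_left (hG A h) (hf0 A)
  have h2 : ‖∑ n ∈ Ico A B, ((f (n + 1) - f n : ℝ) : ℂ) * ∑ j ∈ Ico (n + 1) B, g j‖
      ≤ ∑ n ∈ Ico A B, (f (n + 1) - f n) * G := by
    refine norm_sum_le_of_le _ fun n hn => ?_
    have h0 : 0 ≤ f (n + 1) - f n := sub_nonneg.2 (hf n.le_succ)
    rw [norm_mul, Complex.norm_real, Real.norm_of_nonneg h0]
    exact mul_le_mul_of_nonneg_left (hG _ (by rw [mem_Ico] at hn; omega)) h0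
  rw [← sum_mul, sum_Ico_sub f h] at h2
  refine (norm_add_le _ _).trans ?_
  linarith

/-! ### The divisor bound -/

lemma add_one_le_mul_rpow {ε : ℝ} (hε : 0 < ε) (v : ℕ) :
    (v + 1 : ℝ) ≤ (1 + 1 / (ε * Real.log 2)) * (2 : ℝ) ^ (ε * v) := by
  have hl : 0 < Real.log 2 := Real.log_pos (by norm_num)
  have h1 : ε * Real.log 2 * v + 1 ≤ (2 : ℝ) ^ (ε * v) := by
    rw [Real.rpow_def_of_pos (by norm_num)]
    have := Real.add_one_le_exp (Real.log 2 * (ε * v))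
    linarith
  have h2 : (1 : ℝ) ≤ (2 : ℝ) ^ (ε * v) := Real.one_le_rpow (by norm_num) (by positivity)
  have h3 : (v : ℝ) ≤ 1 / (ε * Real.log 2) * (2 : ℝ) ^ (ε * v) := by
    rw [one_div, ← div_eq_inv_mul, le_div_iff₀ (by positivity)]
    linarith
  linarith

/-- In the product of (v+1)/p^(εv) over p^v exactly dividing n, a prime p ≥ 2^(1/ε) contributes at
most 1 because v+1 ≤ 2^v ≤ p^(εv). Each of the boundedly many smaller primes contributes at most a
constant. -/
lemma exists_card_divisors_le {ε : ℝ} (hε : 0 < ε) :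
    ∃ K : ℝ, 1 ≤ K ∧ ∀ n : ℕ, 0 < n → (n.divisors.card : ℝ) ≤ K * (n : ℝ) ^ ε := by
  have hl : 0 < Real.log 2 := Real.log_pos (by norm_num)
  set A : ℝ := 1 + 1 / (ε * Real.log 2) with hA
  have hA1 : 1 ≤ A := by rw [hA]; have : 0 ≤ 1 / (ε * Real.log 2) := by positivity
                         linarith
  set P : ℕ := ⌈(2 : ℝ) ^ (1 / ε)⌉₊ with hP
  refine ⟨A ^ P, one_le_pow₀ hA1, fun n hn => ?_⟩
  have h1 : (n.divisors.card : ℝ) = ∏ p ∈ n.primeFactors, ((n.factorization p : ℝ) + 1) := by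
    rw [Nat.card_divisors hn.ne']; push_cast; rfl
  have h2 : (n : ℝ) ^ ε = ∏ p ∈ n.primeFactors, ((p : ℝ) ^ (ε * n.factorization p)) := by
    conv_lhs => rw [← Nat.prod_factorization_pow_eq_self hn.ne']
    rw [Finsupp.prod]; push_cast
    rw [← Real.finsetProd_rpow _ _ (fun i _ => by positivity)]
    refine prod_congr rfl fun p _ => ?_
    rw [← Real.rpow_natCast, ← Real.rpow_mul (by positivity), mul_comm]
  have h3 : ∀ p ∈ n.primeFactors, ((n.factorization p : ℝ) + 1) ≤
      (if p < P then A else 1) * ((p : ℝ) ^ (ε * n.factorization p)) := by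
    intro p hp
    have hp2 : (2 : ℝ) ≤ p := by exact_mod_cast (Nat.prime_of_mem_primeFactors hp).two_le
    split_ifs with hpP
    · refine (add_one_le_mul_rpow hε _).trans ?_
      apply mul_le_mul_of_nonneg_left _ (by linarith)
      exact Real.rpow_le_rpow (by norm_num) hp2 (by positivity)
    · push Not at hpP
      have h4 : (2 : ℝ) ^ (1 / ε) ≤ p := (Nat.le_ceil _).trans (by exact_mod_cast hpP)
      have h5 : (2 : ℝ) ≤ (p : ℝ) ^ ε := by
        calc (2 : ℝ) = ((2 : ℝ) ^ (1 / ε)) ^ ε := by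
              rw [← Real.rpow_mul (by norm_num)]; field_simp; simp
          _ ≤ _ := Real.rpow_le_rpow (by positivity) h4 hε.le
      rw [one_mul, Real.rpow_mul (by positivity), Real.rpow_natCast]
      calc ((n.factorization p : ℝ) + 1) ≤ 2 ^ (n.factorization p) := by
            exact_mod_cast Nat.lt_two_pow_self
        _ ≤ _ := pow_le_pow_left₀ (by norm_num) h5 _
  rw [h1, h2]
  refine (prod_le_prod (fun p _ => by positivity) h3).trans ?_
  rw [prod_mul_distrib]
  apply mul_le_mul_of_nonneg_right _ (prod_nonneg fun p _ => by positivity)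
  rw [prod_ite]
  simp only [prod_const, one_pow, mul_one]
  apply pow_le_pow_right₀ hA1
  calc #{p ∈ n.primeFactors | p < P} ≤ #(range P) := card_le_card (by
        intro p; simp)
    _ = P := card_range P

/-! ### Harmonic sums and counting by fibres -/

lemma sum_inv_le (N : ℕ) : ∑ n ∈ Icc 1 N, (1 : ℝ) / n ≤ 1 + Real.log N := by
  have := harmonic_le_one_add_log N
  rw [harmonic_eq_sum_Icc] at this
  push_cast at this
  simpa using this

lemma sum_comp_le_mul_sum {ι κ : Type*} [DecidableEq κ] (S : Finset ι) (T : Finset κ) (φ : ι → κ)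
    (hφ : ∀ i ∈ S, φ i ∈ T) {f : κ → ℝ} (hf : ∀ k ∈ T, 0 ≤ f k) {B : ℝ}
    (hB : ∀ k ∈ T, (#{i ∈ S | φ i = k} : ℝ) ≤ B) :
    ∑ i ∈ S, f (φ i) ≤ B * ∑ k ∈ T, f k := by
  rw [← sum_fiberwise_of_maps_to hφ, mul_sum]
  refine sum_le_sum fun k hk => ?_
  calc ∑ i ∈ S with φ i = k, f (φ i) = ∑ i ∈ S with φ i = k, f k :=
        sum_congr rfl fun i hi => by rw [(mem_filter.1 hi).2]
    _ = #{i ∈ S | φ i = k} * f k := by rw [sum_const, nsmul_eq_mul]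
    _ ≤ B * f k := mul_le_mul_of_nonneg_right (hB k hk) (hf k hk)

lemma card_le_mul_card {ι κ : Type*} [DecidableEq κ] (S : Finset ι) (T : Finset κ) (φ : ι → κ)
    (hφ : ∀ i ∈ S, φ i ∈ T) {B : ℝ} (hB : ∀ k ∈ T, (#{i ∈ S | φ i = k} : ℝ) ≤ B) :
    (#S : ℝ) ≤ B * #T := by
  have := sum_comp_le_mul_sum S T φ hφ (f := fun _ => 1) (fun _ _ => zero_le_one) hB
  simpa using this

lemma card_pairs_mul_eq_le (S : Finset (ℕ × ℕ)) {k : ℕ} (hk : 0 < k) :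
    #{p ∈ S | p.1 * p.2 = k} ≤ #k.divisors := by
  apply card_le_card_of_injOn Prod.fst
  · intro p hp
    simp only [coe_filter, Set.mem_ofPred_eq] at hp
    simp only [mem_coe, Nat.mem_divisors]
    exact ⟨⟨p.2, hp.2.symm⟩, hk.ne'⟩
  · rintro ⟨x, y⟩ hp ⟨x', y'⟩ hp' h
    simp only [coe_filter, Set.mem_ofPred_eq] at hp hp'
    simp only at h
    subst h
    have hx : 0 < x := by
      rcases Nat.eq_zero_or_pos x with h0 | h0
      · subst h0; simp at hp; omega
      · exact h0
    have : y = y' := Nat.eq_of_mul_eq_mul_left hx (hp.2.trans hp'.2.symm)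
    rw [this]

/-! ### Sums of reciprocals of ‖ka/s‖ over k -/

lemma le_nd_div {j s : ℕ} (hs : 0 < s) :
    min (j : ℝ) (s - j) / s ≤ nd ((j : ℝ) / s) := by
  have hs' : (0 : ℝ) < s := by exact_mod_cast hs
  unfold nd
  set m := round ((j : ℝ) / s)
  have h1 : |(j : ℝ) / s - m| = |(j : ℝ) - m * s| / s := by
    rw [← abs_of_pos hs', ← abs_div, abs_of_pos hs']; congr 1; field_simp
  rw [h1]
  apply div_le_div_of_nonneg_right _ hs'.le
  rcases le_or_gt m 0 with hm | hm
  · have : (m : ℝ) ≤ 0 := by exact_mod_cast hm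
    exact (min_le_left _ _).trans (le_trans (by nlinarith) (le_abs_self _))
  · have : (1 : ℝ) ≤ m := by exact_mod_cast hm
    exact (min_le_right _ _).trans (le_trans (by nlinarith) (neg_le_abs _))

lemma inv_nd_div_le {j s : ℕ} (hj : 0 < j) (hjs : j < s) :
    1 / nd ((j : ℝ) / s) ≤ s * (1 / (j : ℝ)) + s * (1 / ((s - j : ℕ) : ℝ)) := by
  have hs : (0 : ℝ) < s := by exact_mod_cast hj.trans hjs
  have hj' : (0 : ℝ) < j := by exact_mod_cast hj
  have hsj : (0 : ℝ) < ((s - j : ℕ) : ℝ) := by exact_mod_cast Nat.sub_pos_of_lt hjs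
  have h := le_nd_div (j := j) (hj.trans hjs)
  rw [← Nat.cast_sub hjs.le] at h
  have hp : 0 < min (j : ℝ) ((s - j : ℕ) : ℝ) / s := by positivity
  refine (one_div_le_one_div_of_le hp h).trans ?_
  rw [one_div_div]
  rcases min_choice (j : ℝ) ((s - j : ℕ) : ℝ) with h0 | h0 <;> rw [h0]
  · rw [div_eq_mul_one_div]; have : 0 ≤ (s : ℝ) * (1 / ((s - j : ℕ) : ℝ)) := by positivity
    linarith
  · rw [div_eq_mul_one_div]; have : 0 ≤ (s : ℝ) * (1 / (j : ℝ)) := by positivity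
    linarith

/-- `1/‖k a/s‖`, set to zero at the multiples of `s`. -/
noncomputable def recip (a s k : ℕ) : ℝ := if s ∣ k then 0 else 1 / nd ((k : ℝ) * (a / s))

lemma recip_nonneg (a s k : ℕ) : 0 ≤ recip a s k := by
  unfold recip; split_ifs
  · exact le_rfl
  · have := nd_nonneg ((k : ℝ) * (a / s)); positivity

lemma recip_add_mul (a : ℕ) {s : ℕ} (hs : 0 < s) (b k : ℕ) : recip a s (b * s + k) = recip a s k := by
  have hs' : (s : ℝ) ≠ 0 := by positivity
  unfold recip
  have h1 : s ∣ b * s + k ↔ s ∣ k := Nat.dvd_add_right (Dvd.intro_left b rfl)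
  have h2 : (((b * s + k : ℕ) : ℝ)) * (a / s) = (k : ℝ) * (a / s) + ((b * a : ℕ) : ℤ) := by
    push_cast; field_simp; ring
  rw [h2, nd_add_int]
  simp only [h1]

/-- Multiplication by a permutes the residues modulo s, so the fractional parts are the j/s with 0 <
j < s. There 1/‖j/s‖ is at most s/j + s/(s-j), which leaves two equal harmonic sums. -/
lemma sum_range_recip_le {a s : ℕ} (hs : 0 < s) (h : a.Coprime s) :
    ∑ k ∈ range s, recip a s k ≤ 2 * s * (1 + Real.log s) := by
  have hs' : (s : ℝ) ≠ 0 := by positivity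
  set g : ℕ → ℝ := fun j => if j = 0 then 0 else 1 / nd ((j : ℝ) / s) with hg
  have hinj : Set.InjOn (fun k => k * a % s) (range s : Finset ℕ) := by
    intro x hx y hy hxy
    simp only [coe_range, Set.mem_Iio] at hx hy
    have h2 : x * a ≡ y * a [MOD s] := hxy
    have h3 : x ≡ y [MOD s] := Nat.ModEq.cancel_right_of_coprime (by rwa [Nat.coprime_comm] at h) h2
    exact Nat.ModEq.eq_of_lt_of_lt h3 hx hy
  have himg : (range s).image (fun k => k * a % s) = range s := by
    apply eq_of_subset_of_card_le
    · intro x hx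
      obtain ⟨k, _, rfl⟩ := mem_image.1 hx
      exact mem_range.2 (Nat.mod_lt _ hs)
    · rw [card_image_of_injOn hinj]
  have h1 : ∑ k ∈ range s, recip a s k = ∑ j ∈ range s, g j := by
    conv_rhs => rw [← himg, sum_image hinj]
    refine sum_congr rfl fun k hk => ?_
    have h4 : k * a % s = 0 ↔ s ∣ k := by
      rw [← Nat.dvd_iff_mod_eq_zero]
      exact ⟨fun h5 => (Nat.Coprime.symm h).dvd_of_dvd_mul_right h5, fun h5 => Dvd.dvd.mul_right h5 a⟩
    simp only [hg, recip, h4]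
    split_ifs
    · rfl
    · congr 1
      have h5 : ((k * a : ℕ) : ℝ) = ((s * (k * a / s) + k * a % s : ℕ) : ℝ) := by
        rw [Nat.div_add_mod]
      push_cast at h5
      have h6 : (k : ℝ) * (a / s) = ((k * a % s : ℕ) : ℝ) / s + (((k * a / s : ℕ) : ℤ) : ℝ) := by
        rw [Int.cast_natCast]; field_simp; rw [h5]; ring
      rw [h6, nd_add_int]
  rw [h1]
  have h7 : ∑ j ∈ range s, g j = ∑ j ∈ Icc 1 (s - 1), g j := by
    symm
    apply sum_subset
    · intro j; rw [mem_Icc, mem_range]; omega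
    · intro j hj hj'
      have : j = 0 := by rw [mem_Icc] at hj'; rw [mem_range] at hj; omega
      simp [hg, this]
  have h8 : ∑ j ∈ Icc 1 (s - 1), g j ≤
      ∑ j ∈ Icc 1 (s - 1), (s * (1 / (j : ℝ)) + s * (1 / ((s - j : ℕ) : ℝ))) := by
    refine sum_le_sum fun j hj => ?_
    rw [mem_Icc] at hj
    simp only [hg]
    rw [if_neg (by omega)]
    exact inv_nd_div_le (by omega) (by omega)
  have h9 : ∑ j ∈ Icc 1 (s - 1), (s : ℝ) * (1 / ((s - j : ℕ) : ℝ)) =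
      ∑ j ∈ Icc 1 (s - 1), (s : ℝ) * (1 / (j : ℝ)) := by
    apply sum_nbij' (fun j => s - j) (fun j => s - j)
    · intro j; simp only [mem_Icc]; omega
    · intro j; simp only [mem_Icc]; omega
    · intro j; simp only [mem_Icc]; omega
    · intro j; simp only [mem_Icc]; omega
    · intro j _; rfl
  rw [sum_add_distrib, h9, ← mul_sum] at h8
  have h10 : ∑ j ∈ Icc 1 (s - 1), (1 : ℝ) / j ≤ 1 + Real.log s := by
    refine le_trans ?_ (sum_inv_le s)
    apply sum_le_sum_of_subset_of_nonneg
    · intro j; simp only [mem_Icc]; omega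
    · intro j _ _; positivity
  rw [h7]
  have : (s : ℝ) * ∑ j ∈ Icc 1 (s - 1), (1 : ℝ) / j ≤ s * (1 + Real.log s) :=
    mul_le_mul_of_nonneg_left h10 (by positivity)
  linarith

lemma sum_Icc_recip_le {a s : ℕ} (hs : 0 < s) (h : a.Coprime s) (K : ℕ) :
    ∑ k ∈ Icc 1 K, recip a s k ≤ (K / s + 1) * (2 * s * (1 + Real.log s)) := by
  have hs' : (0 : ℝ) < s := by positivity
  have hper : ∀ b : ℕ, ∑ k ∈ range (b * s), recip a s k = b * ∑ k ∈ range s, recip a s k := by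
    intro b
    induction b with
    | zero => simp
    | succ b ih =>
      rw [Nat.succ_mul, sum_range_add, ih]
      simp only [recip_add_mul a hs]
      push_cast; ring
  calc ∑ k ∈ Icc 1 K, recip a s k ≤ ∑ k ∈ range ((K / s + 1) * s), recip a s k := by
        apply sum_le_sum_of_subset_of_nonneg
        · intro k
          rw [mem_Icc, mem_range]
          have h2 := Nat.div_add_mod K s
          have h3 := Nat.mod_lt K hs
          intro hk
          rw [add_mul, one_mul, mul_comm]; omega
        · intro k _ _; exact recip_nonneg _ _ _
    _ = ((K / s + 1 : ℕ) : ℝ) * ∑ k ∈ range s, recip a s k := hper _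
    _ ≤ ((K / s + 1 : ℕ) : ℝ) * (2 * s * (1 + Real.log s)) :=
        mul_le_mul_of_nonneg_left (sum_range_recip_le hs h) (by positivity)
    _ ≤ _ := by
        apply mul_le_mul_of_nonneg_right
        · push_cast; gcongr; exact Nat.cast_div_le
        · have : 0 ≤ Real.log s := Real.log_natCast_nonneg s
          positivity

/-- `Y/k` at the multiples of `s`, and `1/‖k a/s‖` elsewhere. -/
noncomputable def capRecip (Y : ℝ) (a s k : ℕ) : ℝ := if s ∣ k then Y / k else recip a s k

lemma capRecip_nonneg {Y : ℝ} (hY : 0 ≤ Y) (a s k : ℕ) : 0 ≤ capRecip Y a s k := by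
  unfold capRecip; split_ifs
  · positivity
  · exact recip_nonneg _ _ _

lemma sum_capRecip_le {a s : ℕ} (hs : 0 < s) (h : a.Coprime s) {Y : ℝ} (hY : 0 ≤ Y) (K : ℕ) :
    ∑ k ∈ Icc 1 K, capRecip Y a s k ≤
      Y / s * (1 + Real.log K) + (K / s + 1) * (2 * s * (1 + Real.log s)) := by
  have hs' : (0 : ℝ) < s := by positivity
  have h1 : ∀ k, capRecip Y a s k = (if s ∣ k then Y / k else 0) + recip a s k := by
    intro k; unfold capRecip
    split_ifs with h0
    · rw [recip, if_pos h0, add_zero]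
    · rw [zero_add]
  simp only [h1]
  rw [sum_add_distrib]
  refine add_le_add ?_ (sum_Icc_recip_le hs h K)
  rw [← sum_filter]
  calc ∑ k ∈ Icc 1 K with s ∣ k, Y / (k : ℝ) = ∑ b ∈ Icc 1 (K / s), Y / ((s * b : ℕ) : ℝ) := by
        symm
        apply sum_nbij' (fun b => s * b) (fun k => k / s)
        · intro b hb
          rw [mem_Icc] at hb
          rw [mem_filter, mem_Icc]
          refine ⟨⟨Nat.mul_pos hs (by omega), ?_⟩, Dvd.intro b rfl⟩
          rw [mul_comm]; exact (Nat.le_div_iff_mul_le hs).1 hb.2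
        · intro k hk
          rw [mem_filter, mem_Icc] at hk
          rw [mem_Icc]
          exact ⟨Nat.div_pos (Nat.le_of_dvd (by omega) hk.2) hs, Nat.div_le_div_right hk.1.2⟩
        · intro b _; exact Nat.mul_div_cancel_left b hs
        · intro k hk; exact Nat.mul_div_cancel' (mem_filter.1 hk).2
        · intro b _; rfl
    _ = Y / s * ∑ b ∈ Icc 1 (K / s), 1 / (b : ℝ) := by
        rw [mul_sum]; refine sum_congr rfl fun b _ => ?_
        push_cast; rw [div_mul_div_comm, mul_one]
    _ ≤ Y / s * (1 + Real.log K) := by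
        apply mul_le_mul_of_nonneg_left _ (by positivity)
        refine le_trans ?_ (sum_inv_le K)
        apply sum_le_sum_of_subset_of_nonneg
        · exact Icc_subset_Icc_right (Nat.div_le_self K s)
        · intro j _ _; positivity

/-! ### Dyadic ranges -/

lemma mem_dyadic {R : ℝ} {r : ℕ} : r ∈ dyadic R ↔ R ≤ r ∧ (r : ℝ) < 2 * R := by
  unfold dyadic
  rw [mem_Ico, Nat.ceil_le, Nat.lt_ceil]

lemma card_dyadic_le {R : ℝ} (hR : 1 ≤ R) : (#(dyadic R) : ℝ) ≤ 2 * R := by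
  unfold dyadic
  rw [Nat.card_Ico]
  have h1 := Nat.ceil_lt_add_one (show 0 ≤ 2 * R by linarith)
  have h2 := Nat.le_ceil R
  rcases le_total ⌈R⌉₊ ⌈2 * R⌉₊ with h | h
  · rw [Nat.cast_sub h]; linarith
  · rw [Nat.sub_eq_zero_of_le h]; simp; linarith

/-- The gcd is bounded by the sum of all common divisors of a and r. A divisor d of a has at most
2R/d multiples in the range, so it contributes at most 2R. -/
lemma sum_dyadic_gcd_le {R : ℝ} (hR : 1 ≤ R) {a : ℕ} (ha : 0 < a) :
    ∑ r ∈ dyadic R, (a.gcd r : ℝ) ≤ 2 * R * #a.divisors := by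
  have h1 : ∀ r ∈ dyadic R, (a.gcd r : ℝ) ≤ ∑ d ∈ a.divisors, if d ∣ r then (d : ℝ) else 0 := by
    intro r _
    have : (a.gcd r : ℝ) = if a.gcd r ∣ r then ((a.gcd r : ℕ) : ℝ) else 0 := by
      rw [if_pos (Nat.gcd_dvd_right a r)]
    rw [this]
    refine single_le_sum (f := fun d => if d ∣ r then (d : ℝ) else 0) (fun d _ => ?_) ?_
    · split_ifs <;> positivity
    · exact Nat.mem_divisors.2 ⟨Nat.gcd_dvd_left a r, ha.ne'⟩
  refine (sum_le_sum h1).trans ?_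
  rw [sum_comm]
  have h2 : ∀ d ∈ a.divisors, ∑ r ∈ dyadic R, (if d ∣ r then (d : ℝ) else 0) ≤ 2 * R := by
    intro d hd
    have hd0 : 0 < d := Nat.pos_of_mem_divisors hd
    rw [← sum_filter, sum_const, nsmul_eq_mul]
    have h3 : #{r ∈ dyadic R | d ∣ r} ≤ ⌊2 * R⌋₊ / d := by
      rw [← Nat.card_multiples]
      -- `Nat.card_multiples` counts the e with d ∣ e + 1, hence the shift by one.
      apply card_le_card_of_injOn (fun r => r - 1)
      · intro r hr
        simp only [coe_filter, Set.mem_ofPred_eq, mem_dyadic] at hr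
        have hr1 : 1 ≤ r := by
          have : (1 : ℝ) ≤ r := hR.trans hr.1.1
          exact_mod_cast this
        have hr2 : r ≤ ⌊2 * R⌋₊ := Nat.le_floor hr.1.2.le
        simp only [coe_filter, Set.mem_ofPred_eq, mem_range]
        rw [Nat.sub_add_cancel hr1]
        exact ⟨by omega, hr.2⟩
      · intro x hx y hy hxy
        simp only [coe_filter, Set.mem_ofPred_eq, mem_dyadic] at hx hy hxy
        have hx1 : 1 ≤ x := by
          have : (1 : ℝ) ≤ x := hR.trans hx.1.1
          exact_mod_cast this
        have hy1 : 1 ≤ y := by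
          have : (1 : ℝ) ≤ y := hR.trans hy.1.1
          exact_mod_cast this
        omega
    have h4 : (#{r ∈ dyadic R | d ∣ r} : ℝ) * d ≤ ⌊2 * R⌋₊ := by
      have : #{r ∈ dyadic R | d ∣ r} * d ≤ ⌊2 * R⌋₊ :=
        (Nat.mul_le_mul_right d h3).trans (Nat.div_mul_le_self _ _)
      exact_mod_cast this
    exact h4.trans (Nat.floor_le (by linarith))
  refine (sum_le_sum h2).trans ?_
  rw [sum_const, nsmul_eq_mul, mul_comm]

/-! ### Standing assumptions and the quantities to be bounded -/

/-- The standing assumptions, with `X = u ^ 12`; `B` dominates all divisor functions and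
logarithms that occur. -/
structure Ctx (κ u R L T B : ℝ) (a q : ℕ) : Prop where
  one_le_kappa : 1 ≤ κ
  one_le_u : 1 ≤ u
  one_le_R : 1 ≤ R
  one_le_L : 1 ≤ L
  L_le_T : L ≤ T
  R_le_T : R ≤ T
  coprime : a.Coprime q
  a_pos : 0 < a
  q_pos : 0 < q
  q_le_a : (q : ℝ) ≤ κ * a
  a_le_q : (a : ℝ) ≤ κ * q
  T_le : T * u ^ 4 ≤ κ * R * q
  q_le : (q : ℝ) ≤ κ * u ^ 8
  R_le : R ≤ 2 * κ * u ^ 12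
  B_ge : 16 ≤ B
  kappa_le_B : κ ≤ B
  divisors_le : ∀ n : ℕ, 0 < n → (n : ℝ) ≤ 10 ^ 4 * κ ^ 8 * u ^ 48 → (#n.divisors : ℝ) ≤ B
  log_le : 1 + Real.log (10 ^ 4 * κ ^ 8 * u ^ 48) ≤ B

/-- The target bound. -/
noncomputable def target (u R T : ℝ) : ℝ := u ^ 8 * (T * R) + u ^ 11 * √(T * R)

/-- `∑_{r ∼ R} ∑_{l ∼ L} |∑_{n ≤ N_r} f(n) e(anl/(rq))|`. -/
noncomputable def errSum (R L : ℝ) (a q : ℕ) (N : ℕ → ℕ) (f : ArithmeticFunction ℝ) : ℝ :=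
  ∑ r ∈ dyadic R, ∑ l ∈ dyadic L,
    ‖∑ n ∈ Icc 1 (N r), (f n : ℂ) * e (n * (l * ((a : ℝ) / (r * q))))‖

/-! ### Linear sums -/

/-- `Y` if `x` is an integer, and the inverse of its distance to the integers otherwise. -/
noncomputable def cap (Y x : ℝ) : ℝ := if nd x = 0 then Y else 1 / nd x

lemma cap_nonneg {Y : ℝ} (hY : 0 ≤ Y) (x : ℝ) : 0 ≤ cap Y x := by
  unfold cap; split_ifs
  · exact hY
  · have := nd_nonneg x; positivity

lemma norm_sum_Ico_e_le_cap {A C : ℕ} {Y : ℝ} (h : ((C - A : ℕ) : ℝ) ≤ Y) (x : ℝ) :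
    ‖∑ n ∈ Ico A C, e (n * x)‖ ≤ cap Y x := by
  unfold cap
  split_ifs with h0
  · refine (norm_sum_e_le_card _ _).trans ?_
    simpa using h
  · have hp : 0 < nd x := lt_of_le_of_ne (nd_nonneg x) (Ne.symm h0)
    refine (norm_sum_Ico_e_le A C hp).trans ?_
    apply one_div_le_one_div_of_le hp; linarith

/-- The right side depends on l and m only through k = lm, which allows them to be merged. When s
divides lm, this uses X/m = lX/(lm). -/
lemma cap_le_capRecip {a s l m : ℕ} (hs : 0 < s) (h : a.Coprime s) {X L : ℝ} (hX : 0 ≤ X)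
    (hl : (l : ℝ) ≤ L) (hl0 : 0 < l) (hm : 0 < m) :
    cap (X / m) (m * (l * ((a : ℝ) / s))) ≤ capRecip (L * X) a s (l * m) := by
  have hs' : (s : ℝ) ≠ 0 := by positivity
  have e1 : (m : ℝ) * (l * ((a : ℝ) / s)) = ((l * m : ℕ) : ℝ) * (a / s) := by push_cast; ring
  unfold cap capRecip recip
  rw [e1]
  have hiff : nd (((l * m : ℕ) : ℝ) * (a / s)) = 0 ↔ s ∣ l * m := by
    constructor
    · intro h0
      unfold nd at h0
      rw [abs_eq_zero, sub_eq_zero] at h0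
      have h1 : (((l * m * a : ℕ) : ℤ) : ℝ) = ((round (((l * m : ℕ) : ℝ) * (a / s)) * s : ℤ) : ℝ) := by
        conv_rhs => rw [Int.cast_mul, ← h0]
        push_cast; field_simp
      have h2 : ((l * m * a : ℕ) : ℤ) = round (((l * m : ℕ) : ℝ) * (a / s)) * s := by
        exact_mod_cast h1
      have h3 : s ∣ l * m * a := by
        rw [← Int.natCast_dvd_natCast, h2]; exact Dvd.intro_left _ rfl
      exact h.symm.dvd_of_dvd_mul_right h3
    · rintro ⟨c, hc⟩
      rw [hc]
      have : ((s * c : ℕ) : ℝ) * (a / s) = ((c * a : ℕ) : ℤ) := by push_cast; field_simp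
      rw [this]; unfold nd; rw [round_intCast, sub_self, abs_zero]
  simp only [hiff]
  split_ifs with h0
  · have hl' : (0 : ℝ) < l := by exact_mod_cast hl0
    have hm' : (0 : ℝ) < m := by exact_mod_cast hm
    push_cast
    rw [div_le_div_iff₀ hm' (by positivity)]
    nlinarith [mul_nonneg hX hm'.le]
  · exact le_rfl

/-- As a is coprime to q, only the gcd of a and r cancels from a/(rq). -/
lemma exists_reduced {a q r : ℕ} (h : a.Coprime q) (ha : 0 < a) (hq : 0 < q) (hr : 0 < r) :
    ∃ a' s : ℕ, 0 < s ∧ a'.Coprime s ∧ (a : ℝ) / (r * q) = (a' : ℝ) / s ∧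
      s * a.gcd r = r * q := by
  have hg : 0 < a.gcd r := Nat.gcd_pos_of_pos_left r ha
  obtain ⟨a', ha'⟩ := Nat.gcd_dvd_left a r
  obtain ⟨r', hr'⟩ := Nat.gcd_dvd_right a r
  have hr0 : 0 < r' := by
    rcases Nat.eq_zero_or_pos r' with h0 | h0
    · rw [h0, mul_zero] at hr'; omega
    · exact h0
  have hcop : a'.Coprime r' := by
    have := Nat.coprime_div_gcd_div_gcd hg
    rwa [Nat.div_eq_of_eq_mul_right hg ha', Nat.div_eq_of_eq_mul_right hg hr'] at this
  have hcop2 : a'.Coprime q := Nat.Coprime.coprime_dvd_left ⟨_, ha'.trans (mul_comm _ _)⟩ h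
  refine ⟨a', r' * q, Nat.mul_pos hr0 hq, hcop.mul_right hcop2, ?_, ?_⟩
  · have e1 : (a : ℝ) = (a.gcd r : ℝ) * a' := by exact_mod_cast ha'
    have e2 : (r : ℝ) = (a.gcd r : ℝ) * r' := by exact_mod_cast hr'
    have hg' : (a.gcd r : ℝ) ≠ 0 := by positivity
    have h3 : (r' : ℝ) ≠ 0 := by positivity
    have h4 : (q : ℝ) ≠ 0 := by positivity
    generalize (a.gcd r : ℝ) = g at *
    rw [e1, e2]; push_cast; field_simp
  · conv_rhs => rw [hr']
    ring

namespace Ctx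

variable {κ u R L T B : ℝ} {a q : ℕ}

/-- All integers to which the divisor and logarithm bounds are applied are compared with one
generous monomial; this performs the comparison. -/
lemma small (h : Ctx κ u R L T B a q) {c : ℝ} {i j : ℕ} (hc : c ≤ 10 ^ 4)
    (hi : i ≤ 8) (hj : j ≤ 48) : c * κ ^ i * u ^ j ≤ 10 ^ 4 * κ ^ 8 * u ^ 48 := by
  have hκ := h.one_le_kappa
  have hu := h.one_le_u
  have h1 : κ ^ i ≤ κ ^ 8 := pow_le_pow_right₀ hκ hi
  have h2 : u ^ j ≤ u ^ 48 := pow_le_pow_right₀ hu hj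
  gcongr

lemma T_le' (h : Ctx κ u R L T B a q) : T ≤ 2 * κ ^ 3 * u ^ 16 := by
  have hκ := h.one_le_kappa
  have hu := h.one_le_u
  have hu4 : 0 < u ^ 4 := by positivity
  have hR := h.one_le_R
  have : T * u ^ 4 ≤ (2 * κ ^ 3 * u ^ 16) * u ^ 4 := by
    calc T * u ^ 4 ≤ κ * R * q := h.T_le
      _ ≤ κ * (2 * κ * u ^ 12) * (κ * u ^ 8) := by
          gcongr
          · exact h.R_le
          · exact h.q_le
      _ = _ := by ring
  exact le_of_mul_le_mul_right this hu4

lemma log_nat_le (h : Ctx κ u R L T B a q) {n : ℕ} (hn : 0 < n)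
    (hle : (n : ℝ) ≤ 10 ^ 4 * κ ^ 8 * u ^ 48) : 1 + Real.log n ≤ B := by
  refine le_trans ?_ h.log_le
  have : Real.log n ≤ Real.log (10 ^ 4 * κ ^ 8 * u ^ 48) :=
    Real.log_le_log (by exact_mod_cast hn) hle
  linarith

lemma B_pos (h : Ctx κ u R L T B a q) : 0 < B := by linarith [h.B_ge]

lemma T_pos (h : Ctx κ u R L T B a q) : 0 < T := by linarith [h.one_le_R, h.R_le_T]

lemma pos_of_mem (h : Ctx κ u R L T B a q) {r : ℕ} (hr : r ∈ dyadic R) : 0 < r := by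
  have : (1 : ℝ) ≤ r := h.one_le_R.trans (mem_dyadic.1 hr).1
  exact_mod_cast this

lemma pos_of_mem' (h : Ctx κ u R L T B a q) {l : ℕ} (hl : l ∈ dyadic L) : 0 < l := by
  have : (1 : ℝ) ≤ l := h.one_le_L.trans (mem_dyadic.1 hl).1
  exact_mod_cast this

lemma target_nonneg (h : Ctx κ u R L T B a q) : 0 ≤ target u R T := by
  have := h.T_pos
  have := h.one_le_u
  have := h.one_le_R
  unfold target; positivity

lemma le_target (h : Ctx κ u R L T B a q) : u ^ 8 * (T * R) ≤ target u R T := by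
  have := h.T_pos
  have := h.one_le_u
  unfold target
  have : 0 ≤ u ^ 11 * √(T * R) := by positivity
  linarith

/-- Merging k = lm costs a divisor function. Of the three terms, the first comes from k divisible by
the reduced denominator s = rq/(a,r), the other two from the K/s + 1 periods of length s. -/
lemma sum_cap_row_le (h : Ctx κ u R L T B a q) {r : ℕ} (hr : r ∈ dyadic R) :
    ∑ l ∈ dyadic L, ∑ m ∈ Icc 1 ⌊u ^ 8⌋₊,
      cap (u ^ 12 / m) (m * (l * ((a : ℝ) / (r * q)))) ≤
    B ^ 2 * (2 * (L * u ^ 12) / (R * q) * a.gcd r + 4 * (L * u ^ 8) + 4 * (R * q)) := by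
  have hκ := h.one_le_kappa
  have hu := h.one_le_u
  have hR := h.one_le_R
  have hL := h.one_le_L
  have hB := h.B_pos
  have hq0 : (0 : ℝ) < q := by exact_mod_cast h.q_pos
  have hr0 := h.pos_of_mem hr
  obtain ⟨hr1, hr2⟩ := mem_dyadic.1 hr
  obtain ⟨a', s, hs, hcop, hθ, hsg⟩ := exists_reduced h.coprime h.a_pos h.q_pos hr0
  have hs' : (0 : ℝ) < s := by exact_mod_cast hs
  have hg : 0 < a.gcd r := Nat.gcd_pos_of_pos_left r h.a_pos
  have hsg' : (s : ℝ) * a.gcd r = r * q := by exact_mod_cast hsg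
  have hg' : (1 : ℝ) ≤ a.gcd r := by exact_mod_cast hg
  have hsle : (s : ℝ) ≤ 2 * (R * q) := by nlinarith
  set K : ℕ := ⌊2 * L * u ^ 8⌋₊ with hK
  have hKle : (K : ℝ) ≤ 2 * L * u ^ 8 := Nat.floor_le (by positivity)
  have hKbd : (K : ℝ) ≤ 10 ^ 4 * κ ^ 8 * u ^ 48 := by
    calc (K : ℝ) ≤ 2 * L * u ^ 8 := hKle
      _ ≤ 2 * (2 * κ ^ 3 * u ^ 16) * u ^ 8 := by
          have := h.L_le_T.trans h.T_le'
          gcongr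
      _ = 4 * κ ^ 3 * u ^ 24 := by ring
      _ ≤ _ := h.small (by norm_num) (by norm_num) (by norm_num)
  have hsbd : (s : ℝ) ≤ 10 ^ 4 * κ ^ 8 * u ^ 48 := by
    calc (s : ℝ) ≤ 2 * (R * q) := hsle
      _ ≤ 2 * ((2 * κ * u ^ 12) * (κ * u ^ 8)) := by
          have := h.R_le; have := h.q_le
          gcongr
      _ = 4 * κ ^ 2 * u ^ 20 := by ring
      _ ≤ _ := h.small (by norm_num) (by norm_num) (by norm_num)
  have hX : 0 ≤ u ^ 12 := by positivity
  have step1 : ∑ l ∈ dyadic L, ∑ m ∈ Icc 1 ⌊u ^ 8⌋₊,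
      cap (u ^ 12 / m) (m * (l * ((a : ℝ) / (r * q)))) ≤
      ∑ p ∈ dyadic L ×ˢ Icc 1 ⌊u ^ 8⌋₊, capRecip (2 * L * u ^ 12) a' s (p.1 * p.2) := by
    rw [sum_product, hθ]
    refine sum_le_sum fun l hl => sum_le_sum fun m hm => ?_
    exact cap_le_capRecip hs hcop hX (mem_dyadic.1 hl).2.le (h.pos_of_mem' hl) (mem_Icc.1 hm).1
  have step2 : ∑ p ∈ dyadic L ×ˢ Icc 1 ⌊u ^ 8⌋₊, capRecip (2 * L * u ^ 12) a' s (p.1 * p.2) ≤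
      B * ∑ k ∈ Icc 1 K, capRecip (2 * L * u ^ 12) a' s k := by
    apply sum_comp_le_mul_sum _ _ (fun p : ℕ × ℕ => p.1 * p.2)
    · rintro ⟨l, m⟩ hp
      rw [mem_product, mem_Icc] at hp
      simp only at hp ⊢
      have hl0 := h.pos_of_mem' hp.1
      rw [mem_Icc]
      refine ⟨Nat.mul_pos hl0 hp.2.1, Nat.le_floor ?_⟩
      have h1 : (l : ℝ) ≤ 2 * L := (mem_dyadic.1 hp.1).2.le
      have h2 : (m : ℝ) ≤ u ^ 8 := (Nat.le_floor_iff (by positivity)).1 hp.2.2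
      push_cast; gcongr
    · intro k _; exact capRecip_nonneg (by positivity) _ _ _
    · intro k hk
      rw [mem_Icc] at hk
      have h1 : (k : ℝ) ≤ K := by exact_mod_cast hk.2
      refine le_trans ?_ (h.divisors_le k hk.1 (h1.trans hKbd))
      exact_mod_cast card_pairs_mul_eq_le _ hk.1
  have step3 := sum_capRecip_le hs hcop (show 0 ≤ 2 * L * u ^ 12 by positivity) K
  have hK1 : 0 < K := Nat.floor_pos.2 (by nlinarith [one_le_pow₀ hu (n := 8)])
  have hlogK := h.log_nat_le hK1 hKbd
  have hlogs := h.log_nat_le hs hsbd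
  have hsR : R * q ≤ s * a.gcd r := by rw [hsg']; gcongr
  have t1 : 2 * L * u ^ 12 / s ≤ 2 * (L * u ^ 12) / (R * q) * a.gcd r := by
    rw [div_mul_eq_mul_div, div_le_div_iff₀ hs' (by positivity)]
    calc 2 * L * u ^ 12 * (R * q) ≤ 2 * L * u ^ 12 * (s * a.gcd r) := by gcongr
      _ = _ := by ring
  have t2 : ((K : ℝ) / s + 1) * (2 * s * (1 + Real.log s)) ≤ B * (4 * (L * u ^ 8) + 4 * (R * q)) := by
    have : ((K : ℝ) / s + 1) * (2 * s * (1 + Real.log s)) = (1 + Real.log s) * (2 * K + 2 * s) := by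
      field_simp
    rw [this]
    gcongr ?_ * ?_
    linarith
  have t3 : 2 * L * u ^ 12 / s * (1 + Real.log K) ≤
      B * (2 * (L * u ^ 12) / (R * q) * a.gcd r) := by
    rw [mul_comm]
    have : 0 ≤ Real.log K := Real.log_natCast_nonneg K
    gcongr
  calc _ ≤ _ := step1
    _ ≤ _ := step2
    _ ≤ B * (B * (2 * (L * u ^ 12) / (R * q) * a.gcd r) + B * (4 * (L * u ^ 8) + 4 * (R * q))) := by
        gcongr
        exact step3.trans (add_le_add t3 t2)
    _ = _ := by ring

/-- Averaged over r, the gcd of a and r is at most B in size. The first term is then about L u^12/q,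
and T u^4 ≤ κRq makes it acceptable; the last one uses q ≤ κu^8 and R ≤ T. -/
lemma sum_cap_le (h : Ctx κ u R L T B a q) :
    ∑ r ∈ dyadic R, ∑ l ∈ dyadic L, ∑ m ∈ Icc 1 ⌊u ^ 8⌋₊,
      cap (u ^ 12 / m) (m * (l * ((a : ℝ) / (r * q)))) ≤ B ^ 5 * target u R T := by
  have hκ := h.one_le_kappa
  have hu := h.one_le_u
  have hR := h.one_le_R
  have hL := h.one_le_L
  have hB := h.B_pos
  have hT := h.T_pos
  have hq0 : (0 : ℝ) < q := by exact_mod_cast h.q_pos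
  refine (sum_le_sum fun r hr => h.sum_cap_row_le hr).trans ?_
  rw [← mul_sum, sum_add_distrib, sum_add_distrib, ← mul_sum, sum_const, sum_const, nsmul_eq_mul,
    nsmul_eq_mul]
  have hc := card_dyadic_le hR
  have hqa : (a : ℝ) ≤ 10 ^ 4 * κ ^ 8 * u ^ 48 := by
    calc (a : ℝ) ≤ κ * q := h.a_le_q
      _ ≤ κ * (κ * u ^ 8) := by have := h.q_le; gcongr
      _ = 1 * κ ^ 2 * u ^ 8 := by ring
      _ ≤ _ := h.small (by norm_num) (by norm_num) (by norm_num)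
  have hg : ∑ r ∈ dyadic R, (a.gcd r : ℝ) ≤ 2 * R * B := by
    refine (sum_dyadic_gcd_le hR h.a_pos).trans ?_
    have := h.divisors_le a h.a_pos hqa
    gcongr
  have hW : u ^ 8 * (T * R) ≤ target u R T := h.le_target
  have k1 : 2 * (L * u ^ 12) / (R * q) * ∑ r ∈ dyadic R, (a.gcd r : ℝ) ≤
      4 * B ^ 2 * (u ^ 8 * (T * R)) := by
    calc _ ≤ 2 * (L * u ^ 12) / (R * q) * (2 * R * B) := by gcongr
      _ = 4 * B * (L * u ^ 8) * (u ^ 4 / q) := by field_simp; ring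
      _ ≤ 4 * B * (T * u ^ 8) * (u ^ 4 / q) := by
          have := h.L_le_T
          gcongr
      _ = 4 * B * u ^ 8 * (T * u ^ 4 / q) := by ring
      _ ≤ 4 * B * u ^ 8 * (κ * R) := by
          gcongr
          rw [div_le_iff₀ hq0]; exact h.T_le
      _ ≤ 4 * B * u ^ 8 * (B * (T * R)) := by
          have h1 := h.kappa_le_B
          have h2 : R ≤ T * R := le_mul_of_one_le_left (by linarith) (by linarith [h.R_le_T])
          gcongr
      _ = _ := by ring
  have k2 : (#(dyadic R) : ℝ) * (4 * (L * u ^ 8)) ≤ 8 * (u ^ 8 * (T * R)) := by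
    calc _ ≤ (2 * R) * (4 * (T * u ^ 8)) := by
          have := h.L_le_T
          gcongr
      _ = _ := by ring
  have k3 : (#(dyadic R) : ℝ) * (4 * (R * q)) ≤ 8 * B * (u ^ 8 * (T * R)) := by
    calc _ ≤ (2 * R) * (4 * (T * (B * u ^ 8))) := by
          have := h.R_le_T
          have h1 := h.kappa_le_B
          have : (q : ℝ) ≤ B * u ^ 8 := h.q_le.trans (by gcongr)
          gcongr
      _ = _ := by ring
  have hB16 := h.B_ge
  have hW0 : 0 ≤ u ^ 8 * (T * R) := by positivity
  calc _ ≤ B ^ 2 * (4 * B ^ 2 * (u ^ 8 * (T * R)) + 8 * (u ^ 8 * (T * R)) +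
        8 * B * (u ^ 8 * (T * R))) := by gcongr
    _ = B ^ 2 * (4 * B ^ 2 + 8 + 8 * B) * (u ^ 8 * (T * R)) := by ring
    _ ≤ B ^ 2 * B ^ 3 * (u ^ 8 * (T * R)) := by
        gcongr
        nlinarith
    _ = B ^ 5 * (u ^ 8 * (T * R)) := by ring
    _ ≤ _ := by gcongr

end Ctx

/-! ### Counting pairs of points with close frequencies -/

lemma card_Icc_modEq_le (K : ℕ) {m : ℕ} (S : Finset ℕ) (hS : S ⊆ Icc 1 K)
    (h : ∀ x ∈ S, ∀ y ∈ S, x ≡ y [MOD m]) : #S ≤ K / m + 1 := by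
  rw [← card_range (K / m + 1)]
  apply card_le_card_of_injOn (fun k => k / m)
  · intro k hk
    simp only [coe_range, Set.mem_Iio]
    have := (mem_Icc.1 (hS hk)).2
    exact Nat.lt_succ_of_le (Nat.div_le_div_right this)
  · intro x hx y hy hxy
    simp only at hxy
    have h1 : x % m = y % m := h x hx y hy
    rw [← Nat.div_add_mod x m, ← Nat.div_add_mod y m, hxy, h1]

/-- The equation fixes k r' modulo r, hence k modulo r/(r,r'), and k determines the other unknown.
-/
lemma card_linear_solutions_le (K : ℕ) {r r' : ℕ} (hr : 0 < r) (t : ℤ) :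
    #{p ∈ Icc 1 K ×ˢ Icc 1 K | (p.1 : ℤ) * r' - p.2 * r = t} ≤ K / (r / r.gcd r') + 1 := by
  set S := {p ∈ Icc 1 K ×ˢ Icc 1 K | (p.1 : ℤ) * r' - p.2 * r = t} with hS
  have hinj : Set.InjOn Prod.fst (S : Set (ℕ × ℕ)) := by
    rintro ⟨k, l⟩ hp ⟨k', l'⟩ hp' hk
    simp only [hS, coe_filter, Set.mem_ofPred_eq] at hp hp' hk
    subst hk
    have h1 : (l : ℤ) * r = l' * r := by linarith [hp.2, hp'.2]
    have h2 : (l : ℤ) = l' := mul_right_cancel₀ (by exact_mod_cast hr.ne') h1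
    have h3 : l = l' := by exact_mod_cast h2
    rw [h3]
  rw [← card_image_of_injOn hinj]
  apply card_Icc_modEq_le K
  · intro k hk
    obtain ⟨p, hp, rfl⟩ := mem_image.1 hk
    exact (mem_product.1 (mem_filter.1 hp).1).1
  · intro k hk k' hk'
    obtain ⟨p, hp, rfl⟩ := mem_image.1 hk
    obtain ⟨p', hp', rfl⟩ := mem_image.1 hk'
    have h1 := (mem_filter.1 hp).2
    have h2 := (mem_filter.1 hp').2
    apply Nat.ModEq.cancel_right_div_gcd hr (c := r')
    rw [← Int.natCast_modEq_iff]
    push_cast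
    rw [Int.modEq_iff_dvd]
    exact ⟨(p'.2 : ℤ) - p.2, by linarith⟩

/-- The pairs `(r, k)` with `r ∼ R` and `k ≤ K`. -/
noncomputable def pts (R : ℝ) (K : ℕ) : Finset (ℕ × ℕ) := dyadic R ×ˢ Icc 1 K

lemma mem_pts {R : ℝ} {K : ℕ} {p : ℕ × ℕ} :
    p ∈ pts R K ↔ (R ≤ p.1 ∧ (p.1 : ℝ) < 2 * R) ∧ 1 ≤ p.2 ∧ p.2 ≤ K := by
  unfold pts; rw [mem_product, mem_dyadic, mem_Icc]

lemma card_pts_le {R : ℝ} (hR : 1 ≤ R) (K : ℕ) : (#(pts R K) : ℝ) ≤ 2 * (R * K) := by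
  unfold pts; rw [card_product, Nat.card_Icc]; push_cast
  have := card_dyadic_le hR
  calc (#(dyadic R) : ℝ) * ((K + 1 - 1 : ℕ) : ℝ) ≤ 2 * R * K := by simp; gcongr
    _ = _ := by ring

/-- The determinant `k r' - k' r` of two points. -/
def det (p : (ℕ × ℕ) × (ℕ × ℕ)) : ℤ := (p.1.2 : ℤ) * p.2.1 - p.2.2 * p.1.1

lemma abs_det_le {R : ℝ} {K : ℕ} {p : (ℕ × ℕ) × (ℕ × ℕ)} (hp : p ∈ pts R K ×ˢ pts R K) :
    |(det p : ℝ)| ≤ 2 * (R * K) := by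
  rw [mem_product, mem_pts, mem_pts] at hp
  obtain ⟨⟨⟨h1, h2⟩, h3, h4⟩, ⟨h5, h6⟩, h7, h8⟩ := hp
  unfold det; push_cast
  have h4' : (p.1.2 : ℝ) ≤ K := by exact_mod_cast h4
  have h8' : (p.2.2 : ℝ) ≤ K := by exact_mod_cast h8
  have a1 : (p.1.2 : ℝ) * p.2.1 ≤ K * (2 * R) := by gcongr
  have a2 : (p.2.2 : ℝ) * p.1.1 ≤ K * (2 * R) := by gcongr
  have a3 : 0 ≤ (p.1.2 : ℝ) * p.2.1 := by positivity
  have a4 : 0 ≤ (p.2.2 : ℝ) * p.1.1 := by positivity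
  rw [abs_le]; constructor <;> linarith

/-- Pairs of points with small determinant. -/
lemma card_det_small_le {R : ℝ} (hR : 1 ≤ R) (K W : ℕ) {B : ℝ} (hB0 : 0 ≤ B)
    (hB : ∀ n : ℕ, 0 < n → (n : ℝ) ≤ 2 * (R * K) → (#n.divisors : ℝ) ≤ B) :
    (#{p ∈ pts R K ×ˢ pts R K | |det p| ≤ W} : ℝ) ≤ B * (2 * (R * K) * (2 * W + 1)) := by
  set T := (pts R K) ×ˢ Icc (-(W : ℤ)) W with hT
  -- Once r', k and the determinant t are given, k'r = kr' - t is a known positive integer, so r is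
  -- one of its divisors and k' follows.
  have h1 := card_le_mul_card {p ∈ pts R K ×ˢ pts R K | |det p| ≤ W} T
    (fun p => ((p.2.1, p.1.2), det p)) ?_ (B := B) ?_
  · refine h1.trans (mul_le_mul_of_nonneg_left ?_ hB0)
    rw [hT, card_product, Int.card_Icc]
    have h2 := card_pts_le hR K
    have h3 : (((W : ℤ) + 1 - -(W : ℤ)).toNat : ℝ) = 2 * W + 1 := by
      rw [show ((W : ℤ) + 1 - -(W : ℤ)) = ((2 * W + 1 : ℕ) : ℤ) by push_cast; ring, Int.toNat_natCast]
      push_cast; ring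
    push_cast; rw [h3]; gcongr
  · intro p hp
    rw [mem_filter, mem_product, mem_pts, mem_pts] at hp
    rw [hT, mem_product, mem_pts, mem_Icc]
    exact ⟨⟨hp.1.2.1, hp.1.1.2⟩, abs_le.1 hp.2⟩
  · rintro ⟨⟨r', k⟩, t⟩ hw
    rcases eq_empty_or_nonempty {i ∈ {p ∈ pts R K ×ˢ pts R K | |det p| ≤ W} |
      ((i.2.1, i.1.2), det i) = ((r', k), t)} with h0 | ⟨p0, hp0⟩
    · rw [h0]; simpa using hB0
    · rw [mem_filter, mem_filter] at hp0
      obtain ⟨⟨hp01, _⟩, hp02⟩ := hp0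
      set n := p0.1.1 * p0.2.2 with hn
      rw [mem_product, mem_pts, mem_pts] at hp01
      have hn0 : 0 < n := by
        have : (1 : ℝ) ≤ p0.1.1 := hR.trans hp01.1.1.1
        have : 1 ≤ p0.1.1 := by exact_mod_cast this
        exact Nat.mul_pos this hp01.2.2.1
      have hnle : (n : ℝ) ≤ 2 * (R * K) := by
        rw [hn]; push_cast
        have h4 : (p0.2.2 : ℝ) ≤ K := by exact_mod_cast hp01.2.2.2
        calc (p0.1.1 : ℝ) * p0.2.2 ≤ (2 * R) * K := by
              have := hp01.1.1.2.le
              gcongr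
          _ = _ := by ring
      refine le_trans ?_ (hB n hn0 hnle)
      rw [Nat.cast_le]
      simp only [Prod.mk.injEq] at hp02
      have key : ∀ p ∈ {i ∈ {p ∈ pts R K ×ˢ pts R K | |det p| ≤ W} |
          ((i.2.1, i.1.2), det i) = ((r', k), t)}, p.1.1 * p.2.2 = n ∧ p.2.1 = r' ∧ p.1.2 = k := by
        intro p hp
        rw [mem_filter] at hp
        have hp2 := hp.2
        simp only [Prod.mk.injEq] at hp2
        refine ⟨?_, hp2.1⟩
        have e1 := hp2.2
        have e2 := hp02.2
        unfold det at e1 e2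
        rw [hp2.1.1, hp2.1.2] at e1
        rw [hp02.1.1, hp02.1.2] at e2
        have : ((p.1.1 * p.2.2 : ℕ) : ℤ) = n := by rw [hn]; push_cast; linarith
        exact_mod_cast this
      apply card_le_card_of_injOn (fun p => p.1.1)
      · intro p hp
        simp only [mem_coe, Nat.mem_divisors]
        exact ⟨⟨p.2.2, (key p hp).1.symm⟩, hn0.ne'⟩
      · rintro ⟨⟨x1, x2⟩, ⟨x3, x4⟩⟩ hx ⟨⟨y1, y2⟩, ⟨y3, y4⟩⟩ hy hxy
        obtain ⟨k1, k2, k3⟩ := key _ hx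
        obtain ⟨l1, l2, l3⟩ := key _ hy
        simp only at k1 k2 k3 l1 l2 l3 hxy
        subst hxy
        have hx0 : 0 < x1 := by
          rcases Nat.eq_zero_or_pos x1 with h0 | h0
          · rw [h0, zero_mul] at k1; omega
          · exact h0
        have : x4 = y4 := Nat.eq_of_mul_eq_mul_left hx0 (k1.trans l1.symm)
        rw [this, k2, k3, l2, l3]

lemma card_Icc_erase_zero (n : ℕ) : #((Icc (-(n : ℤ)) n).erase 0) = 2 * n := by
  rw [card_erase_of_mem (by rw [mem_Icc]; omega), Int.card_Icc]; omega

/-- Solutions of `a ∣ z + q y` in a box, with `y ≠ 0`. -/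
lemma card_box_le {a q : ℕ} (ha : 0 < a) (h : a.Coprime q) (Y Z : ℕ) :
    (#{p ∈ Icc (-(Y : ℤ)) Y ×ˢ Icc (-(Z : ℤ)) Z | p.1 ≠ 0 ∧ (a : ℤ) ∣ p.2 + q * p.1} : ℝ) ≤
      2 * Z * (2 * Y / a + 1) + 2 * Y / a := by
  have ha' : (0 : ℤ) < a := by exact_mod_cast ha
  have haq : IsCoprime (a : ℤ) q := Nat.isCoprime_iff_coprime.2 h
  set S := {p ∈ Icc (-(Y : ℤ)) Y ×ˢ Icc (-(Z : ℤ)) Z | p.1 ≠ 0 ∧ (a : ℤ) ∣ p.2 + q * p.1} with hS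
  have hsplit : #S ≤ #{p ∈ S | p.2 = 0} + #{p ∈ S | p.2 ≠ 0} :=
    (card_filter_add_card_filter_not (fun p : ℤ × ℤ => p.2 = 0)).symm.le
  -- The line z = 0 is counted apart: there a divides y ≠ 0, so no "+1" arises. Every term of the
  -- bound is then proportional to Y or Z, which is what yields the decay in h when the box is
  -- shrunk by h.
  have h0 : #{p ∈ S | p.2 = 0} ≤ 2 * (Y / a) := by
    rw [← card_Icc_erase_zero]
    apply card_le_card_of_injOn (fun p : ℤ × ℤ => p.1 / (a : ℤ))
    · rintro ⟨y, z⟩ hp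
      simp only [hS, coe_filter, Set.mem_ofPred_eq, mem_filter, mem_product, mem_Icc] at hp
      obtain ⟨⟨⟨⟨h1, h2⟩, _⟩, h3, h4⟩, h5⟩ := hp
      rw [h5, zero_add] at h4
      obtain ⟨c, rfl⟩ := haq.dvd_of_dvd_mul_left h4
      simp only [mem_coe, mem_erase, mem_Icc]
      rw [Int.mul_ediv_cancel_left _ ha'.ne']
      push_cast
      refine ⟨by rintro rfl; simp at h3, ?_, ?_⟩
      · rw [neg_le, Int.le_ediv_iff_mul_le ha']; linarith
      · rw [Int.le_ediv_iff_mul_le ha']; linarith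
    · rintro ⟨y, z⟩ hp ⟨y', z'⟩ hp' hyy
      simp only [hS, coe_filter, Set.mem_ofPred_eq, mem_filter, mem_product, mem_Icc] at hp hp' hyy
      obtain ⟨⟨_, _, h4⟩, h5⟩ := hp
      obtain ⟨⟨_, _, h4'⟩, h5'⟩ := hp'
      rw [h5, zero_add] at h4
      rw [h5', zero_add] at h4'
      have e1 := Int.ediv_mul_cancel (haq.dvd_of_dvd_mul_left h4)
      have e2 := Int.ediv_mul_cancel (haq.dvd_of_dvd_mul_left h4')
      rw [hyy, e2] at e1
      rw [e1, h5, h5']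
  have h1 : #{p ∈ S | p.2 ≠ 0} ≤ (2 * Y / a + 1) * (2 * Z) := by
    rw [← card_Icc_erase_zero Z]
    apply card_le_mul_card_image_of_maps_to (f := fun p : ℤ × ℤ => p.2)
    · rintro ⟨y, z⟩ hp
      simp only [hS, mem_filter, mem_product] at hp
      simp only [mem_erase]
      exact ⟨hp.2, hp.1.1.2⟩
    · intro z hz
      rw [show 2 * Y / a + 1 = #(range (2 * Y / a + 1)) by simp]
      apply card_le_card_of_injOn (fun p : ℤ × ℤ => ((p.1 + Y) / a).toNat)
      · rintro ⟨y, z'⟩ hp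
        simp only [hS, coe_filter, Set.mem_ofPred_eq, mem_filter, mem_product, mem_Icc] at hp
        simp only [coe_range, Set.mem_Iio]
        obtain ⟨⟨⟨⟨⟨h1, h2⟩, _⟩, _⟩, _⟩, _⟩ := hp
        have h3 : (y + Y) / a ≤ (((2 * Y / a : ℕ)) : ℤ) := by
          push_cast
          exact Int.ediv_le_ediv ha' (by linarith)
        exact Nat.lt_succ_of_le (Int.toNat_le.2 h3)
      · rintro ⟨y, z1⟩ hp ⟨y', z2⟩ hp' hyy
        simp only [hS, coe_filter, Set.mem_ofPred_eq, mem_filter, mem_product, mem_Icc] at hp hp' hyy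
        obtain ⟨⟨⟨⟨⟨h1, h2⟩, _⟩, _, h4⟩, _⟩, h5⟩ := hp
        obtain ⟨⟨⟨⟨⟨h1', h2'⟩, _⟩, _, h4'⟩, _⟩, h5'⟩ := hp'
        rw [h5] at h4
        rw [h5'] at h4'
        have d1 : (a : ℤ) ∣ q * (y - y') := by
          have := dvd_sub h4 h4'
          have e : z + q * y - (z + q * y') = q * (y - y') := by ring
          rwa [e] at this
        have d2 : (a : ℤ) ∣ (y + Y) - (y' + Y) := by
          have := haq.dvd_of_dvd_mul_left d1
          have e : (y + Y) - (y' + Y) = y - y' := by ring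
          rwa [e]
        have m1 : (y + Y) % a = (y' + Y) % a :=
          Int.emod_eq_emod_iff_emod_sub_eq_zero.2 (Int.emod_eq_zero_of_dvd d2)
        have p1 : 0 ≤ (y + Y) / a := Int.ediv_nonneg (by linarith) ha'.le
        have p2 : 0 ≤ (y' + Y) / a := Int.ediv_nonneg (by linarith) ha'.le
        have q1 : (y + Y) / a = (y' + Y) / a := by omega
        have e1 := Int.mul_ediv_add_emod (y + Y) a
        have e2 := Int.mul_ediv_add_emod (y' + Y) a
        rw [q1, m1, e2] at e1
        have : y = y' := by linarith
        rw [this, h5, h5']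
  have ha'' : (0 : ℝ) < a := by exact_mod_cast ha
  have c0 : ((Y / a : ℕ) : ℝ) ≤ Y / a := Nat.cast_div_le
  have c1 : ((2 * Y / a : ℕ) : ℝ) ≤ 2 * Y / a := by
    refine Nat.cast_div_le.trans ?_; push_cast; exact le_rfl
  have h2 : (#S : ℝ) ≤ 2 * ((Y / a : ℕ) : ℝ) + (((2 * Y / a : ℕ) : ℝ) + 1) * (2 * Z) := by
    exact_mod_cast hsplit.trans (add_le_add h0 h1)
  calc (#S : ℝ) ≤ _ := h2
    _ ≤ 2 * ((Y : ℝ) / a) + (2 * Y / a + 1) * (2 * Z) := by gcongr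
    _ = _ := by ring

lemma gcd_dvd_det (p : (ℕ × ℕ) × (ℕ × ℕ)) : ((p.1.1.gcd p.2.1 : ℕ) : ℤ) ∣ det p := by
  unfold det
  apply dvd_sub
  · exact Dvd.dvd.mul_left (by exact_mod_cast Nat.gcd_dvd_right _ _) _
  · exact Dvd.dvd.mul_left (by exact_mod_cast Nat.gcd_dvd_left _ _) _

/-- For fixed r, r' and determinant, the pairs (k, k') number at most K(r,r')/r + 1, which is at
most (1 + K/R)(r,r'). It remains to count the tuples (r, r', t, j) weighted by the gcd. -/
lemma card_le_sum_gcd {R : ℝ} (hR : 1 ≤ R) (K : ℕ) (S : Finset ((ℕ × ℕ) × (ℕ × ℕ)))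
    (hS : S ⊆ pts R K ×ˢ pts R K) (j : (ℕ × ℕ) × (ℕ × ℕ) → ℤ) :
    (#S : ℝ) ≤ (1 + K / R) * ∑ w ∈ S.image (fun p => ((p.1.1, p.2.1), (det p, j p))),
      (w.1.1.gcd w.1.2 : ℝ) := by
  rw [card_eq_sum_card_image (fun p => ((p.1.1, p.2.1), (det p, j p))) S, mul_sum]
  push_cast
  refine sum_le_sum fun w hw => ?_
  obtain ⟨p0, hp0, rfl⟩ := mem_image.1 hw
  have hm := hS hp0
  rw [mem_product, mem_pts, mem_pts] at hm
  have hr1 : R ≤ p0.1.1 := hm.1.1.1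
  have hr : 0 < p0.1.1 := by
    have : (1 : ℝ) ≤ p0.1.1 := hR.trans hr1
    exact_mod_cast this
  have hg : 0 < p0.1.1.gcd p0.2.1 := Nat.gcd_pos_of_pos_left _ hr
  have h1 : #{p ∈ S | ((p.1.1, p.2.1), (det p, j p)) = ((p0.1.1, p0.2.1), (det p0, j p0))} ≤
      K / (p0.1.1 / p0.1.1.gcd p0.2.1) + 1 := by
    refine le_trans ?_ (card_linear_solutions_le K hr (r' := p0.2.1) (det p0))
    apply card_le_card_of_injOn (fun p => (p.1.2, p.2.2))
    · intro p hp
      simp only [coe_filter, Set.mem_ofPred_eq, Prod.mk.injEq] at hp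
      obtain ⟨hpS, ⟨e1, e2⟩, e3, _⟩ := hp
      have hm' := hS hpS
      rw [mem_product, mem_pts, mem_pts] at hm'
      simp only [coe_filter, Set.mem_ofPred_eq, mem_product, mem_Icc]
      refine ⟨⟨hm'.1.2, hm'.2.2⟩, ?_⟩
      rw [← e3]; unfold det; rw [e1, e2]
    · rintro ⟨⟨x1, x2⟩, ⟨x3, x4⟩⟩ hx ⟨⟨y1, y2⟩, ⟨y3, y4⟩⟩ hy hxy
      simp only [coe_filter, Set.mem_ofPred_eq, Prod.mk.injEq] at hx hy hxy
      obtain ⟨_, ⟨e1, e2⟩, _⟩ := hx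
      obtain ⟨_, ⟨f1, f2⟩, _⟩ := hy
      rw [e1, e2, f1, f2, hxy.1, hxy.2]
  have hg' : (1 : ℝ) ≤ p0.1.1.gcd p0.2.1 := by exact_mod_cast hg
  have h2 : ((K / (p0.1.1 / p0.1.1.gcd p0.2.1) : ℕ) : ℝ) ≤ K / R * p0.1.1.gcd p0.2.1 := by
    refine Nat.cast_div_le.trans ?_
    rw [Nat.cast_div (Nat.gcd_dvd_left _ _) (by positivity), div_div_eq_mul_div, div_mul_eq_mul_div]
    gcongr
  calc ((#{p ∈ S | ((p.1.1, p.2.1), (det p, j p)) = ((p0.1.1, p0.2.1), (det p0, j p0))} : ℕ) : ℝ)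
      ≤ ((K / (p0.1.1 / p0.1.1.gcd p0.2.1) : ℕ) : ℝ) + 1 := by exact_mod_cast h1
    _ ≤ K / R * p0.1.1.gcd p0.2.1 + p0.1.1.gcd p0.2.1 := add_le_add h2 hg'
    _ = _ := by ring

/-- The gcd g of r and r' divides the determinant t, so both j r r' and a t - q j r r' may be
divided by g. This shrinks the box of possible values by g ≥ h and gains the factor 1/h. -/
lemma card_gcd_ge_le {a q : ℕ} (ha : 0 < a) (hcop : a.Coprime q) {R : ℝ} (hR : 1 ≤ R) (K : ℕ)
    {Y Δ B : ℝ} (hY0 : 0 ≤ Y) (hΔ0 : 0 ≤ Δ) (hB0 : 0 ≤ B)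
    (hB : ∀ n : ℕ, 0 < n → (n : ℝ) ≤ Y → (#n.divisors : ℝ) ≤ B)
    (S : Finset ((ℕ × ℕ) × (ℕ × ℕ))) (hS : S ⊆ pts R K ×ˢ pts R K)
    (j : (ℕ × ℕ) × (ℕ × ℕ) → ℤ) (hj : ∀ p ∈ S, j p ≠ 0)
    (hY : ∀ p ∈ S, |(j p : ℝ)| * (p.1.1 * p.2.1) ≤ Y)
    (hΔ : ∀ p ∈ S, |(a : ℝ) * det p - q * (j p * (p.1.1 * p.2.1))| ≤ Δ) {h : ℕ} (hh : 0 < h) :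
    (#{w ∈ S.image (fun p => ((p.1.1, p.2.1), (det p, j p))) | h ≤ w.1.1.gcd w.1.2} : ℝ) ≤
      B ^ 3 * (2 * Δ * (2 * Y / a + 1) + 2 * Y / a) * (1 / h) := by
  have hh' : (1 : ℝ) ≤ h := by exact_mod_cast hh
  have ha' : (0 : ℝ) < a := by exact_mod_cast ha
  set Q := {w ∈ S.image (fun p => ((p.1.1, p.2.1), (det p, j p))) | h ≤ w.1.1.gcd w.1.2} with hQ
  set T := {p ∈ Icc (-(⌊Y / h⌋₊ : ℤ)) ⌊Y / h⌋₊ ×ˢ Icc (-(⌊Δ / h⌋₊ : ℤ)) ⌊Δ / h⌋₊ |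
    p.1 ≠ 0 ∧ (a : ℤ) ∣ p.2 + q * p.1} with hT
  -- structure of the elements of `Q`
  have key : ∀ w ∈ Q, ∃ r₁ r₁' : ℕ, ∃ t₁ : ℤ, 0 < r₁ ∧ 0 < r₁' ∧ 0 < w.1.1.gcd w.1.2 ∧
      h ≤ w.1.1.gcd w.1.2 ∧
      w.1.1 = w.1.1.gcd w.1.2 * r₁ ∧ w.1.2 = w.1.1.gcd w.1.2 * r₁' ∧
      w.2.1 = w.1.1.gcd w.1.2 * t₁ ∧ w.2.2 ≠ 0 ∧ |(w.2.2 : ℝ)| * (w.1.1 * w.1.2) ≤ Y ∧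
      |(a : ℝ) * w.2.1 - q * (w.2.2 * (w.1.1 * w.1.2))| ≤ Δ := by
    intro w hw
    rw [hQ, mem_filter] at hw
    obtain ⟨p, hp, rfl⟩ := mem_image.1 hw.1
    have hm := hS hp
    rw [mem_product, mem_pts, mem_pts] at hm
    have hr : 0 < p.1.1 := by
      have : (1 : ℝ) ≤ p.1.1 := hR.trans hm.1.1.1
      exact_mod_cast this
    have hr' : 0 < p.2.1 := by
      have : (1 : ℝ) ≤ p.2.1 := hR.trans hm.2.1.1
      exact_mod_cast this
    obtain ⟨t₁, ht₁⟩ := gcd_dvd_det p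
    have d1 := Nat.gcd_dvd_left p.1.1 p.2.1
    have d2 := Nat.gcd_dvd_right p.1.1 p.2.1
    have hg : 0 < p.1.1.gcd p.2.1 := Nat.gcd_pos_of_pos_left _ hr
    exact ⟨p.1.1 / p.1.1.gcd p.2.1, p.2.1 / p.1.1.gcd p.2.1, t₁,
      Nat.div_pos (Nat.le_of_dvd hr d1) hg, Nat.div_pos (Nat.le_of_dvd hr' d2) hg, hg, hw.2,
      (Nat.mul_div_cancel' d1).symm, (Nat.mul_div_cancel' d2).symm, ht₁, hj p hp, hY p hp, hΔ p hp⟩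
  -- With r = g r₁ and r' = g r₁', these are y = j g r₁ r₁' and z = a(t/g) - qy, so that a divides z
  -- + qy.
  set f : (ℕ × ℕ) × (ℤ × ℤ) → ℤ × ℤ := fun w =>
    (w.2.2 * ((w.1.1.gcd w.1.2 * (w.1.1 / w.1.1.gcd w.1.2) * (w.1.2 / w.1.1.gcd w.1.2) : ℕ) : ℤ),
      a * (w.2.1 / (w.1.1.gcd w.1.2 : ℕ)) - q * (w.2.2 *
        ((w.1.1.gcd w.1.2 * (w.1.1 / w.1.1.gcd w.1.2) * (w.1.2 / w.1.1.gcd w.1.2) : ℕ) : ℤ))) with hf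
  have hmaps : ∀ w ∈ Q, f w ∈ T := by
    rintro ⟨⟨r, r'⟩, ⟨t, i⟩⟩ hw
    obtain ⟨r₁, r₁', t₁, h1, h2, h3, h4, h5, h6, h7, h8, h9, h10⟩ := key _ hw
    simp only at h3 h4 h5 h6 h7 h8 h9 h10
    simp only [hf]
    generalize hgg : r.gcd r' = g at *
    subst h5 h6 h7
    have hg' : (h : ℝ) ≤ g := by exact_mod_cast h4
    have hg0 : (0 : ℝ) < g := by exact_mod_cast h3
    rw [Nat.mul_div_cancel_left _ h3, Nat.mul_div_cancel_left _ h3,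
      Int.mul_ediv_cancel_left _ (by exact_mod_cast h3.ne')]
    rw [hT, mem_filter, mem_product, mem_Icc, mem_Icc]
    simp only
    refine ⟨⟨abs_le.1 ?_, abs_le.1 ?_⟩, ?_, ?_⟩
    · rw [Int.abs_eq_natAbs, Nat.cast_le]
      apply Nat.le_floor
      rw [Nat.cast_natAbs, le_div_iff₀ (by linarith)]
      push_cast
      rw [abs_mul, abs_of_nonneg (show (0 : ℝ) ≤ (g * r₁ * r₁' : ℝ) by positivity)]
      calc |(i : ℝ)| * (g * r₁ * r₁') * h ≤ |(i : ℝ)| * (g * r₁ * r₁') * g := by gcongr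
        _ = |(i : ℝ)| * (((g * r₁ : ℕ) : ℝ) * ((g * r₁' : ℕ) : ℝ)) := by push_cast; ring
        _ ≤ Y := h9
    · rw [Int.abs_eq_natAbs, Nat.cast_le]
      apply Nat.le_floor
      rw [Nat.cast_natAbs, le_div_iff₀ (by linarith)]
      push_cast
      calc |(a : ℝ) * t₁ - q * (i * (g * r₁ * r₁'))| * h
          ≤ |(a : ℝ) * t₁ - q * (i * (g * r₁ * r₁'))| * g := by gcongr
        _ = |(a : ℝ) * ((g * t₁ : ℤ) : ℝ) - q * (i * (((g * r₁ : ℕ) : ℝ) * ((g * r₁' : ℕ) : ℝ)))| := by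
            conv_lhs => rw [← abs_of_pos hg0, ← abs_mul]
            congr 1; rw [abs_of_pos hg0]; push_cast; ring
        _ ≤ Δ := h10
    · apply mul_ne_zero h8
      have : 0 < g * r₁ * r₁' := by positivity
      exact_mod_cast this.ne'
    · rw [sub_add_cancel]; exact Dvd.intro _ rfl
  -- As y ≠ 0, each of g, r₁, r₁' is one of at most B divisors of y. They determine j from y, and
  -- then t from z.
  have hfib : ∀ v ∈ T, (#{w ∈ Q | f w = v} : ℝ) ≤ B ^ 3 := by
    rintro ⟨y, z⟩ hv
    rw [hT, mem_filter, mem_product, mem_Icc] at hv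
    simp only at hv
    obtain ⟨⟨hy1, _⟩, hy0, _⟩ := hv
    have hyn : 0 < y.natAbs := Int.natAbs_pos.2 hy0
    have hyY : (y.natAbs : ℝ) ≤ Y := by
      have e1 : y.natAbs ≤ ⌊Y / h⌋₊ := by omega
      have e2 : (y.natAbs : ℝ) ≤ Y / h :=
        (Nat.le_floor_iff (by positivity)).1 e1
      exact e2.trans (div_le_self hY0 hh')
    have e3 : #{w ∈ Q | f w = (y, z)} ≤
        #(y.natAbs.divisors ×ˢ y.natAbs.divisors ×ˢ y.natAbs.divisors) := by
      apply card_le_card_of_injOn (fun w => (w.1.1.gcd w.1.2,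
        w.1.1 / w.1.1.gcd w.1.2, w.1.2 / w.1.1.gcd w.1.2))
      · rintro ⟨⟨r, r'⟩, ⟨t, i⟩⟩ hw
        simp only [coe_filter, Set.mem_ofPred_eq, hf, Prod.mk.injEq] at hw
        obtain ⟨_, hw2, _⟩ := hw
        simp only [coe_product, Set.mem_prod, mem_coe, Nat.mem_divisors]
        have hd : ∀ n : ℕ, n ∣ r.gcd r' * (r / r.gcd r') * (r' / r.gcd r') → n ∣ y.natAbs := by
          intro n hn
          rw [← hw2, Int.natAbs_mul, Int.natAbs_natCast]
          exact Dvd.dvd.mul_left hn _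
        refine ⟨⟨hd _ ⟨_, by rw [mul_assoc]⟩, hyn.ne'⟩,
          ⟨hd _ ⟨r.gcd r' * (r' / r.gcd r'), by ring⟩, hyn.ne'⟩,
          ⟨hd _ ⟨r.gcd r' * (r / r.gcd r'), by ring⟩, hyn.ne'⟩⟩
      · rintro ⟨⟨r, r'⟩, ⟨t, i⟩⟩ hw ⟨⟨x, x'⟩, ⟨s, i'⟩⟩ hx hwx
        simp only [coe_filter, Set.mem_ofPred_eq, hf, Prod.mk.injEq] at hw hx hwx
        obtain ⟨hw1, hw2, hw3⟩ := hw
        obtain ⟨hx1, hx2, hx3⟩ := hx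
        obtain ⟨r₁, r₁', t₁, h1, h2, h3, h4, h5, h6, h7, h8, h9, h10⟩ := key _ hw1
        obtain ⟨x₁, x₁', s₁, k1, k2, k3, k4, k5, k6, k7, k8, k9, k10⟩ := key _ hx1
        simp only at h3 h5 h6 h7 k3 k5 k6 k7
        obtain ⟨g1, g2, g3⟩ := hwx
        generalize r.gcd r' = g at *
        generalize x.gcd x' = g' at *
        subst g1 h5 h6 h7 k5 k6 k7
        have hgz : (g : ℤ) ≠ 0 := by exact_mod_cast h3.ne'
        simp only [Nat.mul_div_cancel_left _ h3, Int.mul_ediv_cancel_left _ hgz] at hw2 hw3 hx2 hx3 g2 g3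
        subst g2 g3
        have hp : ((g * r₁ * r₁' : ℕ) : ℤ) ≠ 0 := by
          have : 0 < g * r₁ * r₁' := by positivity
          exact_mod_cast this.ne'
        have hi : i = i' := mul_right_cancel₀ hp (hw2.trans hx2.symm)
        subst hi
        have ht : (a : ℤ) * t₁ = a * s₁ := by linarith
        have ht' : t₁ = s₁ := mul_left_cancel₀ (by exact_mod_cast ha.ne') ht
        rw [ht']
    have e4 := hB y.natAbs hyn hyY
    calc (#{w ∈ Q | f w = (y, z)} : ℝ) ≤
        ((#(y.natAbs.divisors ×ˢ y.natAbs.divisors ×ˢ y.natAbs.divisors) : ℕ) : ℝ) := by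
          exact_mod_cast e3
      _ = (#y.natAbs.divisors : ℝ) ^ 3 := by rw [card_product, card_product]; push_cast; ring
      _ ≤ B ^ 3 := by gcongr
  have h1 := card_le_mul_card Q T f hmaps hfib
  have h2 := card_box_le ha hcop ⌊Y / h⌋₊ ⌊Δ / h⌋₊
  have h3 : (⌊Y / h⌋₊ : ℝ) ≤ Y / h := Nat.floor_le (by positivity)
  have h4 : (⌊Δ / h⌋₊ : ℝ) ≤ Δ / h := Nat.floor_le (by positivity)
  have h5 : (⌊Y / h⌋₊ : ℝ) ≤ Y := h3.trans (div_le_self hY0 hh')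
  calc (#Q : ℝ) ≤ B ^ 3 * #T := h1
    _ ≤ B ^ 3 * (2 * ⌊Δ / h⌋₊ * (2 * ⌊Y / h⌋₊ / a + 1) + 2 * ⌊Y / h⌋₊ / a) := by gcongr
    _ ≤ B ^ 3 * (2 * (Δ / h) * (2 * Y / a + 1) + 2 * (Y / h) / a) := by gcongr
    _ = _ := by ring

/-- The gcd weight is written as the number of h not exceeding it. The factor 1/h available for each
h turns the sum over h into a logarithm. -/
lemma card_det_near_le {a q : ℕ} (ha : 0 < a) (hcop : a.Coprime q) {R : ℝ} (hR : 1 ≤ R) (K : ℕ)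
    {Y Δ B : ℝ} (hY0 : 0 ≤ Y) (hΔ0 : 0 ≤ Δ) (hB0 : 0 ≤ B)
    (hB : ∀ n : ℕ, 0 < n → (n : ℝ) ≤ Y → (#n.divisors : ℝ) ≤ B)
    (hlog : 1 + Real.log ⌊2 * R⌋₊ ≤ B)
    (S : Finset ((ℕ × ℕ) × (ℕ × ℕ))) (hS : S ⊆ pts R K ×ˢ pts R K)
    (j : (ℕ × ℕ) × (ℕ × ℕ) → ℤ) (hj : ∀ p ∈ S, j p ≠ 0)
    (hY : ∀ p ∈ S, |(j p : ℝ)| * (p.1.1 * p.2.1) ≤ Y)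
    (hΔ : ∀ p ∈ S, |(a : ℝ) * det p - q * (j p * (p.1.1 * p.2.1))| ≤ Δ) :
    (#S : ℝ) ≤ (1 + K / R) * (B ^ 4 * (2 * Δ * (2 * Y / a + 1) + 2 * Y / a)) := by
  refine (card_le_sum_gcd hR K S hS j).trans ?_
  have hR0 : 0 < R := by linarith
  apply mul_le_mul_of_nonneg_left _ (by positivity)
  set Q := S.image (fun p => ((p.1.1, p.2.1), (det p, j p))) with hQ
  have h1 : ∀ w ∈ Q, (w.1.1.gcd w.1.2 : ℝ) ≤
      ∑ h ∈ Icc 1 ⌊2 * R⌋₊, if h ≤ w.1.1.gcd w.1.2 then (1 : ℝ) else 0 := by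
    intro w hw
    obtain ⟨p, hp, rfl⟩ := mem_image.1 hw
    have hm := hS hp
    rw [mem_product, mem_pts, mem_pts] at hm
    have hr : 0 < p.1.1 := by
      have : (1 : ℝ) ≤ p.1.1 := hR.trans hm.1.1.1
      exact_mod_cast this
    have hle : p.1.1.gcd p.2.1 ≤ ⌊2 * R⌋₊ :=
      (Nat.gcd_le_left _ hr).trans (Nat.le_floor hm.1.1.2.le)
    rw [← sum_filter, sum_const, nsmul_eq_mul, mul_one, Nat.cast_le]
    conv_lhs => rw [show p.1.1.gcd p.2.1 = #(Icc 1 (p.1.1.gcd p.2.1)) by simp]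
    apply card_le_card
    intro h; simp only [mem_Icc, mem_filter]; omega
  refine (sum_le_sum h1).trans ?_
  rw [sum_comm]
  have h2 : ∀ h ∈ Icc 1 ⌊2 * R⌋₊,
      ∑ w ∈ Q, (if h ≤ w.1.1.gcd w.1.2 then (1 : ℝ) else 0) ≤
      B ^ 3 * (2 * Δ * (2 * Y / a + 1) + 2 * Y / a) * (1 / h) := by
    intro h hh
    rw [← sum_filter, sum_const, nsmul_eq_mul, mul_one]
    exact card_gcd_ge_le ha hcop hR K hY0 hΔ0 hB0 hB S hS j hj hY hΔ (mem_Icc.1 hh).1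
  refine (sum_le_sum h2).trans ?_
  rw [← mul_sum]
  have h3 := (sum_inv_le ⌊2 * R⌋₊).trans hlog
  calc _ ≤ B ^ 3 * (2 * Δ * (2 * Y / a + 1) + 2 * Y / a) * B := by gcongr
    _ = _ := by ring

/-- The difference of the frequencies attached to two points. -/
noncomputable def diff (a q : ℕ) (p : (ℕ × ℕ) × (ℕ × ℕ)) : ℝ :=
  p.1.2 * ((a : ℝ) / (p.1.1 * q)) - p.2.2 * ((a : ℝ) / (p.2.1 * q))

namespace Ctx

variable {κ u R L T B : ℝ} {a q : ℕ}

lemma diff_mul (h : Ctx κ u R L T B a q) {K : ℕ} {p : (ℕ × ℕ) × (ℕ × ℕ)}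
    (hp : p ∈ pts R K ×ˢ pts R K) :
    diff a q p * (q * (p.1.1 * p.2.1)) = a * det p := by
  rw [mem_product, mem_pts, mem_pts] at hp
  have h1 : (0 : ℝ) < p.1.1 := by linarith [h.one_le_R, hp.1.1.1]
  have h2 : (0 : ℝ) < p.2.1 := by linarith [h.one_le_R, hp.2.1.1]
  have h3 : (0 : ℝ) < q := by exact_mod_cast h.q_pos
  unfold diff det; push_cast; field_simp

/-- Pairs of points whose frequencies are close modulo one. -/
lemma card_near_le (h : Ctx κ u R L T B a q) {K : ℕ}
    (hK : 4 * κ * (R * K) ≤ 10 ^ 4 * κ ^ 8 * u ^ 48) {δ : ℝ} (hδ0 : 0 < δ) (hδ : δ ≤ 1 / 2) :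
    (#{p ∈ pts R K ×ˢ pts R K | nd (diff a q p) ≤ δ} : ℝ) ≤
      B ^ 3 * (R * K + δ * (R ^ 3 * K)) +
        (1 + K / R) * (B ^ 8 * (δ * (R ^ 3 * K) + δ * (R ^ 2 * q) + R * K / q)) := by
  have hκ := h.one_le_kappa
  have hu := h.one_le_u
  have hR := h.one_le_R
  have hB := h.B_pos
  have hB16 := h.B_ge
  have hκB := h.kappa_le_B
  have hq0 : (0 : ℝ) < q := by exact_mod_cast h.q_pos
  have ha0 : (0 : ℝ) < a := by exact_mod_cast h.a_pos
  set S := {p ∈ pts R K ×ˢ pts R K | nd (diff a q p) ≤ δ} with hS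
  set Δ := 4 * δ * R ^ 2 * q with hΔ
  set Y := 4 * κ * (R * K) with hY
  have hdiff : ∀ p ∈ S, |(a : ℝ) * det p - q * (round (diff a q p) * (p.1.1 * p.2.1))| ≤ Δ := by
    intro p hp
    rw [hS, mem_filter] at hp
    rw [← h.diff_mul hp.1]
    have hm := hp.1
    rw [mem_product, mem_pts, mem_pts] at hm
    have e1 : diff a q p * (q * (p.1.1 * p.2.1)) - q * (round (diff a q p) * (p.1.1 * p.2.1)) =
        (diff a q p - round (diff a q p)) * (q * (p.1.1 * p.2.1)) := by ring
    rw [e1, abs_mul, abs_of_nonneg (show (0 : ℝ) ≤ q * (p.1.1 * p.2.1) by positivity)]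
    calc |diff a q p - round (diff a q p)| * (q * (p.1.1 * p.2.1))
        ≤ δ * (q * ((2 * R) * (2 * R))) := by
          have := hm.1.1.2.le
          have := hm.2.1.2.le
          have := hp.2
          unfold nd at this
          gcongr
      _ = Δ := by rw [hΔ]; ring
  -- The cases are separated by the integer j nearest to the difference: for j = 0 the determinant
  -- itself is small, for j ≠ 0 the congruence modulo a is used.
  have hsplit : #S ≤ #{p ∈ S | round (diff a q p) = 0} + #{p ∈ S | ¬ round (diff a q p) = 0} :=
    (card_filter_add_card_filter_not (fun p => round (diff a q p) = 0)).symm.le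
  -- the terms with small determinant
  have h0 : (#{p ∈ S | round (diff a q p) = 0} : ℝ) ≤ B ^ 3 * (R * K + δ * (R ^ 3 * K)) := by
    set W := ⌊4 * κ * δ * R ^ 2⌋₊ with hW
    have hWle : (W : ℝ) ≤ 4 * κ * δ * R ^ 2 := Nat.floor_le (by positivity)
    have c1 : #{p ∈ S | round (diff a q p) = 0} ≤ #{p ∈ pts R K ×ˢ pts R K | |det p| ≤ W} := by
      apply card_le_card
      intro p hp
      rw [mem_filter] at hp
      have h1 := hdiff p hp.1
      rw [hp.2] at h1
      rw [mem_filter]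
      refine ⟨(mem_filter.1 hp.1).1, ?_⟩
      rw [Int.abs_eq_natAbs, Nat.cast_le]
      apply Nat.le_floor
      rw [Nat.cast_natAbs]
      push_cast
      simp only [Int.cast_zero, zero_mul, mul_zero, sub_zero] at h1
      rw [abs_mul, abs_of_pos ha0] at h1
      have h2 : (q : ℝ) * |(det p : ℝ)| ≤ q * (4 * κ * δ * R ^ 2) := by
        calc (q : ℝ) * |(det p : ℝ)| ≤ κ * a * |(det p : ℝ)| := by gcongr; exact h.q_le_a
          _ = κ * (a * |(det p : ℝ)|) := by ring
          _ ≤ κ * Δ := by gcongr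
          _ = _ := by rw [hΔ]; ring
      exact le_of_mul_le_mul_left h2 hq0
    have c2 := card_det_small_le hR K W hB.le (fun n hn hle => h.divisors_le n hn
      (hle.trans (le_trans (by nlinarith [mul_nonneg (by linarith : 0 ≤ R) (Nat.cast_nonneg (α := ℝ) K)]) hK)))
    calc (#{p ∈ S | round (diff a q p) = 0} : ℝ) ≤ _ := by exact_mod_cast c1
      _ ≤ _ := c2
      _ ≤ B * (2 * (R * K) * (2 * (4 * κ * δ * R ^ 2) + 1)) := by gcongr
      _ = 2 * B * (R * K) + 16 * B * κ * (δ * (R ^ 3 * K)) := by ring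
      _ ≤ B ^ 3 * (R * K) + B ^ 3 * (δ * (R ^ 3 * K)) := by
          gcongr ?_ * _ + ?_ * _
          · calc 2 * B ≤ B ^ 2 * B := by gcongr; nlinarith
              _ = _ := by ring
          · calc 16 * B * κ ≤ B * B * B := by gcongr
              _ = _ := by ring
      _ = _ := by ring
  have h1 : (#{p ∈ S | ¬ round (diff a q p) = 0} : ℝ) ≤
      (1 + K / R) * (B ^ 8 * (δ * (R ^ 3 * K) + δ * (R ^ 2 * q) + R * K / q)) := by
    have hfl : 0 < ⌊2 * R⌋₊ := Nat.floor_pos.2 (by linarith)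
    have hlog := h.log_nat_le hfl (by
      calc (⌊2 * R⌋₊ : ℝ) ≤ 2 * R := Nat.floor_le (by linarith)
        _ ≤ 2 * (2 * κ * u ^ 12) := by have := h.R_le; gcongr
        _ = 4 * κ ^ 1 * u ^ 12 := by ring
        _ ≤ _ := h.small (by norm_num) (by norm_num) (by norm_num))
    have c1 := card_det_near_le h.a_pos h.coprime hR K (show 0 ≤ Y by positivity)
      (show 0 ≤ Δ by positivity) hB.le (fun n hn hle => h.divisors_le n hn (hle.trans hK)) hlog
      {p ∈ S | ¬ round (diff a q p) = 0}
      (fun p hp => (mem_filter.1 (mem_filter.1 hp).1).1)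
      (fun p => round (diff a q p)) (fun p hp => (mem_filter.1 hp).2) ?_
      (fun p hp => hdiff p (mem_filter.1 hp).1)
    · refine c1.trans ?_
      apply mul_le_mul_of_nonneg_left _ (by positivity)
      have d1 : 2 * Y / a ≤ 8 * κ ^ 2 * (R * K / q) := by
        rw [div_le_iff₀ ha0]
        have : (1 : ℝ) ≤ κ * a / q := by rw [le_div_iff₀ hq0, one_mul]; exact h.q_le_a
        calc 2 * Y = 8 * κ * (R * K) * 1 := by rw [hY]; ring
          _ ≤ 8 * κ * (R * K) * (κ * a / q) := by gcongr
          _ = _ := by ring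
      have d2 : B ^ 4 * (2 * Δ * (2 * Y / a + 1) + 2 * Y / a) ≤
          B ^ 4 * (2 * Δ * (8 * κ ^ 2 * (R * K / q) + 1) + 8 * κ ^ 2 * (R * K / q)) := by gcongr
      refine d2.trans ?_
      have d3 : 2 * Δ * (8 * κ ^ 2 * (R * K / q) + 1) + 8 * κ ^ 2 * (R * K / q) =
          64 * κ ^ 2 * (δ * (R ^ 3 * K)) + 8 * (δ * (R ^ 2 * q)) + 8 * κ ^ 2 * (R * K / q) := by
        rw [hΔ]; field_simp; ring
      rw [d3]
      have e1 : 64 * κ ^ 2 ≤ B ^ 4 := by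
        calc 64 * κ ^ 2 ≤ 16 * 16 * B ^ 2 := by gcongr; norm_num
          _ ≤ B * B * B ^ 2 := by gcongr
          _ = _ := by ring
      have e2 : 8 ≤ B ^ 4 := by nlinarith [one_le_pow₀ hκ (n := 2)]
      have e3 : 8 * κ ^ 2 ≤ B ^ 4 := by nlinarith [one_le_pow₀ hκ (n := 2)]
      calc B ^ 4 * (64 * κ ^ 2 * (δ * (R ^ 3 * K)) + 8 * (δ * (R ^ 2 * q)) + 8 * κ ^ 2 * (R * K / q))
          ≤ B ^ 4 * (B ^ 4 * (δ * (R ^ 3 * K)) + B ^ 4 * (δ * (R ^ 2 * q)) + B ^ 4 * (R * K / q)) := by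
            gcongr
        _ = _ := by ring
    · intro p hp
      obtain ⟨hpS, hne⟩ := mem_filter.1 hp
      have hpp := (mem_filter.1 hpS).1
      have h5 := h.diff_mul hpp
      have h6 := abs_det_le hpp
      have h7 : |diff a q p - round (diff a q p)| ≤ 1 / 2 := abs_sub_round _
      have h8 : (1 : ℝ) ≤ |(round (diff a q p) : ℝ)| := by
        exact_mod_cast Int.one_le_abs hne
      -- A nonzero integer within 1/2 of a real number is at most twice that number in modulus.
      have h9 : |(round (diff a q p) : ℝ)| ≤ 2 * |diff a q p| := by
        have := abs_sub_abs_le_abs_sub (round (diff a q p) : ℝ) (diff a q p)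
        rw [abs_sub_comm] at this
        linarith
      have h10 : |diff a q p| * (q * (p.1.1 * p.2.1)) = a * |(det p : ℝ)| := by
        have := congrArg abs h5
        rwa [abs_mul (diff a q p), abs_mul (a : ℝ), abs_of_pos ha0,
          abs_of_nonneg (show (0 : ℝ) ≤ q * (p.1.1 * p.2.1) by positivity)] at this
      have h11 : (q : ℝ) * (|(round (diff a q p) : ℝ)| * (p.1.1 * p.2.1)) ≤ q * Y := by
        calc (q : ℝ) * (|(round (diff a q p) : ℝ)| * (p.1.1 * p.2.1))
            ≤ q * (2 * |diff a q p| * (p.1.1 * p.2.1)) := by gcongr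
          _ = 2 * (|diff a q p| * (q * (p.1.1 * p.2.1))) := by ring
          _ = 2 * (a * |(det p : ℝ)|) := by rw [h10]
          _ ≤ 2 * (κ * q * (2 * (R * K))) := by
              have := h.a_le_q
              gcongr
          _ = q * Y := by rw [hY]; ring
      exact le_of_mul_le_mul_left h11 hq0
  calc (#S : ℝ) ≤ _ := by exact_mod_cast hsplit
    _ ≤ _ := add_le_add h0 h1

/-- The majorant is unfolded as a sum over t ≤ V and close pairs are counted with δ = 1/t. Terms
proportional to δ acquire a logarithm, the others a factor V. At t = 1 the counting bound is not
available, and all pairs are admitted. -/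
lemma sum_cnt_le (h : Ctx κ u R L T B a q) {K : ℕ}
    (hK : 4 * κ * (R * K) ≤ 10 ^ 4 * κ ^ 8 * u ^ 48) (V : ℕ) (hV : 1 + Real.log V ≤ B) :
    ∑ p ∈ pts R K ×ˢ pts R K, (cnt V (diff a q p) : ℝ) ≤
      4 * (R * K) ^ 2 + B ^ 3 * (V * (R * K) + B * (R ^ 3 * K)) +
        (1 + K / R) * (B ^ 8 * (B * (R ^ 3 * K) + B * (R ^ 2 * q) + V * (R * K) / q)) := by
  have hR := h.one_le_R
  have hB := h.B_pos
  have hq0 : (0 : ℝ) < q := by exact_mod_cast h.q_pos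
  have e1 : ∀ p, (cnt V (diff a q p) : ℝ) =
      ∑ t ∈ Icc 1 V, if (t : ℝ) * nd (diff a q p) ≤ 1 then (1 : ℝ) else 0 := by
    intro p
    rw [← sum_filter, sum_const, nsmul_eq_mul, mul_one]; rfl
  simp only [e1]
  rw [sum_comm]
  set c := (1 + K / R) * (B ^ 8 * (R * K / q)) + B ^ 3 * (R * K) with hc
  set b := (1 + K / R) * (B ^ 8 * (R ^ 3 * K + R ^ 2 * q)) + B ^ 3 * (R ^ 3 * K) with hb
  have e2 : ∀ t ∈ Icc 1 V,
      ∑ p ∈ pts R K ×ˢ pts R K, (if (t : ℝ) * nd (diff a q p) ≤ 1 then (1 : ℝ) else 0) ≤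
      (if t = 1 then 4 * (R * K) ^ 2 else 0) + (c + b * (1 / t)) := by
    intro t ht
    have ht1 := (mem_Icc.1 ht).1
    rw [← sum_filter, sum_const, nsmul_eq_mul, mul_one]
    by_cases h1 : t = 1
    · rw [if_pos h1]
      have h2 : #{p ∈ pts R K ×ˢ pts R K | (t : ℝ) * nd (diff a q p) ≤ 1} ≤
          #(pts R K) * #(pts R K) := by
        rw [← card_product]; exact card_filter_le _ _
      have h3 := card_pts_le hR K
      have h4 : 0 ≤ c + b * (1 / t) := by positivity
      calc _ ≤ (#(pts R K) : ℝ) * #(pts R K) := by exact_mod_cast h2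
        _ ≤ (2 * (R * K)) * (2 * (R * K)) := by gcongr
        _ ≤ _ := by linarith
    · rw [if_neg h1, zero_add]
      have ht2 : (2 : ℝ) ≤ t := by
        have : 2 ≤ t := by omega
        exact_mod_cast this
      have ht0 : (0 : ℝ) < t := by linarith
      have h2 := h.card_near_le hK (δ := 1 / t) (by positivity)
        (one_div_le_one_div_of_le (by norm_num) ht2)
      have h3 : {p ∈ pts R K ×ˢ pts R K | (t : ℝ) * nd (diff a q p) ≤ 1} =
          {p ∈ pts R K ×ˢ pts R K | nd (diff a q p) ≤ 1 / t} := by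
        apply filter_congr
        intro p _
        rw [le_div_iff₀ ht0, mul_comm]
      rw [h3]
      refine h2.trans (le_of_eq ?_)
      rw [hc, hb]; ring
  refine (sum_le_sum e2).trans ?_
  rw [sum_add_distrib, sum_add_distrib, sum_const, Nat.card_Icc, ← mul_sum, nsmul_eq_mul,
    Nat.add_sub_cancel]
  have h5 : ∑ t ∈ Icc 1 V, (if t = 1 then 4 * (R * K) ^ 2 else 0) ≤ 4 * (R * K) ^ 2 := by
    rw [sum_ite_eq']
    split_ifs
    · exact le_rfl
    · positivity
  have h6 : b * ∑ t ∈ Icc 1 V, (1 : ℝ) / t ≤ b * B := by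
    have := (sum_inv_le V).trans hV
    have : 0 ≤ b := by positivity
    gcongr
  calc _ ≤ 4 * (R * K) ^ 2 + (V * c + b * B) := by gcongr
    _ = _ := by rw [hc, hb]; ring

end Ctx

/-! ### Cauchy–Schwarz and Dirichlet convolutions -/

/-- A bilinear form bounded by counting close pairs of frequencies; the cut-offs `v i` are harmless
since the square is expanded with `n` on the outside. -/
lemma norm_bilinear_sq_le {ι : Type*} (S : Finset ι) (C : ι → ℂ) (θ : ι → ℝ) (v : ι → ℕ) {V : ℕ}
    (hv : ∀ i ∈ S, v i ≤ V) (G : ℕ → ℂ) {f g : ℝ} (hC : ∀ i ∈ S, ‖C i‖ ≤ f)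
    (hG : ∀ n ∈ Icc 1 V, ‖G n‖ ≤ g) (hf : 0 ≤ f) :
    ‖∑ i ∈ S, C i * ∑ n ∈ Icc 1 (v i), G n * e (n * θ i)‖ ^ 2 ≤
      f ^ 2 * g ^ 2 * V * ∑ i ∈ S, ∑ j ∈ S, (cnt V (θ i - θ j) : ℝ) := by
  -- The cut-off is moved into the coefficient, so that n runs over one common range and can be
  -- taken outside.
  set D : ι → ℕ → ℂ := fun i n => if n ≤ v i then C i * e (n * θ i) else 0 with hD
  have h1 : ∑ i ∈ S, C i * ∑ n ∈ Icc 1 (v i), G n * e (n * θ i) =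
      ∑ n ∈ Icc 1 V, G n * ∑ i ∈ S, D i n := by
    simp only [mul_sum]
    rw [sum_comm]
    have : ∀ i ∈ S, ∑ n ∈ Icc 1 (v i), C i * (G n * e (n * θ i)) =
        ∑ n ∈ Icc 1 V, G n * D i n := by
      intro i hi
      have e1 : Icc 1 (v i) = {n ∈ Icc 1 V | n ≤ v i} := by
        ext n; have := hv i hi; simp only [mem_Icc, mem_filter]; omega
      rw [e1, sum_filter]
      refine sum_congr rfl fun n _ => ?_
      simp only [hD]
      split_ifs
      · ring
      · simp
    rw [sum_congr rfl this, sum_comm]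
  have h2 : ‖∑ n ∈ Icc 1 V, G n * ∑ i ∈ S, D i n‖ ≤ g * ∑ n ∈ Icc 1 V, ‖∑ i ∈ S, D i n‖ := by
    rw [mul_sum]
    refine norm_sum_le_of_le _ fun n hn => ?_
    rw [norm_mul]
    exact mul_le_mul_of_nonneg_right (hG n hn) (norm_nonneg _)
  have h3 : (∑ n ∈ Icc 1 V, ‖∑ i ∈ S, D i n‖) ^ 2 ≤ V * ∑ n ∈ Icc 1 V, ‖∑ i ∈ S, D i n‖ ^ 2 := by
    have := sq_sum_le_card_mul_sum_sq (s := Icc 1 V) (f := fun n => ‖∑ i ∈ S, D i n‖)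
    simpa using this
  have h4 : ∑ n ∈ Icc 1 V, ‖∑ i ∈ S, D i n‖ ^ 2 ≤
      f ^ 2 * ∑ i ∈ S, ∑ j ∈ S, (cnt V (θ i - θ j) : ℝ) := by
    have k1 : ∀ n, ((‖∑ i ∈ S, D i n‖ ^ 2 : ℝ) : ℂ) =
        ∑ i ∈ S, ∑ j ∈ S, D i n * (starRingEnd ℂ) (D j n) := by
      intro n
      rw [← sum_mul_sum, ← map_sum, Complex.mul_conj, Complex.normSq_eq_norm_sq]
    have k2 : ((∑ n ∈ Icc 1 V, ‖∑ i ∈ S, D i n‖ ^ 2 : ℝ) : ℂ) =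
        ∑ i ∈ S, ∑ j ∈ S, ∑ n ∈ Icc 1 V, D i n * (starRingEnd ℂ) (D j n) := by
      push_cast
      have : ∀ n, ((‖∑ i ∈ S, D i n‖ : ℂ)) ^ 2 =
        ∑ i ∈ S, ∑ j ∈ S, D i n * (starRingEnd ℂ) (D j n) := by
        intro n; rw [← k1 n]; push_cast; rfl
      simp only [this]
      rw [sum_comm]
      refine sum_congr rfl fun i _ => sum_comm
    have k3 : ∑ n ∈ Icc 1 V, ‖∑ i ∈ S, D i n‖ ^ 2 =
        ‖((∑ n ∈ Icc 1 V, ‖∑ i ∈ S, D i n‖ ^ 2 : ℝ) : ℂ)‖ := by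
      rw [Complex.norm_real, Real.norm_of_nonneg (sum_nonneg fun _ _ => by positivity)]
    rw [k3, k2, mul_sum]
    refine norm_sum_le_of_le _ fun i hi => ?_
    rw [mul_sum]
    refine norm_sum_le_of_le _ fun j hj => ?_
    -- After squaring, two cut-offs merely shorten the geometric sum to the smaller of them.
    have k4 : ∑ n ∈ Icc 1 V, D i n * (starRingEnd ℂ) (D j n) =
        C i * (starRingEnd ℂ) (C j) * ∑ n ∈ Icc 1 (min (v i) (v j)), e (n * (θ i - θ j)) := by
      have e1 : Icc 1 (min (v i) (v j)) = {n ∈ Icc 1 V | n ≤ v i ∧ n ≤ v j} := by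
        ext n; have := hv i hi; simp only [mem_Icc, mem_filter]; omega
      rw [e1, sum_filter, mul_sum]
      refine sum_congr rfl fun n _ => ?_
      simp only [hD]
      by_cases c1 : n ≤ v i
      · by_cases c2 : n ≤ v j
        · rw [if_pos c1, if_pos c2, if_pos ⟨c1, c2⟩, map_mul, e_conj,
            show (n : ℝ) * (θ i - θ j) = n * θ i + -(n * θ j) by ring, e_add]
          ring
        · simp [c2]
      · simp [c1]
    rw [k4, norm_mul, norm_mul, RCLike.norm_conj]
    have k5 := norm_sum_Icc_e_le_cnt (v := min (v i) (v j)) (V := V)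
      ((min_le_left _ _).trans (hv i hi)) (θ i - θ j)
    have := hC i hi
    have := hC j hj
    calc ‖C i‖ * ‖C j‖ * ‖∑ n ∈ Icc 1 (min (v i) (v j)), e (n * (θ i - θ j))‖
        ≤ f * f * cnt V (θ i - θ j) := by gcongr
      _ = _ := by ring
  rw [h1]
  calc ‖∑ n ∈ Icc 1 V, G n * ∑ i ∈ S, D i n‖ ^ 2
      ≤ (g * ∑ n ∈ Icc 1 V, ‖∑ i ∈ S, D i n‖) ^ 2 := by gcongr
    _ = g ^ 2 * (∑ n ∈ Icc 1 V, ‖∑ i ∈ S, D i n‖) ^ 2 := by ring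
    _ ≤ g ^ 2 * (V * (f ^ 2 * ∑ i ∈ S, ∑ j ∈ S, (cnt V (θ i - θ j) : ℝ))) := by
        gcongr
        exact h3.trans (by gcongr)
    _ = _ := by ring

lemma sum_conv_mul (f g : ArithmeticFunction ℝ) (N : ℕ) (w : ℕ → ℂ) :
    ∑ n ∈ Icc 1 N, ((f * g) n : ℂ) * w n =
      ∑ m ∈ Icc 1 N, (f m : ℂ) * ∑ n ∈ Icc 1 (N / m), (g n : ℂ) * w (m * n) := by
  have h1 : ∀ n ∈ Icc 1 N, ((f * g) n : ℂ) * w n =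
      ∑ x ∈ Icc 1 N ×ˢ Icc 1 N with x.1 * x.2 = n, (f x.1 : ℂ) * g x.2 * w (x.1 * x.2) := by
    intro n hn
    rw [mem_Icc] at hn
    rw [ArithmeticFunction.mul_apply, Nat.divisorsAntidiagonal_eq_prod_filter_of_le (by omega) hn.2]
    push_cast
    rw [sum_mul]
    refine sum_congr rfl fun x hx => ?_
    rw [(mem_filter.1 hx).2]
  rw [sum_congr rfl h1]
  simp only [sum_filter]
  rw [sum_comm, sum_product]
  refine sum_congr rfl fun m hm => ?_
  rw [mem_Icc] at hm
  rw [mul_sum]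
  have h2 : Icc 1 (N / m) = {n ∈ Icc 1 N | m * n ≤ N} := by
    ext n
    simp only [mem_Icc, mem_filter]
    rw [Nat.le_div_iff_mul_le (by omega), mul_comm n m]
    constructor
    · rintro ⟨a1, a2⟩
      exact ⟨⟨a1, (Nat.le_mul_of_pos_left n (by omega)).trans a2⟩, a2⟩
    · rintro ⟨⟨a1, _⟩, a2⟩
      exact ⟨a1, a2⟩
  rw [h2, sum_filter]
  refine sum_congr rfl fun n hn => ?_
  rw [sum_ite_eq]
  rw [mem_Icc] at hn
  have h3 : m * n ∈ Icc 1 N ↔ m * n ≤ N := by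
    rw [mem_Icc]
    exact ⟨fun h => h.2, fun h => ⟨Nat.mul_pos (by omega) (by omega), h⟩⟩
  simp only [h3]
  split_ifs
  · ring
  · rfl

/-- The same with the outer variable running over any set of positive integers containing the
relevant part of the support. -/
lemma sum_conv_mul_of_support (f g : ArithmeticFunction ℝ) (N : ℕ) (w : ℕ → ℂ) (D : Finset ℕ)
    (hD0 : ∀ m ∈ D, 0 < m) (hD : ∀ m ≤ N, f m ≠ 0 → m ∈ D) :
    ∑ n ∈ Icc 1 N, ((f * g) n : ℂ) * w n =
      ∑ m ∈ D, (f m : ℂ) * ∑ n ∈ Icc 1 (N / m), (g n : ℂ) * w (m * n) := by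
  rw [sum_conv_mul]
  have h1 : ∀ m ∈ D, m ∉ Icc 1 N → (f m : ℂ) * ∑ n ∈ Icc 1 (N / m), (g n : ℂ) * w (m * n) = 0 := by
    intro m hm hmN
    have := hD0 m hm
    rw [mem_Icc] at hmN
    rw [Nat.div_eq_of_lt (by omega)]
    simp
  have h2 : ∀ m ∈ Icc 1 N, m ∉ D → (f m : ℂ) * ∑ n ∈ Icc 1 (N / m), (g n : ℂ) * w (m * n) = 0 := by
    intro m hm hmD
    rw [mem_Icc] at hm
    by_cases h0 : f m = 0
    · rw [h0]; simp
    · exact absurd (hD m hm.2 h0) hmD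
  calc _ = ∑ m ∈ Icc 1 N ∩ D, (f m : ℂ) * ∑ n ∈ Icc 1 (N / m), (g n : ℂ) * w (m * n) := by
        symm; apply sum_subset inter_subset_left
        intro m hm hm'
        exact h2 m hm (fun h => hm' (mem_inter.2 ⟨hm, h⟩))
    _ = _ := by
        apply sum_subset inter_subset_right
        intro m hm hm'
        exact h1 m hm (fun h => hm' (mem_inter.2 ⟨h, hm⟩))

lemma exists_unit_mul_eq_norm (z : ℂ) : ∃ c : ℂ, ‖c‖ ≤ 1 ∧ c * z = (‖z‖ : ℂ) := by
  by_cases hz : z = 0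
  · exact ⟨0, by simp, by simp [hz]⟩
  · have hn : (‖z‖ : ℂ) ≠ 0 := by exact_mod_cast norm_ne_zero_iff.2 hz
    refine ⟨(starRingEnd ℂ) z / ‖z‖, ?_, ?_⟩
    · rw [norm_div, RCLike.norm_conj, Complex.norm_real, norm_norm, div_self (norm_ne_zero_iff.2 hz)]
    · rw [div_mul_eq_mul_div, mul_comm, Complex.mul_conj, Complex.normSq_eq_norm_sq]
      push_cast; field_simp

/-! ### The bilinear estimate on a dyadic block -/

namespace Ctx

variable {κ u R L T B : ℝ} {a q : ℕ}

/-- The quantities A and C below are the squares of the two terms of the target. The bound M ≤ u^4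
gives K ≪ T u^4, which places the trivial count V(RK)^2 under A. The bound M ≥ u^2/2 gives V ≪ u^10,
which places the terms with V^2 under C. The lower bound on q enters only in the last term, through
L u^4/q ≪ R. -/
lemma typeII_numeric (h : Ctx κ u R L T B a q) {V K M : ℝ} (hV0 : 0 ≤ V) (hK0 : 0 ≤ K)
    (hVM : V * M ≤ u ^ 12) (hK : K ≤ 4 * L * M) (hM : u ^ 2 ≤ 2 * M) (hM' : M ≤ u ^ 4) :
    V * (4 * (R * K) ^ 2 + B ^ 3 * (V * (R * K) + B * (R ^ 3 * K)) +
        (1 + K / R) * (B ^ 8 * (B * (R ^ 3 * K) + B * (R ^ 2 * q) + V * (R * K) / q))) ≤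
      B ^ 11 * target u R T ^ 2 := by
  have hκ := h.one_le_kappa
  have hu := h.one_le_u
  have hR := h.one_le_R
  have hL := h.one_le_L
  have hB := h.B_pos
  have hB16 := h.B_ge
  have hκB := h.kappa_le_B
  have hq0 : (0 : ℝ) < q := by exact_mod_cast h.q_pos
  have hq1 : (1 : ℝ) ≤ q := by exact_mod_cast h.q_pos
  have hT := h.T_pos
  have hLT := h.L_le_T
  have hRT := h.R_le_T
  have hM0 : 0 < M := by nlinarith [one_le_pow₀ hu (n := 2)]
  set A := u ^ 16 * (T * R) ^ 2 with hA
  set C := u ^ 22 * (T * R) with hC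
  have hA0 : 0 ≤ A := by positivity
  have hC0 : 0 ≤ C := by positivity
  have hAC : A + C ≤ target u R T ^ 2 := by
    have hs : √(T * R) ^ 2 = T * R := Real.sq_sqrt (by positivity)
    have : 0 ≤ 2 * (u ^ 8 * (T * R)) * (u ^ 11 * √(T * R)) := by positivity
    have e1 : target u R T ^ 2 = A + u ^ 22 * √(T * R) ^ 2 +
        2 * (u ^ 8 * (T * R)) * (u ^ 11 * √(T * R)) := by unfold target; rw [hA]; ring
    rw [e1, hs]; linarith
  have hVK : V * K ≤ 4 * L * u ^ 12 := by
    calc V * K ≤ V * (4 * L * M) := by gcongr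
      _ = 4 * L * (V * M) := by ring
      _ ≤ _ := by gcongr
  have hK2 : K ≤ 4 * L * u ^ 4 := hK.trans (by gcongr)
  have hV2 : V ≤ 2 * u ^ 10 := by
    have : V * u ^ 2 ≤ (2 * u ^ 10) * u ^ 2 := by
      calc V * u ^ 2 ≤ V * (2 * M) := by gcongr
        _ = 2 * (V * M) := by ring
        _ ≤ 2 * u ^ 12 := by gcongr
        _ = _ := by ring
    exact le_of_mul_le_mul_right this (by positivity)
  have hqB : (q : ℝ) ≤ B * u ^ 8 := h.q_le.trans (by gcongr)
  have hLq : L * u ^ 4 / q ≤ B * R := by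
    rw [div_le_iff₀ hq0]
    calc L * u ^ 4 ≤ T * u ^ 4 := by gcongr
      _ ≤ κ * R * q := h.T_le
      _ ≤ _ := by gcongr
  have p18 : u ^ 18 ≤ u ^ 22 := pow_le_pow_right₀ hu (by norm_num)
  have p20 : u ^ 20 ≤ u ^ 22 := pow_le_pow_right₀ hu (by norm_num)
  have p12 : u ^ 12 ≤ u ^ 16 := pow_le_pow_right₀ hu (by norm_num)
  obtain ⟨P, hP⟩ : ∃ P, P = V * K := ⟨_, rfl⟩
  have hVK'' : P ≤ 4 * L * u ^ 12 := by rw [hP]; exact hVK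
  have hP0 : 0 ≤ P := by rw [hP]; positivity
  have hVK' : P ≤ 4 * T * u ^ 12 := by rw [hP]; exact hVK.trans (by gcongr)
  have hVK16 : P ≤ 4 * T * u ^ 16 := hVK'.trans (by gcongr)
  have hK2' : K ≤ 4 * T * u ^ 4 := hK2.trans (by gcongr)
  have t1 : V * (R * K) ^ 2 ≤ 16 * A := by
    calc V * (R * K) ^ 2 = R ^ 2 * P * K := by rw [hP]; ring
      _ ≤ R ^ 2 * (4 * T * u ^ 12) * (4 * T * u ^ 4) := by
          gcongr
      _ = _ := by rw [hA]; ring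
  have t2 : V * (V * (R * K)) ≤ 8 * C := by
    calc V * (V * (R * K)) = V * P * R := by rw [hP]; ring
      _ ≤ (2 * u ^ 10) * (4 * T * u ^ 12) * R := by
          gcongr
      _ = _ := by rw [hC]; ring
  have t3 : V * (R ^ 3 * K) ≤ 4 * A := by
    calc V * (R ^ 3 * K) = P * R * R ^ 2 := by rw [hP]; ring
      _ ≤ (4 * T * u ^ 16) * T * R ^ 2 := by
          gcongr
      _ = _ := by rw [hA]; ring
  have t4 : V * (R ^ 2 * q) ≤ 2 * B * C := by
    calc V * (R ^ 2 * q) = V * (R * R * q) := by ring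
      _ ≤ (2 * u ^ 10) * (T * R * (B * u ^ 8)) := by gcongr
      _ = 2 * B * (u ^ 18 * (T * R)) := by ring
      _ ≤ _ := by rw [hC]; gcongr
  have t5 : V * (V * (R * K) / q) ≤ 8 * C := by
    rw [← mul_div_assoc]; exact (div_le_self (by positivity) hq1).trans t2
  have t6 : V * (K / R * (R ^ 3 * K)) ≤ 16 * A := by
    calc V * (K / R * (R ^ 3 * K)) = V * (R * K) ^ 2 := by field_simp
      _ ≤ _ := t1
  have t7 : V * (K / R * (R ^ 2 * q)) ≤ 4 * B * C := by
    calc V * (K / R * (R ^ 2 * q)) = P * R * q := by rw [hP]; field_simp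
      _ ≤ (4 * T * u ^ 12) * R * (B * u ^ 8) := by
          gcongr
      _ = 4 * B * (u ^ 20 * (T * R)) := by ring
      _ ≤ _ := by rw [hC]; gcongr
  have t8 : V * (K / R * (V * (R * K) / q)) ≤ 16 * B * C := by
    calc V * (K / R * (V * (R * K) / q)) = P * P / q := by rw [hP]; field_simp
      _ ≤ (4 * T * u ^ 12) * (4 * L * u ^ 12) / q := by
          gcongr
      _ = 16 * T * u ^ 20 * (L * u ^ 4 / q) := by ring
      _ ≤ 16 * T * u ^ 20 * (B * R) := by gcongr
      _ = 16 * B * (u ^ 20 * (T * R)) := by ring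
      _ ≤ _ := by rw [hC]; gcongr
  have expand : V * (4 * (R * K) ^ 2 + B ^ 3 * (V * (R * K) + B * (R ^ 3 * K)) +
        (1 + K / R) * (B ^ 8 * (B * (R ^ 3 * K) + B * (R ^ 2 * q) + V * (R * K) / q))) =
      4 * (V * (R * K) ^ 2) + B ^ 3 * (V * (V * (R * K))) + B ^ 4 * (V * (R ^ 3 * K)) +
      B ^ 9 * (V * (R ^ 3 * K)) + B ^ 9 * (V * (R ^ 2 * q)) + B ^ 8 * (V * (V * (R * K) / q)) +
      B ^ 9 * (V * (K / R * (R ^ 3 * K))) + B ^ 9 * (V * (K / R * (R ^ 2 * q))) +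
      B ^ 8 * (V * (K / R * (V * (R * K) / q))) := by ring
  rw [expand]
  have hB1 : 1 ≤ B := by linarith
  calc _ ≤ 4 * (16 * A) + B ^ 3 * (8 * C) + B ^ 4 * (4 * A) + B ^ 9 * (4 * A) + B ^ 9 * (2 * B * C) +
        B ^ 8 * (8 * C) + B ^ 9 * (16 * A) + B ^ 9 * (4 * B * C) + B ^ 8 * (16 * B * C) := by gcongr
    _ = (64 * 1 + 4 * B ^ 4 + 20 * B ^ 9) * A +
        (8 * B ^ 3 + 8 * B ^ 8 + 16 * B ^ 9 + 6 * B ^ 10) * C := by ring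
    _ ≤ (64 * B ^ 9 + 4 * B ^ 9 + 20 * B ^ 9) * A +
        (1 * B ^ 10 + 1 * B ^ 10 + 1 * B ^ 10 + 6 * B ^ 10) * C := by
        have q0 : 1 ≤ B ^ 9 := one_le_pow₀ hB1
        have q1 : B ^ 4 ≤ B ^ 9 := pow_le_pow_right₀ hB1 (by norm_num)
        have q2 : 8 * B ^ 3 ≤ 1 * B ^ 10 := by
          calc 8 * B ^ 3 ≤ B * B ^ 3 := by gcongr; linarith
            _ = B ^ 4 := by ring
            _ ≤ B ^ 10 := pow_le_pow_right₀ hB1 (by norm_num)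
            _ = _ := by ring
        have q3 : 8 * B ^ 8 ≤ 1 * B ^ 10 := by
          calc 8 * B ^ 8 ≤ B * B ^ 8 := by gcongr; linarith
            _ = B ^ 9 := by ring
            _ ≤ B ^ 10 := pow_le_pow_right₀ hB1 (by norm_num)
            _ = _ := by ring
        have q4 : 16 * B ^ 9 ≤ 1 * B ^ 10 := by
          calc 16 * B ^ 9 ≤ B * B ^ 9 := by gcongr
            _ = _ := by ring
        gcongr
    _ = (88 * B ^ 9) * A + (9 * B ^ 10) * C := by ring
    _ ≤ (16 * 16 * B ^ 9) * A + (16 * B ^ 10) * C := by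
        gcongr
        · norm_num
        · norm_num
    _ ≤ (B * B * B ^ 9) * A + (B * B ^ 10) * C := by gcongr
    _ = B ^ 11 * (A + C) := by ring
    _ ≤ _ := by gcongr

/-- Bilinear sums whose first variable lies in a dyadic block between `X^{1/6}` and `X^{1/3}`. -/
lemma errSum_dyadic_conv_le (h : Ctx κ u R L T B a q) {N : ℕ → ℕ} (hN : ∀ r, (N r : ℝ) ≤ u ^ 12)
    {M : ℝ} (hM1 : 1 ≤ M) (hM : u ^ 2 ≤ 2 * M) (hM' : M ≤ u ^ 4) {F G : ArithmeticFunction ℝ}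
    {i j : ℕ} (hFs : ∀ m, F m ≠ 0 → m ∈ dyadic M) (hF : ∀ m : ℕ, (m : ℝ) ≤ u ^ 12 → |F m| ≤ B ^ i)
    (hG : ∀ m : ℕ, (m : ℝ) ≤ u ^ 12 → |G m| ≤ B ^ j) :
    errSum R L a q N (F * G) ≤ B ^ (i + j + 7) * target u R T := by
  have hκ := h.one_le_kappa
  have hu := h.one_le_u
  have hR := h.one_le_R
  have hL := h.one_le_L
  have hB := h.B_pos
  have hM0 : 0 < M := by linarith
  have hdM : ∀ m ∈ dyadic M, 0 < m := fun m hm => by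
    have : (1 : ℝ) ≤ m := hM1.trans (mem_dyadic.1 hm).1
    exact_mod_cast this
  set S := dyadic R ×ˢ (dyadic L ×ˢ dyadic M) with hS
  set V := ⌊u ^ 12 / M⌋₊ with hV
  set K := ⌊4 * L * M⌋₊ with hK
  have hVle : (V : ℝ) ≤ u ^ 12 / M := Nat.floor_le (by positivity)
  have hVM : (V : ℝ) * M ≤ u ^ 12 := by rwa [le_div_iff₀ hM0] at hVle
  have hKle : (K : ℝ) ≤ 4 * L * M := Nat.floor_le (by positivity)
  have hV12 : (V : ℝ) ≤ u ^ 12 := hVle.trans (div_le_self (by positivity) hM1)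
  have hV1 : 0 < V := by
    apply Nat.floor_pos.2
    rw [le_div_iff₀ hM0, one_mul]
    exact hM'.trans (pow_le_pow_right₀ hu (by norm_num))
  have hVlog : 1 + Real.log V ≤ B := h.log_nat_le hV1 (hV12.trans (by
    calc u ^ 12 = 1 * κ ^ 0 * u ^ 12 := by ring
      _ ≤ _ := h.small (by norm_num) (by norm_num) (by norm_num)))
  have hKbd : 4 * κ * (R * K) ≤ 10 ^ 4 * κ ^ 8 * u ^ 48 := by
    calc 4 * κ * (R * K) ≤ 4 * κ * ((2 * κ * u ^ 12) * (4 * (2 * κ ^ 3 * u ^ 16) * u ^ 4)) := by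
          have := h.R_le
          have : (K : ℝ) ≤ 4 * (2 * κ ^ 3 * u ^ 16) * u ^ 4 := hKle.trans (by
            have := h.L_le_T.trans h.T_le'
            gcongr)
          gcongr
      _ = 64 * κ ^ 5 * u ^ 32 := by ring
      _ ≤ _ := h.small (by norm_num) (by norm_num) (by norm_num)
  choose c hc1 hc2 using fun r l : ℕ =>
    exists_unit_mul_eq_norm (∑ n ∈ Icc 1 (N r), ((F * G) n : ℂ) * e (n * (l * ((a : ℝ) / (r * q)))))
  -- The bound for F is known only up to u^12. Beyond it the inner sum is empty, so the coefficient
  -- may be set to zero.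
  set C : ℕ × ℕ × ℕ → ℂ := fun x => if (x.2.2 : ℝ) ≤ u ^ 12 then c x.1 x.2.1 * F x.2.2 else 0 with hC
  set θ : ℕ × ℕ × ℕ → ℝ := fun x => ((x.2.1 * x.2.2 : ℕ) : ℝ) * ((a : ℝ) / (x.1 * q)) with hθ
  have hexp : (errSum R L a q N (F * G) : ℂ) =
      ∑ x ∈ S, C x * ∑ n ∈ Icc 1 (N x.1 / x.2.2), (G n : ℂ) * e (n * θ x) := by
    unfold errSum
    push_cast
    rw [hS, sum_product]
    refine sum_congr rfl fun r hr => ?_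
    rw [sum_product]
    refine sum_congr rfl fun l hl => ?_
    rw [← hc2 r l, sum_conv_mul_of_support F G (N r) _ (dyadic M) hdM (fun m _ hm => hFs m hm), mul_sum]
    refine sum_congr rfl fun m hm => ?_
    simp only [hC, hθ]
    split_ifs with hmu
    · rw [mul_assoc]
      congr 2
      refine sum_congr rfl fun n _ => ?_
      congr 2; push_cast; ring
    · have : N r / m = 0 := by
        apply Nat.div_eq_of_lt
        have : (N r : ℝ) < m := lt_of_le_of_lt (hN r) (not_le.1 hmu)
        exact_mod_cast this
      rw [this]; simp
  have hv : ∀ x ∈ S, N x.1 / x.2.2 ≤ V := by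
    intro x hx
    rw [hS, mem_product, mem_product] at hx
    apply Nat.le_floor
    refine Nat.cast_div_le.trans ?_
    have h1 := (mem_dyadic.1 hx.2.2).1
    have h2 := hN x.1
    gcongr
  have hCb : ∀ x ∈ S, ‖C x‖ ≤ B ^ i := by
    intro x _
    simp only [hC]
    split_ifs with hmu
    · rw [norm_mul, Complex.norm_real, Real.norm_eq_abs]
      calc ‖c x.1 x.2.1‖ * |F x.2.2| ≤ 1 * B ^ i := by
            have := hc1 x.1 x.2.1
            have := hF x.2.2 hmu
            gcongr
        _ = _ := one_mul _
    · simp; positivity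
  have hGb : ∀ n ∈ Icc 1 V, ‖(G n : ℂ)‖ ≤ B ^ j := by
    intro n hn
    rw [Complex.norm_real, Real.norm_eq_abs]
    apply hG
    have : (n : ℝ) ≤ V := by exact_mod_cast (mem_Icc.1 hn).2
    linarith
  have hbil := norm_bilinear_sq_le S C θ (fun x => N x.1 / x.2.2) hv (fun n => (G n : ℂ)) hCb hGb
    (by positivity)
  -- passing from triples to points
  set φ : ℕ × ℕ × ℕ → ℕ × ℕ := fun x => (x.1, x.2.1 * x.2.2) with hφ
  have hmaps : ∀ x ∈ S, φ x ∈ pts R K := by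
    intro x hx
    rw [hS, mem_product, mem_product] at hx
    simp only [hφ, mem_pts]
    refine ⟨mem_dyadic.1 hx.1, Nat.mul_pos (h.pos_of_mem' hx.2.1) (hdM _ hx.2.2), ?_⟩
    apply Nat.le_floor
    have h1 := (mem_dyadic.1 hx.2.1).2.le
    have h2 := (mem_dyadic.1 hx.2.2).2.le
    push_cast
    calc (x.2.1 : ℝ) * x.2.2 ≤ (2 * L) * (2 * M) := by gcongr
      _ = _ := by ring
  have hfib : ∀ p ∈ pts R K, (#{x ∈ S | φ x = p} : ℝ) ≤ B := by
    rintro ⟨r, k⟩ hp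
    rw [mem_pts] at hp
    have hk : (k : ℝ) ≤ 10 ^ 4 * κ ^ 8 * u ^ 48 := by
      refine le_trans ?_ hKbd
      have h1 : (k : ℝ) ≤ K := by exact_mod_cast hp.2.2
      have h2 : (K : ℝ) ≤ R * K := le_mul_of_one_le_left (by positivity) hR
      have h3 : R * (K : ℝ) ≤ 4 * κ * (R * K) := le_mul_of_one_le_left (by positivity) (by linarith)
      linarith
    refine le_trans ?_ (h.divisors_le k hp.2.1 hk)
    rw [Nat.cast_le]
    refine le_trans ?_ (card_pairs_mul_eq_le (dyadic L ×ˢ dyadic M) hp.2.1)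
    apply card_le_card_of_injOn (fun x => x.2)
    · rintro ⟨x1, x2, x3⟩ hx
      simp only [coe_filter, Set.mem_ofPred_eq, hS, mem_product, hφ, Prod.mk.injEq] at hx ⊢
      exact ⟨hx.1.2, hx.2.2⟩
    · rintro ⟨x1, x2, x3⟩ hx ⟨y1, y2, y3⟩ hy hxy
      simp only [coe_filter, Set.mem_ofPred_eq, hφ, Prod.mk.injEq] at hx hy hxy
      rw [hx.2.1, hy.2.1, hxy.1, hxy.2]
  have hcnt : ∑ x ∈ S, ∑ y ∈ S, (cnt V (θ x - θ y) : ℝ) ≤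
      B ^ 2 * ∑ p ∈ pts R K ×ˢ pts R K, (cnt V (diff a q p) : ℝ) := by
    have e1 : ∀ x y, θ x - θ y = diff a q (φ x, φ y) := by
      intro x y; simp only [hθ, hφ, diff]
    simp only [e1]
    calc ∑ x ∈ S, ∑ y ∈ S, (cnt V (diff a q (φ x, φ y)) : ℝ)
        ≤ ∑ x ∈ S, B * ∑ p' ∈ pts R K, (cnt V (diff a q (φ x, p')) : ℝ) := by
          refine sum_le_sum fun x _ => ?_
          exact sum_comp_le_mul_sum S (pts R K) φ hmaps
            (f := fun p' => (cnt V (diff a q (φ x, p')) : ℝ)) (fun _ _ => by positivity) hfib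
      _ ≤ B * ∑ p ∈ pts R K, B * ∑ p' ∈ pts R K, (cnt V (diff a q (p, p')) : ℝ) :=
          sum_comp_le_mul_sum S (pts R K) φ hmaps
            (f := fun p => B * ∑ p' ∈ pts R K, (cnt V (diff a q (p, p')) : ℝ))
            (fun _ _ => by positivity) hfib
      _ = _ := by rw [sum_product, ← mul_sum]; ring
  have hsum := h.sum_cnt_le hKbd V hVlog
  have hnum := h.typeII_numeric (V := V) (K := K) (by positivity) (by positivity) hVM hKle hM hM'
  have hE : ‖(errSum R L a q N (F * G) : ℂ)‖ ^ 2 ≤ (B ^ (i + j + 7) * target u R T) ^ 2 := by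
    rw [hexp]
    refine hbil.trans ?_
    calc (B ^ i) ^ 2 * (B ^ j) ^ 2 * V * ∑ x ∈ S, ∑ y ∈ S, (cnt V (θ x - θ y) : ℝ)
        ≤ (B ^ i) ^ 2 * (B ^ j) ^ 2 * V *
          (B ^ 2 * ∑ p ∈ pts R K ×ˢ pts R K, (cnt V (diff a q p) : ℝ)) := by gcongr
      _ = (B ^ i) ^ 2 * (B ^ j) ^ 2 * B ^ 2 *
          (V * ∑ p ∈ pts R K ×ˢ pts R K, (cnt V (diff a q p) : ℝ)) := by ring
      _ ≤ (B ^ i) ^ 2 * (B ^ j) ^ 2 * B ^ 2 * (B ^ 11 * target u R T ^ 2) := by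
          refine mul_le_mul_of_nonneg_left ?_ (by positivity)
          exact le_trans (mul_le_mul_of_nonneg_left hsum (by positivity)) hnum
      _ = B ^ (2 * i + 2 * j + 13) * target u R T ^ 2 := by ring
      _ ≤ B ^ (2 * i + 2 * j + 14) * target u R T ^ 2 := by
          gcongr
          · linarith [h.B_ge]
          · norm_num
      _ = _ := by ring
  have hE0 : 0 ≤ errSum R L a q N (F * G) :=
    sum_nonneg fun _ _ => sum_nonneg fun _ _ => norm_nonneg _
  rw [Complex.norm_real, Real.norm_of_nonneg hE0] at hE
  exact le_of_sq_le_sq hE (mul_nonneg (by positivity) h.target_nonneg)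

end Ctx

/-! ### Truncations and supports of arithmetic functions -/

/-- The part of `f` supported on `n ≤ y`. -/
noncomputable def low (y : ℝ) (f : ArithmeticFunction ℝ) : ArithmeticFunction ℝ :=
  ⟨fun n => if (n : ℝ) ≤ y then f n else 0, by simp⟩

/-- The part of `f` supported on `n > y`. -/
noncomputable def high (y : ℝ) (f : ArithmeticFunction ℝ) : ArithmeticFunction ℝ :=
  ⟨fun n => if (n : ℝ) ≤ y then 0 else f n, by simp⟩

lemma low_apply (y : ℝ) (f : ArithmeticFunction ℝ) (n : ℕ) :
    low y f n = if (n : ℝ) ≤ y then f n else 0 := rfl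

lemma high_apply (y : ℝ) (f : ArithmeticFunction ℝ) (n : ℕ) :
    high y f n = if (n : ℝ) ≤ y then 0 else f n := rfl

lemma low_add_high (y : ℝ) (f : ArithmeticFunction ℝ) : low y f + high y f = f := by
  ext n; rw [ArithmeticFunction.add_apply, low_apply, high_apply]; split_ifs <;> simp

lemma le_of_low_ne_zero {y : ℝ} {f : ArithmeticFunction ℝ} {n : ℕ} (h : low y f n ≠ 0) :
    (n : ℝ) ≤ y := by
  by_contra h0; exact h (by rw [low_apply, if_neg h0])

lemma lt_of_high_ne_zero {y : ℝ} {f : ArithmeticFunction ℝ} {n : ℕ} (h : high y f n ≠ 0) :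
    y < n := by
  by_contra h0; exact h (by rw [high_apply, if_pos (not_lt.1 h0)])

lemma ne_zero_of_low_ne_zero {y : ℝ} {f : ArithmeticFunction ℝ} {n : ℕ} (h : low y f n ≠ 0) :
    f n ≠ 0 := by
  intro h0; apply h; rw [low_apply, h0, ite_self]

lemma ne_zero_of_high_ne_zero {y : ℝ} {f : ArithmeticFunction ℝ} {n : ℕ} (h : high y f n ≠ 0) :
    f n ≠ 0 := by
  intro h0; apply h; rw [high_apply, h0, ite_self]

lemma abs_low_le (y : ℝ) (f : ArithmeticFunction ℝ) (n : ℕ) : |low y f n| ≤ |f n| := by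
  rw [low_apply]; split_ifs <;> simp

lemma abs_high_le (y : ℝ) (f : ArithmeticFunction ℝ) (n : ℕ) : |high y f n| ≤ |f n| := by
  rw [high_apply]; split_ifs <;> simp

lemma exists_of_mul_ne_zero {f g : ArithmeticFunction ℝ} {n : ℕ} (h : (f * g) n ≠ 0) :
    ∃ x y : ℕ, x * y = n ∧ f x ≠ 0 ∧ g y ≠ 0 := by
  rw [ArithmeticFunction.mul_apply] at h
  obtain ⟨⟨x, y⟩, hp, hne⟩ := exists_ne_zero_of_sum_ne_zero h
  exact ⟨x, y, (Nat.mem_divisorsAntidiagonal.1 hp).1, left_ne_zero_of_mul hne,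
    right_ne_zero_of_mul hne⟩

lemma one_le_of_ne_zero {f : ArithmeticFunction ℝ} {n : ℕ} (h : f n ≠ 0) : (1 : ℝ) ≤ n := by
  rcases Nat.eq_zero_or_pos n with h0 | h0
  · rw [h0] at h; simp at h
  · exact_mod_cast h0

lemma le_mul_of_mul_ne_zero {f g : ArithmeticFunction ℝ} {x y : ℝ}
    (hf : ∀ n, f n ≠ 0 → (n : ℝ) ≤ x) (hg : ∀ n, g n ≠ 0 → (n : ℝ) ≤ y) {n : ℕ}
    (h : (f * g) n ≠ 0) : (n : ℝ) ≤ x * y := by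
  obtain ⟨i, j, rfl, hi, hj⟩ := exists_of_mul_ne_zero h
  have h1 := hf i hi
  have h2 := hg j hj
  have : (0 : ℝ) ≤ x := le_trans (by positivity) h1
  push_cast; gcongr

lemma mul_lt_of_mul_ne_zero {f g : ArithmeticFunction ℝ} {x y : ℝ} (hy : 0 < y)
    (hf : ∀ n, f n ≠ 0 → x < n) (hg : ∀ n, g n ≠ 0 → y ≤ n) {n : ℕ}
    (h : (f * g) n ≠ 0) : x * y < n := by
  obtain ⟨i, j, rfl, hi, hj⟩ := exists_of_mul_ne_zero h
  have h1 := hf i hi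
  have h2 := hg j hj
  push_cast
  exact mul_lt_mul h1 h2 hy (by positivity)

/-! ### `errSum` as a seminorm -/

section errSum

variable {R L : ℝ} {a q : ℕ} {N : ℕ → ℕ}

lemma errSum_add_le (f g : ArithmeticFunction ℝ) :
    errSum R L a q N (f + g) ≤ errSum R L a q N f + errSum R L a q N g := by
  unfold errSum
  rw [← sum_add_distrib]
  refine sum_le_sum fun r _ => ?_
  rw [← sum_add_distrib]
  refine sum_le_sum fun l _ => ?_
  refine le_trans (le_of_eq ?_) (norm_add_le _ _)
  rw [← sum_add_distrib]
  congr 1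
  refine sum_congr rfl fun n _ => ?_
  rw [ArithmeticFunction.add_apply]; push_cast; ring

lemma errSum_neg (f : ArithmeticFunction ℝ) :
    errSum R L a q N (-f) = errSum R L a q N f := by
  unfold errSum
  refine sum_congr rfl fun r _ => sum_congr rfl fun l _ => ?_
  rw [← norm_neg, ← sum_neg_distrib]
  congr 1
  refine sum_congr rfl fun n _ => ?_
  rw [ArithmeticFunction.neg_apply]; push_cast; ring

lemma errSum_eq_zero {u : ℝ} (hN : ∀ r, (N r : ℝ) ≤ u ^ 12) {f : ArithmeticFunction ℝ}
    (hf : ∀ n, f n ≠ 0 → u ^ 12 < n) : errSum R L a q N f = 0 := by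
  unfold errSum
  refine sum_eq_zero fun r _ => sum_eq_zero fun l _ => ?_
  rw [norm_eq_zero]
  refine sum_eq_zero fun n hn => ?_
  have : f n = 0 := by
    by_contra h0
    have h1 := hf n h0
    have h2 : (n : ℝ) ≤ N r := by exact_mod_cast (mem_Icc.1 hn).2
    linarith [hN r]
  rw [this]; simp

lemma errSum_zero : errSum R L a q N 0 = 0 := by
  unfold errSum; simp

lemma errSum_sum_le {ι : Type*} (s : Finset ι) (f : ι → ArithmeticFunction ℝ) :
    errSum R L a q N (∑ t ∈ s, f t) ≤ ∑ t ∈ s, errSum R L a q N (f t) := by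
  classical
  induction s using Finset.induction_on with
  | empty => simp [errSum_zero]
  | insert t s ht ih =>
    rw [sum_insert ht, sum_insert ht]
    exact (errSum_add_le _ _).trans (by linarith)

end errSum

/-! ### Bounded and monotone weights -/

/-- `|f(n)| ≤ B ^ i` for `n ≤ u ^ 12`. -/
def Bdd (u B : ℝ) (i : ℕ) (f : ArithmeticFunction ℝ) : Prop :=
  ∀ n : ℕ, (n : ℝ) ≤ u ^ 12 → |f n| ≤ B ^ i

/-- Nonnegative nondecreasing weights of size at most `B`. -/
structure Smooth (u B : ℝ) (f : ArithmeticFunction ℝ) : Prop where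
  mono : Monotone f
  le : ∀ n : ℕ, (n : ℝ) ≤ 2 * u ^ 12 → f n ≤ B

lemma Smooth.nonneg {u B : ℝ} {f : ArithmeticFunction ℝ} (hf : Smooth u B f) (n : ℕ) : 0 ≤ f n := by
  have := hf.mono (Nat.zero_le n)
  simpa using this

/-- Deleting small arguments from a nonnegative nondecreasing weight keeps it nondecreasing. This is
why upper parts of log and ζ may still serve as smooth variables. -/
lemma Smooth.high {u B y : ℝ} {f : ArithmeticFunction ℝ} (hf : Smooth u B f) :
    Smooth u B (high y f) where
  mono := by
    intro m n hmn
    rw [high_apply, high_apply]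
    have h1 : (m : ℝ) ≤ n := by exact_mod_cast hmn
    split_ifs with h2 h3 h3
    · exact le_rfl
    · exact hf.nonneg n
    · linarith
    · exact hf.mono hmn
  le := by
    intro n hn
    rw [high_apply]
    split_ifs
    · exact (hf.nonneg n).trans (hf.le n hn)
    · exact hf.le n hn

lemma Smooth.bdd {u B : ℝ} {f : ArithmeticFunction ℝ} (hf : Smooth u B f) : Bdd u B 1 f := by
  intro n hn
  rw [abs_of_nonneg (hf.nonneg n), pow_one]
  exact hf.le n (by linarith [(Nat.cast_nonneg n : (0 : ℝ) ≤ n)])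

lemma Bdd.low {u B y : ℝ} {i : ℕ} {f : ArithmeticFunction ℝ} (hf : Bdd u B i f) :
    Bdd u B i (low y f) := fun n hn => (abs_low_le y f n).trans (hf n hn)

lemma Bdd.high {u B y : ℝ} {i : ℕ} {f : ArithmeticFunction ℝ} (hf : Bdd u B i f) :
    Bdd u B i (high y f) := fun n hn => (abs_high_le y f n).trans (hf n hn)

/-! ### Convolutions with a middle-sized factor or a smooth factor -/

namespace Ctx

variable {κ u R L T B : ℝ} {a q : ℕ}

lemma bdd_mono (h : Ctx κ u R L T B a q) {i j : ℕ} (hij : i ≤ j) {f : ArithmeticFunction ℝ}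
    (hf : Bdd u B i f) : Bdd u B j f := fun n hn =>
  (hf n hn).trans (pow_le_pow_right₀ (by linarith [h.B_ge]) hij)

lemma bdd_add (h : Ctx κ u R L T B a q) {i : ℕ} {f g : ArithmeticFunction ℝ}
    (hf : Bdd u B i f) (hg : Bdd u B i g) : Bdd u B (i + 1) (f + g) := fun n hn => by
  have h1 := hf n hn
  have h2 := hg n hn
  have hB := h.B_ge
  rw [ArithmeticFunction.add_apply]
  calc |f n + g n| ≤ |f n| + |g n| := abs_add_le _ _
    _ ≤ 2 * B ^ i := by linarith
    _ ≤ B * B ^ i := by gcongr; linarith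
    _ = _ := by ring

lemma bdd_mul (h : Ctx κ u R L T B a q) {i j : ℕ} {f g : ArithmeticFunction ℝ}
    (hf : Bdd u B i f) (hg : Bdd u B j g) : Bdd u B (i + j + 1) (f * g) := fun n hn => by
  have hB := h.B_pos
  rcases Nat.eq_zero_or_pos n with h0 | h0
  · rw [h0]; simp; positivity
  rw [ArithmeticFunction.mul_apply]
  have h1 : ∀ x ∈ n.divisorsAntidiagonal, |f x.1 * g x.2| ≤ B ^ i * B ^ j := by
    rintro ⟨x, y⟩ hx
    obtain ⟨hx1, _⟩ := Nat.mem_divisorsAntidiagonal.1 hx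
    simp only at hx1 ⊢
    have e1 : x ≤ n := Nat.le_of_dvd h0 ⟨y, hx1.symm⟩
    have e2 : y ≤ n := Nat.le_of_dvd h0 ⟨x, by rw [mul_comm]; exact hx1.symm⟩
    have e1' : (x : ℝ) ≤ n := by exact_mod_cast e1
    have e2' : (y : ℝ) ≤ n := by exact_mod_cast e2
    have := hf x (e1'.trans hn)
    have := hg y (e2'.trans hn)
    rw [abs_mul]; gcongr
  refine (abs_sum_le_sum_abs _ _).trans ((sum_le_sum h1).trans ?_)
  rw [sum_const, nsmul_eq_mul]
  have h2 : (#n.divisorsAntidiagonal : ℝ) ≤ B := by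
    have e3 : #n.divisorsAntidiagonal = #n.divisors := by
      rw [← Nat.map_div_right_divisors, card_map]
    rw [e3]
    apply h.divisors_le n h0 (hn.trans _)
    calc u ^ 12 = 1 * κ ^ 0 * u ^ 12 := by ring
      _ ≤ _ := h.small (by norm_num) (by norm_num) (by norm_num)
  calc _ ≤ B * (B ^ i * B ^ j) := by gcongr
    _ = _ := by ring

/-- Bilinear sums whose first variable lies between `X^{1/6}` and `X^{1/3}`. -/
lemma errSum_mid_conv_le (h : Ctx κ u R L T B a q) {N : ℕ → ℕ} (hN : ∀ r, (N r : ℝ) ≤ u ^ 12)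
    {F G : ArithmeticFunction ℝ} {i j : ℕ} (hFs : ∀ m, F m ≠ 0 → u ^ 2 < m ∧ (m : ℝ) ≤ u ^ 4)
    (hF : Bdd u B i F) (hG : Bdd u B j G) :
    errSum R L a q N (F * G) ≤ B ^ (i + j + 9) * target u R T := by
  have hu := h.one_le_u
  have hB := h.B_pos
  have hB16 := h.B_ge
  have hW := h.target_nonneg
  set J := Nat.log 2 ⌊u ^ 4⌋₊ + 1 with hJ
  set Ft : ℕ → ArithmeticFunction ℝ := fun t =>
    ⟨fun m => if Nat.log 2 m = t then F m else 0, by simp⟩ with hFt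
  have hFt_apply : ∀ t m, Ft t m = if Nat.log 2 m = t then F m else 0 := fun _ _ => rfl
  have hsum : F = ∑ t ∈ range J, Ft t := by
    ext m
    have e1 : (∑ t ∈ range J, Ft t) m = ∑ t ∈ range J, Ft t m := by
      have : ∀ s : Finset ℕ, (∑ t ∈ s, Ft t) m = ∑ t ∈ s, Ft t m := by
        intro s
        induction s using Finset.induction_on with
        | empty => simp
        | insert t s ht ih => rw [sum_insert ht, sum_insert ht, ArithmeticFunction.add_apply, ih]
      exact this _
    rw [e1]
    simp only [hFt_apply]
    rw [sum_ite_eq]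
    split_ifs with hm
    · rfl
    · by_contra h0
      apply hm
      rw [mem_range, hJ]
      apply Nat.lt_succ_of_le
      exact Nat.log_mono_right (Nat.le_floor (hFs m h0).2)
  have hterm : ∀ t ∈ range J, errSum R L a q N (Ft t * G) ≤ B ^ (i + j + 7) * target u R T := by
    intro t _
    by_cases hex : ∃ m, Ft t m ≠ 0
    · obtain ⟨m, hm⟩ := hex
      have key : ∀ m, Ft t m ≠ 0 → m ∈ dyadic (2 ^ t) ∧ u ^ 2 < m ∧ (m : ℝ) ≤ u ^ 4 := by
        intro m hm
        rw [hFt_apply] at hm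
        split_ifs at hm with h1
        · refine ⟨?_, hFs m hm⟩
          have hm0 : m ≠ 0 := by rintro rfl; simp at hm
          rw [mem_dyadic, ← h1]
          constructor
          · exact_mod_cast Nat.pow_log_le_self 2 hm0
          · have := Nat.lt_pow_succ_log_self (b := 2) (by norm_num) m
            rw [pow_succ, mul_comm] at this
            exact_mod_cast this
        · exact absurd rfl hm
      obtain ⟨hm1, hm2, hm3⟩ := key m hm
      rw [mem_dyadic] at hm1
      -- A block meeting (u^2, u^4] may start below u^2, but not below u^2/2; this is why the dyadic
      -- estimate asks only for u^2 ≤ 2M.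
      refine h.errSum_dyadic_conv_le hN (M := 2 ^ t) (one_le_pow₀ (by norm_num)) (by linarith)
        (by linarith) (fun m hm => (key m hm).1) (fun m hm => ?_) hG
      rw [hFt_apply]
      split_ifs
      · exact hF m hm
      · simp; positivity
    · push Not at hex
      have : Ft t = 0 := by ext m; exact hex m
      rw [this, zero_mul, errSum_zero]; positivity
  have hJB : (J : ℝ) ≤ 2 * B := by
    have hfl : 0 < ⌊u ^ 4⌋₊ := Nat.floor_pos.2 (one_le_pow₀ hu)
    have h1 := h.log_nat_le hfl (by
      calc (⌊u ^ 4⌋₊ : ℝ) ≤ u ^ 4 := Nat.floor_le (by positivity)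
        _ = 1 * κ ^ 0 * u ^ 4 := by ring
        _ ≤ _ := h.small (by norm_num) (by norm_num) (by norm_num))
    have h2 : (Nat.log 2 ⌊u ^ 4⌋₊ : ℝ) ≤ Real.logb 2 ⌊u ^ 4⌋₊ := by
      have := Real.natLog_le_logb ⌊u ^ 4⌋₊ 2
      exact_mod_cast this
    have h3 : Real.logb 2 ⌊u ^ 4⌋₊ ≤ 2 * Real.log ⌊u ^ 4⌋₊ := by
      unfold Real.logb
      rw [div_le_iff₀ (Real.log_pos (by norm_num))]
      have := Real.log_two_gt_d9
      have : 0 ≤ Real.log ⌊u ^ 4⌋₊ := Real.log_natCast_nonneg _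
      nlinarith
    rw [hJ]; push_cast; linarith
  calc errSum R L a q N (F * G) = errSum R L a q N (∑ t ∈ range J, Ft t * G) := by
        rw [← sum_mul, ← hsum]
    _ ≤ ∑ t ∈ range J, errSum R L a q N (Ft t * G) := errSum_sum_le _ _
    _ ≤ ∑ t ∈ range J, B ^ (i + j + 7) * target u R T := sum_le_sum hterm
    _ = J * (B ^ (i + j + 7) * target u R T) := by rw [sum_const, card_range, nsmul_eq_mul]
    _ ≤ (B * B) * (B ^ (i + j + 7) * target u R T) := by
        gcongr
        exact hJB.trans (by nlinarith)
    _ = _ := by ring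

/-- Reduction of linear sums to the sums of `cap`. -/
lemma errSum_le_of_cap (h : Ctx κ u R L T B a q) {N : ℕ → ℕ} {f : ArithmeticFunction ℝ} {b : ℝ}
    (hb : 0 ≤ b) (hf : ∀ r ∈ dyadic R, ∀ ψ : ℝ, ‖∑ n ∈ Icc 1 (N r), (f n : ℂ) * e (n * ψ)‖ ≤
      b * ∑ m ∈ Icc 1 ⌊u ^ 8⌋₊, cap (u ^ 12 / m) (m * ψ)) :
    errSum R L a q N f ≤ b * (B ^ 5 * target u R T) := by
  refine le_trans ?_ (mul_le_mul_of_nonneg_left h.sum_cap_le hb)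
  unfold errSum
  rw [mul_sum]
  refine sum_le_sum fun r hr => ?_
  rw [mul_sum]
  exact sum_le_sum fun l _ => hf r hr _

/-- Partial summation removes the monotone weight at the cost of its largest value, leaving a
geometric sum of at most u^12/m terms. -/
lemma norm_sum_smooth_le (h : Ctx κ u R L T B a q) {f : ArithmeticFunction ℝ}
    (hf : Smooth u B f) {m A C : ℕ} (hm : 0 < m) (hC : ((m * C : ℕ) : ℝ) ≤ u ^ 12) (hA : 1 ≤ A) (ψ : ℝ) :
    ‖∑ n ∈ Ico A (C + 1), (f n : ℂ) * e ((m * n : ℕ) * ψ)‖ ≤ B * cap (u ^ 12 / m) (m * ψ) := by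
  have hu := h.one_le_u
  have hm' : (1 : ℝ) ≤ m := by exact_mod_cast hm
  have hC2 : (C : ℝ) ≤ u ^ 12 / m := by
    rw [le_div_iff₀ (by linarith)]; push_cast at hC; linarith
  have hC1 : (C : ℝ) ≤ u ^ 12 := hC2.trans (div_le_self (by positivity) hm')
  have hcap0 : 0 ≤ cap (u ^ 12 / m) (m * ψ) := cap_nonneg (by positivity) _
  have e1 : ∀ n : ℕ, e ((m * n : ℕ) * ψ) = e (n * (m * ψ)) := by
    intro n; congr 1; push_cast; ring
  simp only [e1]
  rcases le_total (C + 1) A with hAC | hAC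
  · rw [Ico_eq_empty_of_le hAC]; simp; exact mul_nonneg h.B_pos.le hcap0
  -- Partial summation asks for all tails, including those starting below A. The indicator of A ≤ n
  -- keeps these from exceeding the range; since A ≥ 1 their length is at most C.
  have h2 : ∑ n ∈ Ico A (C + 1), (f n : ℂ) * e (n * (m * ψ)) =
      ∑ n ∈ Ico A (C + 1), (f n : ℂ) * (if A ≤ n then e (n * (m * ψ)) else 0) := by
    refine sum_congr rfl fun n hn => ?_
    rw [if_pos (mem_Ico.1 hn).1]
  rw [h2]
  refine (norm_sum_Ico_monotone_mul_le hf.mono hf.nonneg _ A (C + 1)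
    (G := cap (u ^ 12 / m) (m * ψ)) ?_).trans ?_
  · intro D _
    rw [← sum_filter]
    have : {n ∈ Ico D (C + 1) | A ≤ n} = Ico (max A D) (C + 1) := by
      ext n; simp only [mem_filter, mem_Ico]; omega
    rw [this]
    apply norm_sum_Ico_e_le_cap
    refine le_trans ?_ hC2
    have : C + 1 - max A D ≤ C := by omega
    exact_mod_cast this
  -- The weight is evaluated at the endpoint C + 1, which may exceed u^12; hence the range up to
  -- 2u^12 in `Smooth`.
  · apply mul_le_mul_of_nonneg_right _ hcap0
    apply hf.le
    have := one_le_pow₀ hu (n := 12)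
    push_cast; linarith

/-- Linear sums with one smooth variable. -/
lemma errSum_low_smooth_le (h : Ctx κ u R L T B a q) {N : ℕ → ℕ} (hN : ∀ r, (N r : ℝ) ≤ u ^ 12)
    {A f : ArithmeticFunction ℝ} {i : ℕ} (hAs : ∀ m, A m ≠ 0 → (m : ℝ) ≤ u ^ 8)
    (hA : Bdd u B i A) (hf : Smooth u B f) :
    errSum R L a q N (A * f) ≤ B ^ (i + 6) * target u R T := by
  have hu := h.one_le_u
  have hB := h.B_pos
  have h1 := h.errSum_le_of_cap (N := N) (f := A * f) (b := B ^ (i + 1)) (by positivity) ?_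
  · refine h1.trans (le_of_eq ?_); ring
  · intro r _ ψ
    rw [sum_conv_mul_of_support A f (N r) (fun n => e (n * ψ)) (Icc 1 ⌊u ^ 8⌋₊)
      (fun m hm => (mem_Icc.1 hm).1) (fun m _ hm => mem_Icc.2
        ⟨by exact_mod_cast one_le_of_ne_zero hm, Nat.le_floor (hAs m hm)⟩), mul_sum]
    refine norm_sum_le_of_le _ fun m hm => ?_
    rw [mem_Icc] at hm
    rw [norm_mul, Complex.norm_real, Real.norm_eq_abs]
    have hset : Icc 1 (N r / m) = Ico 1 (N r / m + 1) := by ext; simp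
    rw [hset]
    have hm8 : (m : ℝ) ≤ u ^ 8 := (Nat.le_floor_iff (by positivity)).1 hm.2
    have k1 := hA m (hm8.trans (pow_le_pow_right₀ hu (by norm_num)))
    have k2 := h.norm_sum_smooth_le hf (C := N r / m) (A := 1) hm.1 (by
      refine le_trans ?_ (hN r)
      exact_mod_cast Nat.mul_div_le (N r) m) le_rfl ψ
    have k3 : 0 ≤ B * cap (u ^ 12 / m) (m * ψ) :=
      mul_nonneg hB.le (cap_nonneg (by positivity) _)
    calc _ ≤ B ^ i * (B * cap (u ^ 12 / m) (m * ψ)) := by gcongr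
      _ = _ := by ring

end Ctx

/-- Dirichlet's hyperbola method, splitting according to the smaller variable. -/
lemma sum_conv_mul_hyperbola (f g : ArithmeticFunction ℝ) (N D : ℕ) (hD : N < (D + 1) ^ 2)
    (w : ℕ → ℂ) :
    ∑ n ∈ Icc 1 N, ((f * g) n : ℂ) * w n =
      ∑ x ∈ Icc 1 D, (f x : ℂ) * ∑ y ∈ Ico x (N / x + 1), (g y : ℂ) * w (x * y) +
      ∑ y ∈ Icc 1 D, (g y : ℂ) * ∑ x ∈ Ico (y + 1) (N / y + 1), (f x : ℂ) * w (y * x) := by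
  set P := {p ∈ Icc 1 N ×ˢ Icc 1 N | p.1 * p.2 ≤ N} with hP
  set F : ℕ × ℕ → ℂ := fun p => (f p.1 : ℂ) * g p.2 * w (p.1 * p.2) with hF
  have hmem : ∀ x y : ℕ, (x, y) ∈ P ↔ 1 ≤ x ∧ 1 ≤ y ∧ x * y ≤ N := by
    intro x y
    simp only [hP, mem_filter, mem_product, mem_Icc]
    constructor
    · rintro ⟨⟨⟨a1, _⟩, a2, _⟩, a3⟩; exact ⟨a1, a2, a3⟩
    · rintro ⟨a1, a2, a3⟩
      exact ⟨⟨⟨a1, (Nat.le_mul_of_pos_right x a2).trans a3⟩, a2,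
        (Nat.le_mul_of_pos_left y a1).trans a3⟩, a3⟩
  have h0 : ∑ n ∈ Icc 1 N, ((f * g) n : ℂ) * w n = ∑ p ∈ P, F p := by
    rw [sum_conv_mul]
    simp only [mul_sum]
    rw [sum_sigma']
    refine sum_bij' (fun s _ => (s.1, s.2)) (fun p _ => ⟨p.1, p.2⟩) ?_ ?_ ?_ ?_ ?_
    · rintro ⟨x, y⟩ hxy
      simp only [mem_sigma, mem_Icc] at hxy
      rw [hmem]
      refine ⟨hxy.1.1, hxy.2.1, ?_⟩
      rw [mul_comm]; exact (Nat.le_div_iff_mul_le hxy.1.1).1 hxy.2.2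
    · rintro ⟨x, y⟩ hxy
      obtain ⟨a1, a2, a3⟩ := (hmem x y).1 hxy
      simp only [mem_sigma, mem_Icc]
      refine ⟨⟨a1, (Nat.le_mul_of_pos_right x a2).trans a3⟩, a2, ?_⟩
      rw [Nat.le_div_iff_mul_le a1, mul_comm]; exact a3
    · rintro ⟨x, y⟩ _; rfl
    · rintro ⟨x, y⟩ _; rfl
    · rintro ⟨x, y⟩ _; simp only [hF]; ring
  rw [h0, ← sum_filter_add_sum_filter_not P (fun p => p.1 ≤ p.2)]
  congr 1
  · simp only [mul_sum]
    rw [sum_sigma']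
    symm
    refine sum_bij' (fun s _ => (s.1, s.2)) (fun p _ => ⟨p.1, p.2⟩) ?_ ?_ ?_ ?_ ?_
    · rintro ⟨x, y⟩ hxy
      simp only [mem_sigma, mem_Icc, mem_Ico] at hxy
      rw [mem_filter, hmem]
      obtain ⟨⟨a1, a2⟩, a3, a4⟩ := hxy
      refine ⟨⟨a1, a1.trans a3, ?_⟩, a3⟩
      rw [mul_comm]; exact (Nat.le_div_iff_mul_le a1).1 (Nat.lt_succ_iff.1 a4)
    · rintro ⟨x, y⟩ hxy
      rw [mem_filter, hmem] at hxy
      obtain ⟨⟨a1, a2, a3⟩, a4⟩ := hxy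
      simp only [mem_sigma, mem_Icc, mem_Ico]
      simp only at a4
      refine ⟨⟨a1, ?_⟩, a4, ?_⟩
      · by_contra hc
        nlinarith
      · apply Nat.lt_succ_of_le
        rw [Nat.le_div_iff_mul_le a1, mul_comm]; exact a3
    · rintro ⟨x, y⟩ _; rfl
    · rintro ⟨x, y⟩ _; rfl
    · rintro ⟨x, y⟩ _; simp only [hF]; ring
  · simp only [mul_sum]
    rw [sum_sigma']
    symm
    refine sum_bij' (fun s _ => (s.2, s.1)) (fun p _ => ⟨p.2, p.1⟩) ?_ ?_ ?_ ?_ ?_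
    · rintro ⟨y, x⟩ hxy
      simp only [mem_sigma, mem_Icc, mem_Ico] at hxy
      rw [mem_filter, hmem]
      obtain ⟨⟨a1, a2⟩, a3, a4⟩ := hxy
      refine ⟨⟨(Nat.succ_pos _).trans_le a3, a1, ?_⟩, not_le.2 a3⟩
      exact (Nat.le_div_iff_mul_le a1).1 (Nat.lt_succ_iff.1 a4)
    · rintro ⟨x, y⟩ hxy
      rw [mem_filter, hmem] at hxy
      obtain ⟨⟨a1, a2, a3⟩, a4⟩ := hxy
      simp only [mem_sigma, mem_Icc, mem_Ico]
      simp only at a4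
      refine ⟨⟨a2, ?_⟩, by omega, ?_⟩
      · by_contra hc
        nlinarith
      · apply Nat.lt_succ_of_le
        rw [Nat.le_div_iff_mul_le a2]; exact a3
    · rintro ⟨x, y⟩ _; rfl
    · rintro ⟨x, y⟩ _; rfl
    · rintro ⟨y, x⟩ _; simp only [hF]; rw [mul_comm y x]; ring

namespace Ctx

variable {κ u R L T B : ℝ} {a q : ℕ}

/-- Linear sums with two smooth variables. -/
lemma errSum_low_smooth_smooth_le (h : Ctx κ u R L T B a q) {N : ℕ → ℕ}
    (hN : ∀ r, (N r : ℝ) ≤ u ^ 12) {A f g : ArithmeticFunction ℝ} {i : ℕ}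
    (hAs : ∀ m, A m ≠ 0 → (m : ℝ) ≤ u ^ 2) (hA : Bdd u B i A) (hf : Smooth u B f)
    (hg : Smooth u B g) :
    errSum R L a q N (A * (f * g)) ≤ B ^ (i + 9) * target u R T := by
  have hu := h.one_le_u
  have hB := h.B_pos
  have hB16 := h.B_ge
  have h1 := h.errSum_le_of_cap (N := N) (f := A * (f * g)) (b := B ^ (i + 4)) (by positivity) ?_
  · refine h1.trans (le_of_eq ?_); ring
  intro r _ ψ
  -- The smaller of two variables with product at most u^12 is at most u^6. Together with the factor
  -- b ≤ u^2 it gives m = bx ≤ u^8.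
  set D := ⌊u ^ 6⌋₊ with hD
  have hDN : ∀ n ≤ N r, n < (D + 1) ^ 2 := by
    intro n hn
    have e1 : u ^ 6 < D + 1 := Nat.lt_floor_add_one _
    have e2 : (n : ℝ) ≤ N r := by exact_mod_cast hn
    have e3 : (n : ℝ) < ((D : ℝ) + 1) ^ 2 := by
      calc (n : ℝ) ≤ u ^ 12 := e2.trans (hN r)
        _ = (u ^ 6) ^ 2 := by ring
        _ < _ := by gcongr
    exact_mod_cast e3
  have hcap0 : ∀ m : ℕ, 0 ≤ cap (u ^ 12 / m) (m * ψ) := fun m => cap_nonneg (by positivity) _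
  -- one half of the hyperbola
  have half : ∀ {k k' : ArithmeticFunction ℝ}, Smooth u B k → Smooth u B k' → ∀ {b : ℕ}, 0 < b →
      ∀ s : ℕ → ℕ, (∀ x, 1 ≤ x → 1 ≤ s x) →
      ‖∑ x ∈ Icc 1 D, (k x : ℂ) * ∑ y ∈ Ico (s x) (N r / b / x + 1),
        (k' y : ℂ) * e ((b * (x * y) : ℕ) * ψ)‖ ≤
      B ^ 2 * ∑ x ∈ Icc 1 D, cap (u ^ 12 / (b * x : ℕ)) ((b * x : ℕ) * ψ) := by
    intro k k' hk hk' b hb s hs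
    rw [mul_sum]
    refine norm_sum_le_of_le _ fun x hx => ?_
    rw [mem_Icc] at hx
    rw [norm_mul, Complex.norm_real, Real.norm_of_nonneg (hk.nonneg x)]
    have k1 : k x ≤ B := by
      apply hk.le
      have e1 : (x : ℝ) ≤ u ^ 6 := (Nat.le_floor_iff (by positivity)).1 hx.2
      have e2 : u ^ 6 ≤ u ^ 12 := pow_le_pow_right₀ hu (by norm_num)
      have e3 : 0 ≤ u ^ 12 := by positivity
      linarith
    have k2 := h.norm_sum_smooth_le hk' (m := b * x) (C := N r / b / x) (A := s x)
      (Nat.mul_pos hb hx.1) (by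
        refine le_trans ?_ (hN r)
        rw [Nat.div_div_eq_div_mul]
        exact_mod_cast Nat.mul_div_le (N r) (b * x)) (hs x hx.1) ψ
    have e4 : ∀ y, b * (x * y) = b * x * y := fun y => by ring
    simp only [e4]
    calc _ ≤ B * (B * cap (u ^ 12 / (b * x : ℕ)) ((b * x : ℕ) * ψ)) := by
          have := hcap0 (b * x)
          gcongr
      _ = _ := by ring
  have key : ‖∑ n ∈ Icc 1 (N r), ((A * (f * g)) n : ℂ) * e (n * ψ)‖ ≤
      ∑ p ∈ Icc 1 ⌊u ^ 2⌋₊ ×ˢ Icc 1 D, B ^ i * (2 * B ^ 2) *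
        cap (u ^ 12 / (p.1 * p.2 : ℕ)) ((p.1 * p.2 : ℕ) * ψ) := by
    rw [sum_conv_mul_of_support A (f * g) (N r) (fun n => e (n * ψ)) (Icc 1 ⌊u ^ 2⌋₊)
      (fun m hm => (mem_Icc.1 hm).1) (fun m _ hm => mem_Icc.2
        ⟨by exact_mod_cast one_le_of_ne_zero hm, Nat.le_floor (hAs m hm)⟩), sum_product]
    refine norm_sum_le_of_le _ fun b hb => ?_
    rw [mem_Icc] at hb
    rw [norm_mul, Complex.norm_real, Real.norm_eq_abs]
    have hb2 : (b : ℝ) ≤ u ^ 2 := (Nat.le_floor_iff (by positivity)).1 hb.2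
    have k1 := hA b (hb2.trans (pow_le_pow_right₀ hu (by norm_num)))
    rw [sum_conv_mul_hyperbola f g (N r / b) D (hDN _ (Nat.div_le_self _ _))
      (fun n => e ((b * n : ℕ) * ψ))]
    have k2 := half hf hg hb.1 (fun x => x) (fun x hx => hx)
    have k3 := half hg hf hb.1 (fun x => x + 1) (fun x hx => by omega)
    have k4 := (norm_add_le _ _).trans (add_le_add k2 k3)
    have k5 : 0 ≤ ∑ x ∈ Icc 1 D, cap (u ^ 12 / (b * x : ℕ)) ((b * x : ℕ) * ψ) :=
      sum_nonneg fun x _ => hcap0 _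
    rw [← mul_sum]
    simp only
    calc _ ≤ B ^ i * (B ^ 2 * ∑ x ∈ Icc 1 D, cap (u ^ 12 / (b * x : ℕ)) ((b * x : ℕ) * ψ) +
          B ^ 2 * ∑ x ∈ Icc 1 D, cap (u ^ 12 / (b * x : ℕ)) ((b * x : ℕ) * ψ)) := by
          gcongr
      _ = _ := by ring
  rw [← mul_sum] at key
  have hcomp := sum_comp_le_mul_sum (Icc 1 ⌊u ^ 2⌋₊ ×ˢ Icc 1 D) (Icc 1 ⌊u ^ 8⌋₊)
    (fun p : ℕ × ℕ => p.1 * p.2) (fun p hp => by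
      rw [mem_product, mem_Icc, mem_Icc] at hp
      rw [mem_Icc]
      refine ⟨Nat.mul_pos hp.1.1 hp.2.1, Nat.le_floor ?_⟩
      have e1 : (p.1 : ℝ) ≤ u ^ 2 := (Nat.le_floor_iff (by positivity)).1 hp.1.2
      have e2 : (p.2 : ℝ) ≤ u ^ 6 := (Nat.le_floor_iff (by positivity)).1 hp.2.2
      push_cast
      calc (p.1 : ℝ) * p.2 ≤ u ^ 2 * u ^ 6 := by gcongr
        _ = _ := by ring)
    (f := fun m => cap (u ^ 12 / m) (m * ψ)) (fun m _ => hcap0 m) (B := B) (fun k hk => by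
      rw [mem_Icc] at hk
      have e1 : (k : ℝ) ≤ u ^ 8 := (Nat.le_floor_iff (by positivity)).1 hk.2
      refine le_trans ?_ (h.divisors_le k hk.1 (e1.trans (by
        calc u ^ 8 = 1 * κ ^ 0 * u ^ 8 := by ring
          _ ≤ _ := h.small (by norm_num) (by norm_num) (by norm_num))))
      exact_mod_cast card_pairs_mul_eq_le _ hk.1)
  have hs0 : 0 ≤ ∑ m ∈ Icc 1 ⌊u ^ 8⌋₊, cap (u ^ 12 / m) (m * ψ) := sum_nonneg fun m _ => hcap0 m
  calc _ ≤ _ := key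
    _ ≤ B ^ i * (2 * B ^ 2) * (B * ∑ m ∈ Icc 1 ⌊u ^ 8⌋₊, cap (u ^ 12 / m) (m * ψ)) := by
        gcongr
    _ ≤ B ^ i * (B * B ^ 2) * (B * ∑ m ∈ Icc 1 ⌊u ^ 8⌋₊, cap (u ^ 12 / m) (m * ψ)) := by
        gcongr
        linarith
    _ = _ := by ring

end Ctx

/-! ### The combinatorial decomposition of Λ -/

open ArithmeticFunction (zeta moebius coe_zeta_mul_coe_moebius coe_zeta_mul_apply intCoe_apply) in
-- All divisors of n ≤ y are below the cut, so Möbius inversion is unaffected. Hence 1 - ζM vanishes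
-- up to y.
lemma zeta_mul_low_moebius_apply {y : ℝ} {n : ℕ} (hn : (n : ℝ) ≤ y) :
    ((zeta : ArithmeticFunction ℝ) * low y (moebius : ArithmeticFunction ℝ)) n =
      (1 : ArithmeticFunction ℝ) n := by
  have h1 : ((zeta : ArithmeticFunction ℝ) * (moebius : ArithmeticFunction ℝ)) = 1 :=
    coe_zeta_mul_coe_moebius
  rw [← h1, coe_zeta_mul_apply, coe_zeta_mul_apply]
  refine sum_congr rfl fun d hd => ?_
  rw [low_apply, if_pos]
  have : d ≤ n := Nat.divisor_le hd
  exact le_trans (by exact_mod_cast this) hn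

open ArithmeticFunction (zeta moebius coe_zeta_mul_coe_moebius coe_zeta_mul_apply intCoe_apply) in
lemma abs_moebius_le_one (n : ℕ) : |(moebius : ArithmeticFunction ℝ) n| ≤ 1 := by
  have := @ArithmeticFunction.abs_moebius_le_one n
  rw [intCoe_apply]
  exact_mod_cast this

lemma Bdd.neg {u B : ℝ} {i : ℕ} {f : ArithmeticFunction ℝ} (hf : Bdd u B i f) :
    Bdd u B i (-f) := fun n hn => by
  rw [ArithmeticFunction.neg_apply, abs_neg]; exact hf n hn

namespace Ctx

open ArithmeticFunction (log vonMangoldt zeta moebius)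

variable {κ u R L T B : ℝ} {a q : ℕ}

lemma smooth_log (h : Ctx κ u R L T B a q) : Smooth u B log where
  mono := by
    intro m n hmn
    rcases Nat.eq_zero_or_pos m with h0 | h0
    · rw [h0]; simp only [ArithmeticFunction.map_zero, ArithmeticFunction.log_apply]
      exact Real.log_natCast_nonneg n
    · simp only [ArithmeticFunction.log_apply]
      exact Real.log_le_log (by exact_mod_cast h0) (by exact_mod_cast hmn)
  le := by
    intro n hn
    rcases Nat.eq_zero_or_pos n with h0 | h0
    · rw [h0]; simpa using h.B_pos.le
    rw [ArithmeticFunction.log_apply]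
    have h1 : (n : ℝ) ≤ 10 ^ 4 * κ ^ 8 * u ^ 48 := by
      refine hn.trans ?_
      calc 2 * u ^ 12 = 2 * κ ^ 0 * u ^ 12 := by ring
        _ ≤ _ := h.small (by norm_num) (by norm_num) (by norm_num)
    have h2 := Real.log_le_log (by exact_mod_cast h0) h1
    linarith [h.log_le]

lemma smooth_zeta (h : Ctx κ u R L T B a q) : Smooth u B (zeta : ArithmeticFunction ℝ) where
  mono := by
    intro m n hmn
    rw [ArithmeticFunction.natCoe_apply, ArithmeticFunction.natCoe_apply,
      ArithmeticFunction.zeta_apply, ArithmeticFunction.zeta_apply]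
    split_ifs with h1 h2
    · simp
    · simp
    · omega
    · simp
  le := by
    intro n _
    rw [ArithmeticFunction.natCoe_apply, ArithmeticFunction.zeta_apply]
    have := h.B_ge
    split_ifs
    · simp; linarith
    · simp; linarith

lemma bdd_vonMangoldt (h : Ctx κ u R L T B a q) : Bdd u B 1 vonMangoldt := fun n hn => by
  rw [abs_of_nonneg ArithmeticFunction.vonMangoldt_nonneg]
  refine ArithmeticFunction.vonMangoldt_le_log.trans ((le_abs_self _).trans ?_)
  rw [← ArithmeticFunction.log_apply]
  exact h.smooth_log.bdd n hn

/-- Removing the small part of a smooth variable. -/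
lemma errSum_reduce_le (h : Ctx κ u R L T B a q) {N : ℕ → ℕ}
    (hN : ∀ r, (N r : ℝ) ≤ u ^ 12) {A f Z : ArithmeticFunction ℝ} {i j : ℕ}
    (hAs : ∀ m, A m ≠ 0 → (m : ℝ) ≤ u ^ 2) (hA : Bdd u B i A) (hf : Smooth u B f)
    (hZ : Bdd u B j Z) :
    errSum R L a q N (A * (f * Z)) ≤
      errSum R L a q N (low (u ^ 2) (A * low (u ^ 2) f) * Z) +
      errSum R L a q N (A * (high (u ^ 4) (high (u ^ 2) f) * Z)) +
      B ^ (i + j + 12) * target u R T := by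
  have hB := h.B_ge
  have hW := h.target_nonneg
  set f₁ := low (u ^ 2) f with hf₁
  set f₂ := low (u ^ 4) (high (u ^ 2) f) with hf₂
  set f₃ := high (u ^ 4) (high (u ^ 2) f) with hf₃
  set P := A * f₁ with hP
  have e1 : f = f₁ + (f₂ + f₃) := by
    rw [hf₂, hf₃, low_add_high, hf₁, low_add_high]
  have hPs : ∀ m, P m ≠ 0 → (m : ℝ) ≤ u ^ 4 := fun m hm => by
    have := le_mul_of_mul_ne_zero hAs (fun n hn => le_of_low_ne_zero hn) hm
    refine this.trans (le_of_eq (by ring))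
  have hPb : Bdd u B (i + 2) P := h.bdd_mul hA hf.bdd.low
  -- The smooth variable is cut at u^2 and u^4. Its middle part is a bilinear factor; its small part
  -- is absorbed in A, and the product is cut again at u^2, the excess lying in (u^2, u^4]. Only the
  -- two terms in the first bracket survive.
  have e2 : A * (f * Z) = (low (u ^ 2) P * Z + A * (f₃ * Z)) +
      (high (u ^ 2) P * Z + f₂ * (A * Z)) := by
    have e3 : A * (f * Z) = P * Z + f₂ * (A * Z) + A * (f₃ * Z) := by
      rw [hP]; nth_rewrite 1 [e1]; ring
    rw [e3]; nth_rewrite 1 [← low_add_high (u ^ 2) P]; ring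
  have b1 : errSum R L a q N (high (u ^ 2) P * Z) ≤ B ^ (i + 2 + j + 9) * target u R T :=
    h.errSum_mid_conv_le hN (fun m hm => ⟨lt_of_high_ne_zero hm,
      hPs m (ne_zero_of_high_ne_zero hm)⟩) hPb.high hZ
  have b2 : errSum R L a q N (f₂ * (A * Z)) ≤ B ^ (1 + (i + j + 1) + 9) * target u R T :=
    h.errSum_mid_conv_le hN (fun m hm => ⟨lt_of_high_ne_zero (ne_zero_of_low_ne_zero hm),
      le_of_low_ne_zero hm⟩) hf.bdd.high.low (h.bdd_mul hA hZ)
  have t1 := errSum_add_le (R := R) (L := L) (a := a) (q := q) (N := N)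
    (low (u ^ 2) P * Z + A * (f₃ * Z)) (high (u ^ 2) P * Z + f₂ * (A * Z))
  have t2 := errSum_add_le (R := R) (L := L) (a := a) (q := q) (N := N)
    (low (u ^ 2) P * Z) (A * (f₃ * Z))
  have t3 := errSum_add_le (R := R) (L := L) (a := a) (q := q) (N := N)
    (high (u ^ 2) P * Z) (f₂ * (A * Z))
  rw [← e2] at t1
  have b3 : B ^ (i + 2 + j + 9) * target u R T + B ^ (1 + (i + j + 1) + 9) * target u R T ≤
      B ^ (i + j + 12) * target u R T := by
    have e4 : B ^ (i + 2 + j + 9) * target u R T + B ^ (1 + (i + j + 1) + 9) * target u R T =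
      2 * (B ^ (i + j + 11) * target u R T) := by
      rw [show i + 2 + j + 9 = i + j + 11 by ring, show 1 + (i + j + 1) + 9 = i + j + 11 by ring]
      ring
    rw [e4, show B ^ (i + j + 12) * target u R T = B * (B ^ (i + j + 11) * target u R T) by ring]
    gcongr; linarith
  linarith

/-- Linear sums with three smooth variables. -/
lemma errSum_low_log_zeta_zeta_le (h : Ctx κ u R L T B a q) {N : ℕ → ℕ}
    (hN : ∀ r, (N r : ℝ) ≤ u ^ 12) {A : ArithmeticFunction ℝ} {i : ℕ}
    (hAs : ∀ m, A m ≠ 0 → (m : ℝ) ≤ u ^ 2) (hA : Bdd u B i A) :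
    errSum R L a q N (A * (log * ((zeta : ArithmeticFunction ℝ) * zeta))) ≤
      B ^ (i + 16) * target u R T := by
  have hB := h.B_ge
  have hW := h.target_nonneg
  have hu := h.one_le_u
  have hl := h.smooth_log
  have hz := h.smooth_zeta
  set Z : ArithmeticFunction ℝ := (zeta : ArithmeticFunction ℝ) with hZ
  set l₃ := high (u ^ 4) (high (u ^ 2) log) with hl₃
  set z₃ := high (u ^ 4) (high (u ^ 2) Z) with hz₃
  have sl₃ : Smooth u B l₃ := hl.high.high
  have sz₃ : Smooth u B z₃ := hz.high.high
  have low_bdd : ∀ {f : ArithmeticFunction ℝ}, Smooth u B f →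
      Bdd u B (i + 2) (low (u ^ 2) (A * low (u ^ 2) f)) := fun hf =>
    (h.bdd_mul hA hf.bdd.low).low
  have low_supp : ∀ f : ArithmeticFunction ℝ, ∀ m, low (u ^ 2) f m ≠ 0 → (m : ℝ) ≤ u ^ 2 :=
    fun f m hm => le_of_low_ne_zero hm
  -- The three smooth variables are treated in turn. Each reduction leaves a sum with two smooth
  -- variables and one where the treated variable exceeds u^4; the factors are then rotated.
  have r1 := h.errSum_reduce_le hN hAs hA hl (h.bdd_mul hz.bdd hz.bdd)
  have r2 := h.errSum_reduce_le hN hAs hA hz (h.bdd_mul sl₃.bdd hz.bdd)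
  have r3 := h.errSum_reduce_le hN hAs hA hz (h.bdd_mul sl₃.bdd sz₃.bdd)
  have s1 := h.errSum_low_smooth_smooth_le hN (low_supp _) (low_bdd hl) hz hz
  have s2 := h.errSum_low_smooth_smooth_le hN (low_supp _) (low_bdd hz) sl₃ hz
  have s3 := h.errSum_low_smooth_smooth_le hN (low_supp _) (low_bdd hz) sl₃ sz₃
  have e1 : A * (l₃ * (Z * Z)) = A * (Z * (l₃ * Z)) := by ring
  have e2 : A * (z₃ * (l₃ * Z)) = A * (Z * (l₃ * z₃)) := by ring
  rw [← hl₃, e1] at r1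
  rw [← hz₃, e2] at r2
  rw [← hz₃] at r3
  -- With all three variables beyond u^4 the product exceeds u^12, so nothing is left.
  have v : errSum R L a q N (A * (z₃ * (l₃ * z₃))) = 0 := by
    apply errSum_eq_zero hN
    intro n hn
    have g3 : ∀ n, z₃ n ≠ 0 → u ^ 4 < n := fun n hn => lt_of_high_ne_zero hn
    have g3' : ∀ n, l₃ n ≠ 0 → u ^ 4 < n := fun n hn => lt_of_high_ne_zero hn
    have p4 : (0 : ℝ) < u ^ 4 := by positivity
    have k1 : ∀ n, (l₃ * z₃) n ≠ 0 → u ^ 4 * u ^ 4 < n := fun n hn =>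
      mul_lt_of_mul_ne_zero p4 g3' (fun n hn => (g3 n hn).le) hn
    have k2 : ∀ n, (z₃ * (l₃ * z₃)) n ≠ 0 → u ^ 4 * (u ^ 4 * u ^ 4) < n := fun n hn =>
      mul_lt_of_mul_ne_zero (by positivity) g3 (fun n hn => (k1 n hn).le) hn
    rw [mul_comm A] at hn
    have := mul_lt_of_mul_ne_zero one_pos k2 (fun n hn => one_le_of_ne_zero hn) hn
    refine lt_of_eq_of_lt (by ring) this
  rw [v] at r3
  have m1 : B ^ (i + 2 + 9) * target u R T ≤ B ^ (i + 15) * target u R T := by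
    have : B ^ (i + 2 + 9) ≤ B ^ (i + 15) := pow_le_pow_right₀ (by linarith) (by omega)
    gcongr
  have e3 : B ^ (i + 16) * target u R T = B * (B ^ (i + 15) * target u R T) := by ring
  have m2 : 6 * (B ^ (i + 15) * target u R T) ≤ B * (B ^ (i + 15) * target u R T) := by
    gcongr; linarith
  have e4 : B ^ (i + (1 + 1 + 1) + 12) = B ^ (i + 15) := by ring
  rw [e4] at r1 r2 r3
  rw [e3]
  linarith

/-- The exponential sum over primes, via the threefold Vaughan-type identity. -/
theorem errSum_vonMangoldt_le (h : Ctx κ u R L T B a q) {N : ℕ → ℕ}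
    (hN : ∀ r, (N r : ℝ) ≤ u ^ 12) :
    errSum R L a q N vonMangoldt ≤ B ^ 24 * target u R T := by
  have hB := h.B_ge
  have hB0 := h.B_pos
  have hW := h.target_nonneg
  have hu := h.one_le_u
  have hl := h.smooth_log
  have hz := h.smooth_zeta
  set Z : ArithmeticFunction ℝ := (zeta : ArithmeticFunction ℝ) with hZ
  set M := low (u ^ 2) (moebius : ArithmeticFunction ℝ) with hM
  set E₀ : ArithmeticFunction ℝ := 1 + -(Z * M) with hE₀
  set G := low (u ^ 4) E₀ with hG
  set H := high (u ^ 4) E₀ with hH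
  have hE : E₀ = G + H := (low_add_high _ _).symm
  have E₀s : ∀ n, E₀ n ≠ 0 → u ^ 2 < n := by
    intro n hn
    by_contra hc
    apply hn
    rw [hE₀, ArithmeticFunction.add_apply, ArithmeticFunction.neg_apply,
      zeta_mul_low_moebius_apply (not_lt.1 hc)]
    ring
  have bM : Bdd u B 0 M := by
    refine Bdd.low fun n _ => ?_
    rw [pow_zero]; exact abs_moebius_le_one n
  have b1 : Bdd u B 0 (1 : ArithmeticFunction ℝ) := by
    intro n _
    rw [ArithmeticFunction.one_apply]; split_ifs <;> simp
  have bE : Bdd u B 3 E₀ := h.bdd_add (h.bdd_mono (by norm_num) b1) (h.bdd_mul hz.bdd bM).neg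
  have bG : Bdd u B 3 G := bE.low
  have bH : Bdd u B 3 H := bE.high
  have Ms : ∀ n, M n ≠ 0 → (n : ℝ) ≤ u ^ 2 := fun n hn => le_of_low_ne_zero hn
  -- Powers of M are cut at u^2 after each multiplication. The lower part stays an admissible factor
  -- for linear sums; the upper part lies in (u^2, u^4] and is a bilinear factor.
  set A₂ := low (u ^ 2) (M * M) with hA₂
  set G₂ := high (u ^ 2) (M * M) with hG₂
  set A₃ := low (u ^ 2) (M * A₂) with hA₃
  set G₃ := high (u ^ 2) (M * A₂) with hG₃
  have d2 : M * M = A₂ + G₂ := (low_add_high _ _).symm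
  have d3 : M * A₂ = A₃ + G₃ := (low_add_high _ _).symm
  have bMM : Bdd u B 1 (M * M) := h.bdd_mul bM bM
  have bA₂ : Bdd u B 1 A₂ := bMM.low
  have bG₂ : Bdd u B 1 G₂ := bMM.high
  have bMA : Bdd u B 2 (M * A₂) := h.bdd_mul bM bA₂
  have sA₂ : ∀ n, A₂ n ≠ 0 → (n : ℝ) ≤ u ^ 2 := fun n hn => le_of_low_ne_zero hn
  have sG₂ : ∀ n, G₂ n ≠ 0 → u ^ 2 < n ∧ (n : ℝ) ≤ u ^ 4 := fun n hn =>
    ⟨lt_of_high_ne_zero hn, (le_mul_of_mul_ne_zero Ms Ms (ne_zero_of_high_ne_zero hn)).trans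
      (le_of_eq (by ring))⟩
  have sA₃ : ∀ n, A₃ n ≠ 0 → (n : ℝ) ≤ u ^ 2 := fun n hn => le_of_low_ne_zero hn
  have sG₃ : ∀ n, G₃ n ≠ 0 → u ^ 2 < n ∧ (n : ℝ) ≤ u ^ 4 := fun n hn =>
    ⟨lt_of_high_ne_zero hn, (le_mul_of_mul_ne_zero Ms sA₂ (ne_zero_of_high_ne_zero hn)).trans
      (le_of_eq (by ring))⟩
  have sG : ∀ n, G n ≠ 0 → u ^ 2 < n ∧ (n : ℝ) ≤ u ^ 4 := fun n hn =>
    ⟨E₀s n (ne_zero_of_low_ne_zero hn), le_of_low_ne_zero hn⟩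
  have blz : Bdd u B 3 (log * Z) := h.bdd_mul hl.bdd hz.bdd
  have blzz : Bdd u B 5 (log * (Z * Z)) := h.bdd_mul hl.bdd (h.bdd_mul hz.bdd hz.bdd)
  -- Cofactor of G in E₀^3 Λ, from E₀^3 - H^3 = (E₀ - H)(E₀^2 + E₀H + H^2) with E₀ - H = G.
  set K : ArithmeticFunction ℝ := vonMangoldt * (E₀ * E₀ + E₀ * H + H * H) with hK
  have bK : Bdd u B 11 K := h.bdd_mul h.bdd_vonMangoldt
    (h.bdd_add (h.bdd_add (h.bdd_mul bE bE) (h.bdd_mul bE bH))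
      (h.bdd_mono (by norm_num) (h.bdd_mul bH bH)))
  have up : ∀ {x : ℝ} {k : ℕ}, k ≤ 23 → x ≤ B ^ k * target u R T →
      x ≤ B ^ 23 * target u R T := fun hk hx => hx.trans (by gcongr; linarith)
  have u8 : u ^ 2 ≤ u ^ 8 := by gcongr; norm_num
  have q1 := up (by norm_num) (h.errSum_low_smooth_le hN (fun m hm => (Ms m hm).trans u8) bM hl)
  have q2 := up (by norm_num) (h.errSum_low_smooth_smooth_le hN sA₂ bA₂ hl hz)
  have q3 := up (by norm_num) (h.errSum_mid_conv_le hN sG₂ bG₂ blz)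
  have q4 := up (by norm_num) (h.errSum_low_log_zeta_zeta_le hN sA₃ bMA.low)
  have q5 := up (by norm_num) (h.errSum_mid_conv_le hN sG₃ bMA.high blzz)
  have q6 := up (by norm_num) (h.errSum_mid_conv_le hN sG₂ bG₂ (h.bdd_mul bM blzz))
  have q7 := up (by norm_num) (h.errSum_mid_conv_le hN sG bG bK)
  have q8 : errSum R L a q N (H * (H * H) * vonMangoldt) = 0 := by
    apply errSum_eq_zero hN
    intro n hn
    have g : ∀ n, H n ≠ 0 → u ^ 4 < n := fun n hn => lt_of_high_ne_zero hn
    have k1 : ∀ n, (H * H) n ≠ 0 → u ^ 4 * u ^ 4 < n := fun n hn =>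
      mul_lt_of_mul_ne_zero (by positivity) g (fun n hn => (g n hn).le) hn
    have k2 : ∀ n, (H * (H * H)) n ≠ 0 → u ^ 4 * (u ^ 4 * u ^ 4) < n := fun n hn =>
      mul_lt_of_mul_ne_zero (by positivity) g (fun n hn => (k1 n hn).le) hn
    have := mul_lt_of_mul_ne_zero one_pos k2 (fun n hn => one_le_of_ne_zero hn) hn
    refine lt_of_eq_of_lt (by ring) this
  set P : ArithmeticFunction ℝ := A₂ * (log * Z) + G₂ * (log * Z) with hP
  set V : ArithmeticFunction ℝ := A₃ * (log * (Z * Z)) + (G₃ * (log * (Z * Z)) +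
    G₂ * (M * (log * (Z * Z)))) with hV
  have hΛ : (vonMangoldt : ArithmeticFunction ℝ) * Z = log :=
    ArithmeticFunction.vonMangoldt_mul_zeta
  -- The expansion of (1 - ζM)^3 Λ, solved for Λ, with Λζ = log inserted in each term. P and V are
  -- M^2 log ζ and M^3 log ζ^2 after the cuts.
  have ident : (vonMangoldt : ArithmeticFunction ℝ) = (M * log + (M * log + M * log)) +
      (-(P + (P + P)) + (V + (G * K + H * (H * H) * vonMangoldt))) := by
    have hP' : P = M * M * (log * Z) := by rw [hP, d2]; ring
    have hV' : V = M * M * M * (log * (Z * Z)) := by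
      rw [hV]
      have : M * M * M = A₃ + G₃ + G₂ * M := by rw [← d3, d2]; ring
      rw [this]; ring
    have hK' : G * K + H * (H * H) * vonMangoldt =
        (1 + -(Z * M)) * ((1 + -(Z * M)) * (1 + -(Z * M))) * vonMangoldt := by
      rw [← hE₀, hK, hE]; ring
    rw [hP', hV', hK', ← hΛ]; ring
  have tri := fun f g => errSum_add_le (R := R) (L := L) (a := a) (q := q) (N := N) f g
  have f1 := tri (M * log + (M * log + M * log))
    (-(P + (P + P)) + (V + (G * K + H * (H * H) * vonMangoldt)))
  rw [← ident] at f1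
  have f2 := tri (M * log) (M * log + M * log)
  have f3 := tri (M * log) (M * log)
  have f4 := tri (-(P + (P + P))) (V + (G * K + H * (H * H) * vonMangoldt))
  rw [errSum_neg] at f4
  have f5 := tri P (P + P)
  have f6 := tri P P
  have f7 := tri (A₂ * (log * Z)) (G₂ * (log * Z))
  have f8 := tri V (G * K + H * (H * H) * vonMangoldt)
  have f9 := tri (A₃ * (log * (Z * Z))) (G₃ * (log * (Z * Z)) + G₂ * (M * (log * (Z * Z))))
  have f10 := tri (G₃ * (log * (Z * Z))) (G₂ * (M * (log * (Z * Z))))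
  have f11 := tri (G * K) (H * (H * H) * vonMangoldt)
  rw [← hP] at f7
  rw [← hV] at f9
  -- Three copies of M log, two pieces for each of three copies of P, three pieces of V, and GK: 13
  -- sums in all, absorbed by B ≥ 16. The largest exponent, 23, comes from GK.
  have fin : 13 * (B ^ 23 * target u R T) ≤ B ^ 24 * target u R T := by
    rw [show B ^ 24 * target u R T = B * (B ^ 23 * target u R T) by ring]
    gcongr; linarith
  linarith

end Ctx

/-! ### The range where R is large compared with X -/

lemma cnt_le_card (V : ℕ) (x : ℝ) : cnt V x ≤ V := by
  unfold cnt
  exact (card_filter_le _ _).trans (by simp)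

lemma cnt_le_inv {V : ℕ} {x : ℝ} (hx : 0 < nd x) : (cnt V x : ℝ) ≤ 1 / nd x := by
  unfold cnt
  have h1 : {h ∈ (Icc 1 V : Finset ℕ) | ((h : ℕ) : ℝ) * nd x ≤ 1} ⊆ Icc 1 ⌊1 / nd x⌋₊ := by
    intro h hh
    rw [mem_filter, mem_Icc] at hh
    rw [mem_Icc]
    exact ⟨hh.1.1, Nat.le_floor ((le_div_iff₀ hx).2 hh.2)⟩
  have h2 := card_le_card h1
  rw [Nat.card_Icc, Nat.add_sub_cancel] at h2
  have h3 : (⌊1 / nd x⌋₊ : ℝ) ≤ 1 / nd x := Nat.floor_le (by positivity)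
  exact le_trans (by exact_mod_cast h2) h3

/-- Differences of multiples of a small frequency. -/
lemma sum_cnt_sub_le {N V : ℕ} {β : ℝ} (hβ : 0 < β) (hNβ : N * β ≤ 1 / 2) :
    ∑ i ∈ Icc 1 N, ∑ j ∈ Icc 1 N, (cnt V (i * β - j * β) : ℝ) ≤
      N * (V + 2 * ((1 + Real.log N) / β)) := by
  have key : ∀ i ∈ Icc 1 N, ∑ j ∈ Icc 1 N, (cnt V (i * β - j * β) : ℝ) ≤
      V + 2 * ((1 + Real.log N) / β) := by
    intro i hi
    rw [mem_Icc] at hi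
    have hb : ∀ j ∈ Icc 1 N, (cnt V (i * β - j * β) : ℝ) ≤
        (if j = i then (V : ℝ) else 0) + (if j < i then 1 / ((i - j : ℕ) * β) else 0) +
        (if i < j then 1 / ((j - i : ℕ) * β) else 0) := by
      intro j hj
      rw [mem_Icc] at hj
      have hni : (i : ℝ) ≤ N := by exact_mod_cast hi.2
      have hnj : (j : ℝ) ≤ N := by exact_mod_cast hj.2
      have hi0 : (0 : ℝ) ≤ i := by positivity
      have hj0 : (0 : ℝ) ≤ j := by positivity
      have hi1 : (i : ℝ) * β ≤ N * β := by gcongr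
      have hj1 : (j : ℝ) * β ≤ N * β := by gcongr
      have hi2 : 0 ≤ (i : ℝ) * β := by positivity
      have hj2 : 0 ≤ (j : ℝ) * β := by positivity
      -- All multiples stay within [0, 1/2], so differences do not wrap around and the distance to
      -- the integers is the absolute value.
      have habs : |i * β - j * β| ≤ 1 / 2 := by rw [abs_le]; constructor <;> linarith
      rcases lt_trichotomy j i with h | h | h
      · rw [if_neg h.ne, if_pos h, if_neg (by omega), Nat.cast_sub h.le]
        have h1 : (j : ℝ) < i := by exact_mod_cast h
        have h2 : (0 : ℝ) < (i - j) * β := mul_pos (by linarith) hβ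
        have h3 : nd (i * β - j * β) = (i - j) * β := by
          rw [nd_of_abs_le_half habs, ← sub_mul, abs_of_pos h2]
        have := cnt_le_inv (V := V) (x := i * β - j * β) (by rw [h3]; exact h2)
        rw [h3] at this; linarith
      · rw [if_pos h, if_neg (by omega), if_neg (by omega)]
        have := cnt_le_card V (i * β - j * β)
        have : (cnt V (i * β - j * β) : ℝ) ≤ V := by exact_mod_cast this
        linarith
      · rw [if_neg h.ne', if_neg (by omega), if_pos h, Nat.cast_sub h.le]
        have h1 : (i : ℝ) < j := by exact_mod_cast h
        have h2 : (0 : ℝ) < (j - i) * β := mul_pos (by linarith) hβ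
        have h3 : nd (i * β - j * β) = (j - i) * β := by
          rw [nd_of_abs_le_half habs, ← sub_mul, abs_of_neg (by linarith)]; ring
        have := cnt_le_inv (V := V) (x := i * β - j * β) (by rw [h3]; exact h2)
        rw [h3] at this; linarith
    have hinv : ∀ (P : ℕ → Prop) [DecidablePred P] (d : ℕ → ℕ),
        (∀ j ∈ Icc 1 N, P j → d j ∈ Icc 1 N) →
        (∀ j ∈ Icc 1 N, ∀ j' ∈ Icc 1 N, P j → P j' → d j = d j' → j = j') →
        ∑ j ∈ Icc 1 N, (if P j then 1 / ((d j : ℝ) * β) else 0) ≤ (1 + Real.log N) / β := by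
      intro P _ d hd hinj
      rw [← sum_filter]
      have h1 : ∑ j ∈ (Icc 1 N).filter P, 1 / ((d j : ℝ) * β) =
          ∑ k ∈ ((Icc 1 N).filter P).image d, 1 / ((k : ℝ) * β) := by
        rw [sum_image]
        intro x hx y hy hxy
        rw [mem_coe, mem_filter] at hx hy
        exact hinj x hx.1 y hy.1 hx.2 hy.2 hxy
      rw [h1]
      have h2 : ((Icc 1 N).filter P).image d ⊆ Icc 1 N := by
        intro k hk
        rw [mem_image] at hk
        obtain ⟨j, hj, rfl⟩ := hk
        rw [mem_filter] at hj
        exact hd j hj.1 hj.2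
      refine (sum_le_sum_of_subset_of_nonneg h2 (fun _ _ _ => by positivity)).trans ?_
      have h3 : ∑ k ∈ Icc 1 N, 1 / ((k : ℝ) * β) = (∑ k ∈ Icc 1 N, (1 : ℝ) / k) / β := by
        rw [sum_div]
        refine sum_congr rfl fun k _ => ?_
        rw [div_div]
      rw [h3]
      gcongr
      exact sum_inv_le N
    refine (sum_le_sum hb).trans ?_
    rw [sum_add_distrib, sum_add_distrib]
    have t1 : ∑ j ∈ Icc 1 N, (if j = i then (V : ℝ) else 0) = V := by
      rw [sum_ite_eq' , if_pos (mem_Icc.2 hi)]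
    have t2 := hinv (fun j => j < i) (fun j => i - j)
      (fun j hj hji => by simp only [mem_Icc] at hj ⊢; omega)
      (fun j hj j' hj' h1 h2 h3 => by omega)
    have t3 := hinv (fun j => i < j) (fun j => j - i)
      (fun j hj hji => by simp only [mem_Icc] at hj ⊢; omega)
      (fun j hj j' hj' h1 h2 h3 => by omega)
    rw [t1]; linarith
  refine (sum_le_sum key).trans (le_of_eq ?_)
  rw [sum_const, nsmul_eq_mul, Nat.card_Icc, Nat.add_sub_cancel]

/-- When the denominators exceed `X`, the phases are far from wrapping around. -/
lemma errSum_le_of_large {κ u R L T B : ℝ} {a q : ℕ} (hκ : 1 ≤ κ) (hu : 1 ≤ u) (hR : 1 ≤ R)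
    (hL : 1 ≤ L) (hLT : L ≤ T) (hRT : R ≤ T) (ha : 0 < a) (hq : 0 < q) (hqa : (q : ℝ) ≤ κ * a)
    (haq : (a : ℝ) ≤ κ * q) (hRl : 2 * κ * u ^ 12 < R) (hB : 16 ≤ B) (hκB : κ ≤ B)
    (hlog : 1 + Real.log (u ^ 12) ≤ B) {N : ℕ → ℕ} (hN : ∀ r, (N r : ℝ) ≤ u ^ 12)
    {f : ArithmeticFunction ℝ} (hf : Bdd u B 1 f) :
    errSum R L a q N f ≤ B ^ 3 * target u R T := by
  have hB0 : 0 < B := by linarith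
  have hT0 : 0 < T := by linarith
  have ha' : (0 : ℝ) < a := by exact_mod_cast ha
  have hq' : (0 : ℝ) < q := by exact_mod_cast hq
  set V := ⌈2 * L⌉₊ with hV
  have hVL : (V : ℝ) ≤ 3 * T := by
    have := Nat.ceil_lt_add_one (show 0 ≤ 2 * L by linarith)
    linarith
  have inner : ∀ r ∈ dyadic R, ∑ l ∈ dyadic L,
      ‖∑ n ∈ Icc 1 (N r), (f n : ℂ) * e (n * (l * ((a : ℝ) / (r * q))))‖ ≤
      5 * B ^ 2 * T * u ^ 6 := by
    intro r hr
    rw [mem_dyadic] at hr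
    have hr0 : (0 : ℝ) < r := by linarith
    set β : ℝ := (a : ℝ) / (r * q) with hβ
    have hβ0 : 0 < β := by positivity
    have hβ1 : β ≤ κ / R := by
      rw [hβ, div_le_div_iff₀ (by positivity) (by linarith)]
      calc (a : ℝ) * R ≤ (κ * q) * r := by gcongr; exact hr.1
        _ = _ := by ring
    have hβ2 : 1 / β ≤ 2 * κ * R := by
      rw [hβ, one_div_div, div_le_iff₀ ha']
      calc (r : ℝ) * q ≤ (2 * R) * (κ * a) := by gcongr; exact hr.2.le
        _ = _ := by ring
    have hNβ : N r * β ≤ 1 / 2 := by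
      calc N r * β ≤ u ^ 12 * (κ / R) := by gcongr; exact hN r
        _ = (2 * κ * u ^ 12) / (2 * R) := by field_simp
        _ ≤ R / (2 * R) := by gcongr
        _ = 1 / 2 := by field_simp
    choose c hc1 hc2 using fun l : ℕ =>
      exists_unit_mul_eq_norm (∑ n ∈ Icc 1 (N r), (f n : ℂ) * e (n * (l * β)))
    set G : ℕ → ℂ := fun l => if l ∈ dyadic L then c l else 0 with hG
    have hG1 : ∀ l, ‖G l‖ ≤ 1 := by
      intro l; rw [hG]; simp only; split_ifs
      · exact hc1 l
      · simp
    have hC : ∀ n ∈ Icc 1 (N r), ‖(f n : ℂ)‖ ≤ B := by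
      intro n hn
      rw [Complex.norm_real, Real.norm_eq_abs]
      have : (n : ℝ) ≤ N r := by exact_mod_cast (mem_Icc.1 hn).2
      simpa using hf n (this.trans (hN r))
    have hsub : dyadic L ⊆ Icc 1 V := by
      intro l hl
      rw [mem_dyadic] at hl
      rw [mem_Icc]
      have h1 : (1 : ℝ) ≤ l := hL.trans hl.1
      have h2 : (l : ℝ) ≤ V := hl.2.le.trans (Nat.le_ceil _)
      exact ⟨by exact_mod_cast h1, by exact_mod_cast h2⟩
    set s := ∑ l ∈ dyadic L, ‖∑ n ∈ Icc 1 (N r), (f n : ℂ) * e (n * (l * β))‖ with hs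
    have hs0 : 0 ≤ s := sum_nonneg fun _ _ => norm_nonneg _
    have hid : (s : ℂ) = ∑ n ∈ Icc 1 (N r), (f n : ℂ) * ∑ l ∈ Icc 1 V, G l * e (l * (n * β)) := by
      have h1 : ∀ n : ℕ, ∑ l ∈ Icc 1 V, G l * e (l * (n * β)) =
          ∑ l ∈ dyadic L, c l * e (n * (l * β)) := by
        intro n
        rw [← sum_subset hsub]
        · refine sum_congr rfl fun l hl => ?_
          rw [hG]; simp only [if_pos hl]
          congr 2; ring
        · intro l _ hl
          rw [hG]; simp [if_neg hl]
      simp only [h1]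
      rw [hs]; push_cast
      simp only [mul_sum]
      rw [sum_comm]
      refine sum_congr rfl fun l _ => ?_
      rw [← hc2, mul_sum]
      refine sum_congr rfl fun n _ => ?_
      ring
    -- The roles are exchanged: the frequencies are nβ with coefficients f(n), and the inner
    -- variable is l, whose coefficients are the phases removing the absolute values.
    have hbil := norm_bilinear_sq_le (Icc 1 (N r)) (fun n => (f n : ℂ)) (fun n : ℕ => (n : ℝ) * β)
      (fun _ => V) (fun _ _ => le_rfl) G hC (fun l _ => hG1 l) hB0.le
    rw [← hid, Complex.norm_real, Real.norm_eq_abs, sq_abs] at hbil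
    have hcnt := sum_cnt_sub_le (V := V) hβ0 hNβ
    have hlogN : 1 + Real.log (N r) ≤ B := by
      rcases Nat.eq_zero_or_pos (N r) with h0 | h0
      · rw [h0]; simp; linarith
      · have := Real.log_le_log (by exact_mod_cast h0) (hN r)
        linarith
    have hcnt2 : (N r : ℝ) * (V + 2 * ((1 + Real.log (N r)) / β)) ≤ u ^ 12 * (7 * B ^ 2 * T) := by
      have h1 : (1 + Real.log (N r)) / β ≤ 2 * B ^ 2 * T := by
        rw [div_eq_mul_one_div]
        calc (1 + Real.log (N r)) * (1 / β) ≤ B * (2 * κ * R) := by gcongr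
          _ ≤ B * (2 * B * T) := by gcongr
          _ = _ := by ring
      have h2 : 3 * T ≤ 3 * B ^ 2 * T := by
        have : 1 ≤ B ^ 2 := one_le_pow₀ (by linarith)
        nlinarith
      have h3 : V + 2 * ((1 + Real.log (N r)) / β) ≤ 7 * B ^ 2 * T := by linarith
      calc _ ≤ (N r : ℝ) * (7 * B ^ 2 * T) := by gcongr
        _ ≤ _ := by gcongr; exact hN r
    have hsq : s ^ 2 ≤ (5 * B ^ 2 * T * u ^ 6) ^ 2 := by
      calc s ^ 2 ≤ B ^ 2 * 1 ^ 2 * V * (u ^ 12 * (7 * B ^ 2 * T)) :=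
            hbil.trans (by gcongr; exact hcnt.trans hcnt2)
        _ ≤ B ^ 2 * 1 ^ 2 * (3 * T) * (u ^ 12 * (7 * B ^ 2 * T)) := by gcongr
        _ = 21 * (B ^ 4 * T ^ 2 * u ^ 12) := by ring
        _ ≤ 25 * (B ^ 4 * T ^ 2 * u ^ 12) := by gcongr; norm_num
        _ = _ := by ring
    exact (pow_le_pow_iff_left₀ hs0 (by positivity) (by norm_num)).1 hsq
  unfold errSum
  refine (sum_le_sum inner).trans ?_
  rw [sum_const, nsmul_eq_mul]
  have hcard := card_dyadic_le hR
  calc (#(dyadic R) : ℝ) * (5 * B ^ 2 * T * u ^ 6) ≤ (2 * R) * (5 * B ^ 2 * T * u ^ 6) := by gcongr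
    _ = 10 * (B ^ 2 * (u ^ 6 * (T * R))) := by ring
    _ ≤ B * (B ^ 2 * (u ^ 8 * (T * R))) := by
      gcongr
      · linarith
      · norm_num
    _ = B ^ 3 * (u ^ 8 * (T * R)) := by ring
    _ ≤ B ^ 3 * target u R T := by
      unfold target; gcongr
      have : 0 ≤ u ^ 11 * √(T * R) := by positivity
      linarith

/-! ### The estimate in terms of X and ε -/

/-- The maxima over `N` are attained. -/
lemma sum_maxS_eq_errSum (X R L : ℝ) (a q : ℕ) : ∃ N : ℕ → ℕ, (∀ r, N r ≤ ⌊X⌋₊) ∧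
    ∑ r ∈ dyadic R, maxS X (dyadic L) ((a : ℝ) / (r * q)) =
      errSum R L a q N ArithmeticFunction.vonMangoldt := by
  have h : ∀ r : ℕ, ∃ n ≤ ⌊X⌋₊, maxS X (dyadic L) ((a : ℝ) / (r * q)) =
      ∑ l ∈ dyadic L, ‖S n (l * ((a : ℝ) / (r * q)))‖ := by
    intro r
    obtain ⟨n, hn, hmax⟩ := exists_mem_eq_sup' (nonempty_range_add_one (n := ⌊X⌋₊))
      (fun N => ∑ l ∈ dyadic L, ‖S N (l * ((a : ℝ) / (r * q)))‖)
    exact ⟨n, Nat.lt_succ_iff.1 (mem_range.1 hn), hmax⟩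
  choose N hN hmax using h
  exact ⟨N, hN, sum_congr rfl fun r _ => hmax r⟩

/-- The estimate without a size condition on `R`. -/
lemma errSum_vonMangoldt_le {κ u R L T B : ℝ} {a q : ℕ} (hκ : 1 ≤ κ) (hu1 : 1 ≤ u) (hR : 1 ≤ R)
    (hL : 1 ≤ L) (hLT : L ≤ T) (hRT : R ≤ T) (hcop : a.Coprime q) (ha : 0 < a) (hq : 0 < q)
    (hqa : (q : ℝ) ≤ κ * a) (haq : (a : ℝ) ≤ κ * q) (hT : T * u ^ 4 ≤ κ * R * q)
    (hqX : (q : ℝ) ≤ κ * u ^ 8) (hB16 : 16 ≤ B) (hκB : κ ≤ B)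
    (hdiv : ∀ n : ℕ, 0 < n → (n : ℝ) ≤ 10 ^ 4 * κ ^ 8 * u ^ 48 → (#n.divisors : ℝ) ≤ B)
    (hlog : 1 + Real.log (10 ^ 4 * κ ^ 8 * u ^ 48) ≤ B) {N : ℕ → ℕ}
    (hN' : ∀ r, (N r : ℝ) ≤ u ^ 12) :
    errSum R L a q N ArithmeticFunction.vonMangoldt ≤ B ^ 24 * target u R T := by
  have hu0 : 0 < u := by linarith
  have hW : 0 ≤ target u R T := by
    have : 0 ≤ T := by linarith
    unfold target; positivity
  -- The size condition on R keeps all integers that occur below a fixed power of u, where B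
  -- controls divisors and logarithms; larger R need no such control.
  by_cases hRl : R ≤ 2 * κ * u ^ 12
  · have h : Ctx κ u R L T B a q :=
      { one_le_kappa := hκ, one_le_u := hu1, one_le_R := hR, one_le_L := hL, L_le_T := hLT
        R_le_T := hRT, coprime := hcop, a_pos := ha, q_pos := hq, q_le_a := hqa, a_le_q := haq
        T_le := hT
        q_le := hqX
        R_le := hRl, B_ge := hB16, kappa_le_B := hκB, divisors_le := hdiv, log_le := hlog }
    exact h.errSum_vonMangoldt_le hN'
  · have hu12 : 1 ≤ u ^ 12 := one_le_pow₀ hu1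
    have hlog2 : 1 + Real.log (u ^ 12) ≤ B := by
      refine le_trans ?_ hlog
      have : Real.log (u ^ 12) ≤ Real.log (10 ^ 4 * κ ^ 8 * u ^ 48) := by
        apply Real.log_le_log (by positivity)
        have h1 : u ^ 12 ≤ u ^ 48 := pow_le_pow_right₀ hu1 (by norm_num)
        have h2 : 1 ≤ κ ^ 8 := one_le_pow₀ hκ
        have h3 : 1 ≤ 10 ^ 4 * κ ^ 8 := by linarith
        exact h1.trans (le_mul_of_one_le_left (by positivity) h3)
      linarith
    have hΛ : Bdd u B 1 ArithmeticFunction.vonMangoldt := by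
      intro n hn
      rw [abs_of_nonneg ArithmeticFunction.vonMangoldt_nonneg, pow_one]
      rcases Nat.eq_zero_or_pos n with h0 | h0
      · rw [h0]; simp; linarith
      have := Real.log_le_log (by exact_mod_cast h0) hn
      have := ArithmeticFunction.vonMangoldt_le_log (n := n)
      linarith
    refine (errSum_le_of_large hκ hu1 hR hL hLT hRT ha hq hqa haq (not_le.1 hRl) hB16 hκB hlog2 hN'
      hΛ).trans ?_
    exact mul_le_mul_of_nonneg_right (pow_le_pow_right₀ (by linarith) (by norm_num)) hW

/-- The prime exponential sum estimate, with all hypotheses up to a constant `κ`. -/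
theorem exists_sum_maxS_le {κ ε : ℝ} (hκ : 1 ≤ κ) (hε : 0 < ε) :
    ∃ K : ℝ, 0 < K ∧ ∀ (X R L : ℝ) (a q : ℕ), 1 ≤ X → 1 ≤ R → 1 ≤ L → a.Coprime q →
      0 < a → 0 < q → (q : ℝ) ≤ κ * a → (a : ℝ) ≤ κ * q →
      max L R * X ^ (1 / 3 : ℝ) ≤ κ * R * q → (q : ℝ) ≤ κ * X ^ (2 / 3 : ℝ) →
      ∑ r ∈ dyadic R, maxS X (dyadic L) ((a : ℝ) / (r * q)) ≤
        K * (X ^ ε * (X ^ (2 / 3 : ℝ) * (max L R * R) +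
          X ^ (11 / 12 : ℝ) * (max L R * R) ^ (1 / 2 : ℝ))) := by
  -- The estimate loses B^24, and B will be a constant times X^δ.
  set δ : ℝ := ε / 24 with hδ
  have hδ0 : 0 < δ := by positivity
  -- The integers concerned reach a multiple of u^48 = X^4, hence the exponent δ/4.
  obtain ⟨C, hC1, hC⟩ := exists_card_divisors_le (ε := δ / 4) (by positivity)
  set D : ℝ := (10 ^ 4 * κ ^ 8) ^ (δ / 4) with hD
  have hD0 : 0 < D := by positivity
  set K₁ : ℝ := 17 + κ + C * D + D / (δ / 4) with hK₁
  have hq0 : 0 < D / (δ / 4) := by positivity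
  have hCD : 0 < C * D := by positivity
  have hK0 : 0 < K₁ := by positivity
  refine ⟨K₁ ^ 24, by positivity, ?_⟩
  intro X R L a q hX hR hL hcop ha hq hqa haq hT hqX
  have hX0 : 0 < X := by linarith
  obtain ⟨u, hu⟩ : ∃ u : ℝ, u = X ^ (1 / 12 : ℝ) := ⟨_, rfl⟩
  have hpow : ∀ k : ℕ, u ^ k = X ^ ((k : ℝ) / 12) := by
    intro k
    rw [hu, ← Real.rpow_mul_natCast hX0.le]; congr 1; ring
  have hu1 : 1 ≤ u := by rw [hu]; exact Real.one_le_rpow hX (by norm_num)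
  have hu0 : 0 < u := by linarith
  have u12 : u ^ 12 = X := by rw [hpow]; norm_num
  have u48 : u ^ 48 = X ^ (4 : ℝ) := by rw [hpow]; norm_num
  have hXδ : 1 ≤ X ^ δ := Real.one_le_rpow hX hδ0.le
  obtain ⟨B, hB⟩ : ∃ B : ℝ, B = K₁ * X ^ δ := ⟨_, rfl⟩
  have hKB : K₁ ≤ B := by rw [hB]; exact le_mul_of_one_le_right hK0.le hXδ
  have hz : (10 ^ 4 * κ ^ 8 * u ^ 48) ^ (δ / 4) = D * X ^ δ := by
    rw [Real.mul_rpow (by positivity) (by positivity), u48, ← Real.rpow_mul hX0.le, hD]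
    congr 2; ring
  have hdiv : ∀ n : ℕ, 0 < n → (n : ℝ) ≤ 10 ^ 4 * κ ^ 8 * u ^ 48 → (#n.divisors : ℝ) ≤ B := by
    intro n hn0 hn
    calc (#n.divisors : ℝ) ≤ C * (n : ℝ) ^ (δ / 4) := hC n hn0
      _ ≤ C * (10 ^ 4 * κ ^ 8 * u ^ 48) ^ (δ / 4) := by gcongr
      _ = (C * D) * X ^ δ := by rw [hz]; ring
      _ ≤ B := by rw [hB]; gcongr; linarith
  have hlog : 1 + Real.log (10 ^ 4 * κ ^ 8 * u ^ 48) ≤ B := by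
    have h1 := Real.log_le_rpow_div (x := 10 ^ 4 * κ ^ 8 * u ^ 48) (by positivity)
      (show 0 < δ / 4 by positivity)
    rw [hz, mul_div_right_comm] at h1
    calc _ ≤ 1 * X ^ δ + D / (δ / 4) * X ^ δ := by linarith
      _ = (1 + D / (δ / 4)) * X ^ δ := by ring
      _ ≤ B := by rw [hB]; gcongr; linarith
  have hB16 : 16 ≤ B := by linarith
  have hκB : κ ≤ B := by linarith
  set T := max L R with hTdef
  have hLT : L ≤ T := le_max_left _ _
  have hRT : R ≤ T := le_max_right _ _
  obtain ⟨N, hN, hsum⟩ := sum_maxS_eq_errSum X R L a q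
  have hN' : ∀ r, (N r : ℝ) ≤ u ^ 12 := by
    intro r
    rw [u12]
    exact le_trans (by exact_mod_cast hN r) (Nat.floor_le hX0.le)
  have htar : target u R T = X ^ (2 / 3 : ℝ) * (T * R) + X ^ (11 / 12 : ℝ) * (T * R) ^ (1 / 2 : ℝ) := by
    unfold target
    rw [hpow, hpow, Real.sqrt_eq_rpow]
    norm_num
  have hW : 0 ≤ target u R T := by
    have : 0 ≤ T := by linarith
    unfold target; positivity
  have hB24 : B ^ 24 = K₁ ^ 24 * X ^ ε := by
    rw [hB, mul_pow, ← Real.rpow_mul_natCast hX0.le, hδ]; congr 2; push_cast; ring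
  rw [hsum, ← htar, ← mul_assoc, ← hB24]
  refine errSum_vonMangoldt_le hκ hu1 hR hL hLT hRT hcop ha hq hqa haq ?_ ?_ hB16 hκB hdiv hlog hN'
  · rw [hpow]; norm_num; norm_num at hT; exact hT
  · rw [hpow]; norm_num; norm_num at hqX; exact hqX

/-! ### Chebyshev's bound and dyadic decomposition -/

/-- A Chebyshev lower bound for the number of primes, valid from `2` on. -/
lemma le_primeCounting_mul_log {X : ℝ} (hX : 2 ≤ X) :
    X ≤ 16 * (Real.log X * (Nat.primeCounting ⌊X⌋₊ : ℝ)) := by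
  set n := ⌊X⌋₊ with hn
  have hn2 : 2 ≤ n := Nat.le_floor (by exact_mod_cast hX)
  have hn2' : (2 : ℝ) ≤ n := by exact_mod_cast hn2
  have hnX : (n : ℝ) ≤ X := Nat.floor_le (by linarith)
  have hXn : X < n + 1 := Nat.lt_floor_add_one X
  have hlogn : 0 < Real.log n := Real.log_pos (by linarith)
  have h1 := Chebyshev.pi_ge n
  rw [div_le_iff₀ hlogn] at h1
  have hl2 := Real.log_two_gt_d9
  -- The tangent line of the logarithm at 3, the value of n + 1 in the smallest case n = 2, with log
  -- 3 compared to 2 log 2.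
  have h3 : Real.log (n + 1) ≤ 2 * Real.log 2 - 1 / 4 + (n - 2) / 3 := by
    have e1 : ((n : ℝ) + 1) = 3 * ((n + 1) / 3) := by ring
    have e2 := Real.log_le_sub_one_of_pos (show (0 : ℝ) < (n + 1) / 3 by positivity)
    have e3 := Real.one_sub_inv_le_log_of_pos (show (0 : ℝ) < 4 / 3 by norm_num)
    have e4 : Real.log (4 / 3) = 2 * Real.log 2 - Real.log 3 := by
      rw [Real.log_div (by norm_num) (by norm_num), show (4 : ℝ) = 2 ^ 2 by norm_num, Real.log_pow]
      norm_num
    rw [e1, Real.log_mul (by norm_num) (by positivity)]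
    norm_num at e3
    linarith
  have h4 : (n : ℝ) / 8 ≤ (Nat.primeCounting n : ℝ) * Real.log n := by nlinarith
  have h5 : Real.log n ≤ Real.log X := Real.log_le_log (by linarith) hnX
  have h6 : (Nat.primeCounting n : ℝ) * Real.log n ≤ Nat.primeCounting n * Real.log X := by gcongr
  linarith

lemma rpow_one_sub_le_primeCounting {X ε : ℝ} (hX : 2 ≤ X) (hε : 0 < ε) :
    X ^ (1 - ε) ≤ 16 / ε * (Nat.primeCounting ⌊X⌋₊ : ℝ) := by
  have hX0 : 0 < X := by linarith
  have h1 := le_primeCounting_mul_log hX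
  have h2 := Real.log_le_rpow_div hX0.le hε
  have h3 : X ≤ 16 * (X ^ ε / ε * (Nat.primeCounting ⌊X⌋₊ : ℝ)) := h1.trans (by gcongr)
  rw [Real.rpow_sub hX0, Real.rpow_one, div_le_iff₀ (Real.rpow_pos_of_pos hX0 _)]
  refine h3.trans (le_of_eq ?_)
  ring

lemma le_maxS {X : ℝ} {N : ℕ} (hN : N ≤ ⌊X⌋₊) (I : Finset ℕ) (θ : ℝ) :
    ∑ l ∈ I, ‖S N (l * θ)‖ ≤ maxS X I θ :=
  le_sup' (fun N => ∑ l ∈ I, ‖S N (l * θ)‖) (mem_range.2 (Nat.lt_succ_iff.2 hN))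

lemma maxS_nonneg (X : ℝ) (I : Finset ℕ) (θ : ℝ) : 0 ≤ maxS X I θ :=
  le_trans (sum_nonneg fun _ _ => norm_nonneg _) (le_maxS (Nat.zero_le _) I θ)

/-- Covering an initial segment by dyadic intervals. -/
lemma sum_Icc_le_sum_dyadic {f : ℕ → ℝ} (hf : ∀ n, 0 ≤ f n) (n : ℕ) :
    ∑ l ∈ Icc 1 n, f l ≤ ∑ j ∈ range (Nat.log 2 n + 1), ∑ l ∈ dyadic ((2 : ℝ) ^ j), f l := by
  rw [← sum_fiberwise_of_maps_to (g := Nat.log 2) (t := range (Nat.log 2 n + 1))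
    (fun l hl => mem_range.2 (Nat.lt_succ_iff.2 (Nat.log_mono_right (mem_Icc.1 hl).2)))]
  refine sum_le_sum fun j _ => sum_le_sum_of_subset_of_nonneg ?_ (fun l _ _ => hf l)
  intro l hl
  rw [mem_filter, mem_Icc] at hl
  obtain ⟨⟨h1, _⟩, h2⟩ := hl
  rw [mem_dyadic, ← h2]
  have e1 := Nat.pow_log_le_self 2 (show l ≠ 0 by omega)
  have e2 := Nat.lt_pow_succ_log_self (b := 2) (by norm_num) l
  constructor
  · exact_mod_cast e1
  · rw [← pow_succ']; exact_mod_cast e2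

/-- Each block may choose its own N, since a maximum of sums is at most the sum of the maxima. -/
lemma maxS_Icc_le {X : ℝ} {m n : ℕ} (hmn : m ≤ n) (θ : ℝ) :
    maxS X (Icc 1 m) θ ≤ ∑ j ∈ range (Nat.log 2 n + 1), maxS X (dyadic ((2 : ℝ) ^ j)) θ := by
  refine sup'_le _ _ fun N hN => ?_
  calc ∑ l ∈ Icc 1 m, ‖S N (l * θ)‖ ≤ ∑ l ∈ Icc 1 n, ‖S N (l * θ)‖ :=
        sum_le_sum_of_subset_of_nonneg (Icc_subset_Icc_right hmn) fun _ _ _ => norm_nonneg _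
    _ ≤ _ := sum_Icc_le_sum_dyadic (fun l => norm_nonneg (S N (l * θ))) n
    _ ≤ _ := sum_le_sum fun j _ => le_maxS (Nat.lt_succ_iff.1 (mem_range.1 hN)) _ _

/-- Dyadic decomposition of both summation variables. -/
lemma sum_div_mul_maxS_le {ξ : ℝ} (hξ : 0 ≤ ξ) (X : ℝ) (D y a q : ℕ) :
    ∑ d ∈ Icc 1 D, ξ / d * maxS X (Icc 1 (d * y)) ((a : ℝ) / (d * q)) ≤
      ∑ i ∈ range (Nat.log 2 D + 1), ∑ j ∈ range (Nat.log 2 (2 ^ (i + 1) * y) + 1),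
        ξ / 2 ^ i * ∑ d ∈ dyadic ((2 : ℝ) ^ i),
          maxS X (dyadic ((2 : ℝ) ^ j)) ((a : ℝ) / (d * q)) := by
  refine (sum_Icc_le_sum_dyadic (fun d => mul_nonneg (by positivity) (maxS_nonneg _ _ _)) D).trans ?_
  refine sum_le_sum fun i _ => ?_
  rw [← mul_sum, sum_comm, mul_sum]
  refine sum_le_sum fun d hd => ?_
  rw [mem_dyadic] at hd
  have h1 : d ≤ 2 ^ (i + 1) := by
    have : (d : ℝ) ≤ 2 ^ (i + 1) := by rw [pow_succ']; exact hd.2.le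
    exact_mod_cast this
  exact mul_le_mul (div_le_div_of_nonneg_left hξ (by positivity) hd.1)
    (maxS_Icc_le (Nat.mul_le_mul_right y h1) _) (maxS_nonneg _ _ _) (by positivity)

lemma natLog_add_one_le {X ε : ℝ} {n : ℕ} (hX : 1 ≤ X) (hε : 0 < ε) (hn : (n : ℝ) ≤ 6 * X) :
    (Nat.log 2 n : ℝ) + 1 ≤ (1 + 2 * 6 ^ ε / ε) * X ^ ε := by
  have hXε : 1 ≤ X ^ ε := Real.one_le_rpow hX hε.le
  have h0 : 0 ≤ 2 * (6 : ℝ) ^ ε / ε := by positivity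
  rcases Nat.eq_zero_or_pos n with hn0 | hn0
  · rw [hn0]; simp only [Nat.log_zero_right, Nat.cast_zero, zero_add]; nlinarith
  have h1 : (2 : ℝ) ^ Nat.log 2 n ≤ 6 * X := by
    refine le_trans ?_ hn
    exact_mod_cast Nat.pow_log_le_self 2 hn0.ne'
  have h2 := Real.log_le_log (by positivity) h1
  rw [Real.log_pow] at h2
  have h3 := Real.log_le_rpow_div (x := 6 * X) (by positivity) hε
  rw [Real.mul_rpow (by norm_num) (by linarith)] at h3
  have hl2 := Real.log_two_gt_d9
  have h4 : (Nat.log 2 n : ℝ) * (1 / 2) ≤ Nat.log 2 n * Real.log 2 := by gcongr; linarith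
  have h5 : (1 + 2 * 6 ^ ε / ε) * X ^ ε = X ^ ε + 2 * (6 ^ ε * X ^ ε / ε) := by ring
  rw [h5]; linarith

/-- A single dyadic block, with `R` summands and frequencies of size up to `6RP`. -/
lemma block_le {X R L K ε α η P s ξ : ℝ} (hX : 1 ≤ X) (hR : 1 ≤ R) (hL : 1 ≤ L) (hK : 0 ≤ K)
    (hξ : 0 ≤ ξ) (hRX : R ≤ X ^ α) {σ : ℝ} (hP : P = X ^ σ) (hσ : 0 ≤ σ) (hLP : L ≤ R * (6 * P))
    (h1 : 2 / 3 + α + σ + η + 4 * ε ≤ 1) (h2 : 11 / 12 + σ / 2 + η + 4 * ε ≤ 1)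
    (hs : s ≤ K * (X ^ ε * (X ^ (2 / 3 : ℝ) * (max L R * R) +
      X ^ (11 / 12 : ℝ) * (max L R * R) ^ (1 / 2 : ℝ)))) :
    ξ / R * s ≤ 12 * K * (ξ * X ^ (1 - η - 3 * ε)) := by
  have hX0 : 0 < X := by linarith
  have hP1 : 1 ≤ P := by rw [hP]; exact Real.one_le_rpow hX hσ
  have hR0 : 0 < R := by linarith
  have hT : max L R * R ≤ 6 * P * R ^ 2 := by
    have : max L R ≤ R * (6 * P) := max_le hLP (by nlinarith)
    calc max L R * R ≤ R * (6 * P) * R := by gcongr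
      _ = _ := by ring
  have hT0 : 0 ≤ max L R * R := by
    have : 0 ≤ max L R := le_trans (by linarith) (le_max_left L R)
    positivity
  have hhalf : (max L R * R) ^ (1 / 2 : ℝ) ≤ 6 * R * X ^ (σ / 2) := by
    rw [← Real.sqrt_eq_rpow]
    apply Real.sqrt_le_iff.2
    refine ⟨by positivity, hT.trans ?_⟩
    have : (X ^ (σ / 2)) ^ 2 = P := by
      rw [hP, ← Real.rpow_mul_natCast hX0.le]; congr 1; push_cast; ring
    calc 6 * P * R ^ 2 ≤ 36 * P * R ^ 2 := by gcongr; norm_num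
      _ = (6 * R * X ^ (σ / 2)) ^ 2 := by rw [mul_pow, this]; ring
  have e1 : X ^ ε * (X ^ (2 / 3 : ℝ) * (X ^ α * P)) ≤ X ^ (1 - η - 3 * ε) := by
    rw [hP, ← Real.rpow_add hX0, ← Real.rpow_add hX0, ← Real.rpow_add hX0]
    exact Real.rpow_le_rpow_of_exponent_le hX (by linarith)
  have e2 : X ^ ε * (X ^ (11 / 12 : ℝ) * X ^ (σ / 2)) ≤ X ^ (1 - η - 3 * ε) := by
    rw [← Real.rpow_add hX0, ← Real.rpow_add hX0]
    exact Real.rpow_le_rpow_of_exponent_le hX (by linarith)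
  have hs2 : s ≤ R * (12 * K * X ^ (1 - η - 3 * ε)) := by
    calc s ≤ K * (X ^ ε * (X ^ (2 / 3 : ℝ) * (6 * P * R ^ 2) +
          X ^ (11 / 12 : ℝ) * (6 * R * X ^ (σ / 2)))) := hs.trans (by gcongr)
      _ = 6 * K * R * (X ^ ε * (X ^ (2 / 3 : ℝ) * (R * P)) +
          X ^ ε * (X ^ (11 / 12 : ℝ) * X ^ (σ / 2))) := by ring
      _ ≤ 6 * K * R * (X ^ ε * (X ^ (2 / 3 : ℝ) * (X ^ α * P)) +
          X ^ ε * (X ^ (11 / 12 : ℝ) * X ^ (σ / 2))) := by gcongr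
      _ ≤ 6 * K * R * (X ^ (1 - η - 3 * ε) + X ^ (1 - η - 3 * ε)) := by gcongr
      _ = _ := by ring
  calc ξ / R * s ≤ ξ / R * (R * (12 * K * X ^ (1 - η - 3 * ε))) := by gcongr
    _ = _ := by field_simp

/-! ### The two statements -/

theorem exists_sum_div_mul_maxS_le {c : ℝ} (C : ℝ) (hc : 0 < c) {ρ η α : ℝ} (hρ : 0 < ρ)
    (hη : 0 < η) (hα : α + ρ + 2 * η < 1 / 3) (hρη : ρ + 3 * η < 1 / 6) :
    ∃ K : ℝ, 0 < K ∧ ∀ (X : ℝ) (a q : ℕ), 2 ≤ X → a.Coprime q →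
      c * q ≤ a → (a : ℝ) ≤ C * q →
      c * X ^ (1 / 3 + ρ + η) ≤ q → (q : ℝ) ≤ C * X ^ (1 / 3 + ρ + η) →
      ∑ d ∈ Icc 1 ⌊X ^ α⌋₊,
          xi ρ X / d * maxS X (Icc 1 (d * Y ρ η X)) ((a : ℝ) / (d * q))
        ≤ K * (xi ρ X * (Nat.primeCounting ⌊X⌋₊ : ℝ) * X ^ (-η)) := by
  -- The slack in the two exponent hypotheses: the first serves the term X^(2/3) TR, the second,
  -- halved, the term X^(11/12) (TR)^(1/2).
  obtain ⟨γ, hγ, hγ1, hγ2⟩ : ∃ γ : ℝ, 0 < γ ∧ γ ≤ 1 / 3 - α - ρ - 2 * η ∧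
      γ ≤ 1 / 12 - (ρ + 3 * η) / 2 :=
    ⟨min (1 / 3 - α - ρ - 2 * η) (1 / 12 - (ρ + 3 * η) / 2), lt_min (by linarith) (by linarith),
      min_le_left _ _, min_le_right _ _⟩
  set ε := γ / 4 with hε
  have hε0 : 0 < ε := by positivity
  -- The entry 6/c absorbs the 6 in L ≤ 6RP: one factor 2 from d < 2R and 3 from the definition of
  -- `Y`.
  set κ := max 1 (max (6 / c) (max (1 / c) C)) with hκdef
  have hκ : 1 ≤ κ := le_max_left _ _
  have hκ6 : 6 / c ≤ κ := (le_max_left _ _).trans (le_max_right _ _)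
  have hκc : 1 / c ≤ κ := ((le_max_left _ _).trans (le_max_right _ _)).trans (le_max_right _ _)
  have hκC : C ≤ κ := ((le_max_right _ _).trans (le_max_right _ _)).trans (le_max_right _ _)
  obtain ⟨K, hK0, hK⟩ := exists_sum_maxS_le hκ hε0
  set K' : ℝ := 1 + 2 * 6 ^ ε / ε with hK'
  have hK'0 : 0 < K' := by positivity
  refine ⟨12 * K * K' ^ 2 * (16 / ε), by positivity, ?_⟩
  intro X a q hX hcop hca haC hcq hqC
  have hX0 : 0 < X := by linarith
  have hX1 : 1 ≤ X := by linarith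
  have hξ : 0 < xi ρ X := Real.rpow_pos_of_pos hX0 _
  have hq' : (0 : ℝ) < q := lt_of_lt_of_le (by positivity) hcq
  have ha' : (0 : ℝ) < a := lt_of_lt_of_le (by positivity) hca
  have hq : 0 < q := by exact_mod_cast hq'
  have ha : 0 < a := by exact_mod_cast ha'
  have hqa : (q : ℝ) ≤ κ * a := by
    calc (q : ℝ) = 1 / c * (c * q) := by field_simp
      _ ≤ κ * a := by gcongr
  have haq : (a : ℝ) ≤ κ * q := haC.trans (by gcongr)
  have hqX : (q : ℝ) ≤ κ * X ^ (2 / 3 : ℝ) := by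
    refine hqC.trans (mul_le_mul hκC ?_ (by positivity) (by linarith))
    exact Real.rpow_le_rpow_of_exponent_le hX1 (by linarith)
  set P : ℝ := X ^ (ρ + η) with hP
  have hP1 : 1 ≤ P := Real.one_le_rpow hX1 (by linarith)
  set y := Y ρ η X with hy
  have hyeq : 3 * (xi ρ X)⁻¹ * X ^ η = 3 * P := by
    rw [hP, Real.rpow_add hX0, xi, Real.rpow_neg hX0.le, inv_inv]; ring
  have hyP : (y : ℝ) ≤ 3 * P := by
    rw [← hyeq]; exact Nat.floor_le (by positivity)
  have hy1 : 1 ≤ y := by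
    apply Nat.le_floor
    rw [hyeq]; push_cast; linarith
  set D := ⌊X ^ α⌋₊ with hD
  -- For negative α the range of d is empty.
  rcases Nat.eq_zero_or_pos D with hD0 | hD0
  · rw [hD0, Icc_eq_empty (by norm_num), sum_empty]; positivity
  have hDX : (D : ℝ) ≤ X ^ α := Nat.floor_le (by positivity)
  have hcount1 : (Nat.log 2 D : ℝ) + 1 ≤ K' * X ^ ε := by
    apply natLog_add_one_le hX1 hε0
    have : X ^ α ≤ X ^ (1 : ℝ) := Real.rpow_le_rpow_of_exponent_le hX1 (by linarith)
    rw [Real.rpow_one] at this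
    linarith
  set b : ℝ := 12 * K * (xi ρ X * X ^ (1 - η - 3 * ε)) with hb
  have hb0 : 0 < b := by positivity
  have hblock : ∀ i ∈ range (Nat.log 2 D + 1),
      ∑ j ∈ range (Nat.log 2 (2 ^ (i + 1) * y) + 1), xi ρ X / 2 ^ i * ∑ d ∈ dyadic ((2 : ℝ) ^ i),
          maxS X (dyadic ((2 : ℝ) ^ j)) ((a : ℝ) / (d * q)) ≤ K' * X ^ ε * b := by
    intro i hi
    have hiD : 2 ^ i ≤ D := (Nat.pow_le_pow_right (by norm_num)
      (Nat.lt_succ_iff.1 (mem_range.1 hi))).trans (Nat.pow_log_le_self 2 hD0.ne')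
    have hRX : (2 : ℝ) ^ i ≤ X ^ α := le_trans (by exact_mod_cast hiD) hDX
    have hR1 : (1 : ℝ) ≤ 2 ^ i := one_le_pow₀ (by norm_num)
    have hny : ((2 ^ (i + 1) * y : ℕ) : ℝ) ≤ 2 ^ i * (6 * P) := by
      push_cast
      calc (2 : ℝ) ^ (i + 1) * y ≤ 2 ^ (i + 1) * (3 * P) := by gcongr
        _ = _ := by ring
    have hterm : ∀ j ∈ range (Nat.log 2 (2 ^ (i + 1) * y) + 1),
        xi ρ X / 2 ^ i * ∑ d ∈ dyadic ((2 : ℝ) ^ i),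
          maxS X (dyadic ((2 : ℝ) ^ j)) ((a : ℝ) / (d * q)) ≤ b := by
      intro j hj
      have hjn : 2 ^ j ≤ 2 ^ (i + 1) * y := (Nat.pow_le_pow_right (by norm_num)
        (Nat.lt_succ_iff.1 (mem_range.1 hj))).trans (Nat.pow_log_le_self 2 (by positivity))
      have hL1 : (1 : ℝ) ≤ 2 ^ j := one_le_pow₀ (by norm_num)
      have hLP : (2 : ℝ) ^ j ≤ 2 ^ i * (6 * P) := le_trans (by exact_mod_cast hjn) hny
      have hmax : max ((2 : ℝ) ^ j) (2 ^ i) ≤ 2 ^ i * (6 * P) := max_le hLP (by nlinarith)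
      have hT : max ((2 : ℝ) ^ j) (2 ^ i) * X ^ (1 / 3 : ℝ) ≤ κ * 2 ^ i * q := by
        calc max ((2 : ℝ) ^ j) (2 ^ i) * X ^ (1 / 3 : ℝ)
            ≤ 2 ^ i * (6 * P) * X ^ (1 / 3 : ℝ) := by gcongr
          _ = 6 / c * 2 ^ i * (c * X ^ (1 / 3 + ρ + η)) := by
            rw [add_assoc, Real.rpow_add hX0 (1 / 3) (ρ + η), ← hP]; field_simp
          _ ≤ κ * 2 ^ i * q := by gcongr
      exact block_le hX1 hR1 hL1 hK0.le hξ.le hRX hP (by linarith) hLP (by linarith) (by linarith)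
        (hK X (2 ^ i) (2 ^ j) a q hX1 hR1 hL1 hcop ha hq hqa haq hT hqX)
    refine (sum_le_sum hterm).trans ?_
    rw [sum_const, nsmul_eq_mul, card_range]
    gcongr
    push_cast
    apply natLog_add_one_le hX1 hε0
    refine hny.trans ?_
    calc (2 : ℝ) ^ i * (6 * P) ≤ X ^ α * (6 * P) := by gcongr
      _ = 6 * X ^ (α + (ρ + η)) := by rw [Real.rpow_add hX0, hP]; ring
      _ ≤ 6 * X ^ (1 : ℝ) := by
        gcongr
        · linarith
      _ = 6 * X := by rw [Real.rpow_one]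
  refine (sum_div_mul_maxS_le hξ.le X D y a q).trans ((sum_le_sum hblock).trans ?_)
  rw [sum_const, nsmul_eq_mul, card_range]
  have hπ := rpow_one_sub_le_primeCounting hX hε0
  -- The numbers of blocks in d and in l cost X^ε each. One of the three saved factors X^(-ε)
  -- remains, to be spent on the passage from X to π(X).
  have hexp : X ^ ε * (X ^ ε * X ^ (1 - η - 3 * ε)) = X ^ (1 - ε) * X ^ (-η) := by
    rw [← Real.rpow_add hX0, ← Real.rpow_add hX0, ← Real.rpow_add hX0]; congr 1; ring
  calc ((Nat.log 2 D + 1 : ℕ) : ℝ) * (K' * X ^ ε * b) ≤ (K' * X ^ ε) * (K' * X ^ ε * b) := by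
        gcongr; push_cast; exact hcount1
    _ = 12 * K * K' ^ 2 * xi ρ X * (X ^ ε * (X ^ ε * X ^ (1 - η - 3 * ε))) := by rw [hb]; ring
    _ = 12 * K * K' ^ 2 * xi ρ X * (X ^ (1 - ε) * X ^ (-η)) := by rw [hexp]
    _ ≤ 12 * K * K' ^ 2 * xi ρ X * ((16 / ε * (Nat.primeCounting ⌊X⌋₊ : ℝ)) * X ^ (-η)) := by gcongr
    _ = _ := by ring

theorem exists_sum_dyadic_maxS_le {c : ℝ} (C : ℝ) (hc : 0 < c) {ε : ℝ} (hε : 0 < ε) :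
    ∃ K : ℝ, 0 < K ∧ ∀ (X R L : ℝ) (a q : ℕ), 1 ≤ X → 1 ≤ R → 1 ≤ L → a.Coprime q →
      c * q ≤ a → (a : ℝ) ≤ C * q →
      max L R * X ^ (1 / 3 : ℝ) / R < q → (q : ℝ) < X ^ (2 / 3 : ℝ) →
      ∑ r ∈ dyadic R, maxS X (dyadic L) ((a : ℝ) / (r * q))
        ≤ K * (X ^ ε * (X ^ (2 / 3 : ℝ) * (max L R * R)
            + X ^ (11 / 12 : ℝ) * (max L R * R) ^ (1 / 2 : ℝ))) := by
  set κ := max 1 (max (1 / c) C) with hκdef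
  have hκ : 1 ≤ κ := le_max_left _ _
  have hκc : 1 / c ≤ κ := (le_max_left _ _).trans (le_max_right _ _)
  have hκC : C ≤ κ := (le_max_right _ _).trans (le_max_right _ _)
  obtain ⟨K, hK0, hK⟩ := exists_sum_maxS_le hκ hε
  refine ⟨K, hK0, ?_⟩
  intro X R L a q hX hR hL hcop hca haC hT hqX
  have hq' : (0 : ℝ) < q := by
    refine lt_of_le_of_lt ?_ hT
    have : 0 ≤ max L R := le_trans (by linarith) (le_max_left L R)
    positivity
  have ha' : (0 : ℝ) < a := lt_of_lt_of_le (by positivity) hca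
  refine hK X R L a q hX hR hL hcop (by exact_mod_cast ha') (by exact_mod_cast hq') ?_
    (haC.trans (by gcongr)) ?_ ?_
  · calc (q : ℝ) = 1 / c * (c * q) := by field_simp
      _ ≤ κ * a := by gcongr
  · have hR0 : 0 < R := by linarith
    rw [div_lt_iff₀ hR0] at hT
    calc max L R * X ^ (1 / 3 : ℝ) ≤ 1 * R * q := by linarith
      _ ≤ κ * R * q := by gcongr
  · calc (q : ℝ) ≤ 1 * X ^ (2 / 3 : ℝ) := by linarith
      _ ≤ κ * X ^ (2 / 3 : ℝ) := by gcongr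

end PrimeExpSum

theorem corollary13 (c C : ℝ) (hc : 0 < c) :
    (∀ ρ η α : ℝ, 0 < ρ → 0 < η → α + ρ + 2 * η < 1 / 3 → ρ + 3 * η < 1 / 6 →
      ∃ K : ℝ, 0 < K ∧ ∀ (X : ℝ) (a q : ℕ), 2 ≤ X → a.Coprime q →
        c * q ≤ a → (a : ℝ) ≤ C * q →
        c * X ^ (1 / 3 + ρ + η) ≤ q → (q : ℝ) ≤ C * X ^ (1 / 3 + ρ + η) →
        ∑ d ∈ Finset.Icc 1 ⌊X ^ α⌋₊,
            PrimeExpSum.xi ρ X / d *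
              PrimeExpSum.maxS X (Finset.Icc 1 (d * PrimeExpSum.Y ρ η X)) ((a : ℝ) / (d * q))
          ≤ K * (PrimeExpSum.xi ρ X * (Nat.primeCounting ⌊X⌋₊ : ℝ) * X ^ (-η))) ∧
    (∀ ε : ℝ, 0 < ε →
      ∃ K : ℝ, 0 < K ∧ ∀ (X R L : ℝ) (a q : ℕ), 1 ≤ X → 1 ≤ R → 1 ≤ L → a.Coprime q →
        c * q ≤ a → (a : ℝ) ≤ C * q →
        max L R * X ^ (1 / 3 : ℝ) / R < q → (q : ℝ) < X ^ (2 / 3 : ℝ) →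
        ∑ r ∈ PrimeExpSum.dyadic R,
            PrimeExpSum.maxS X (PrimeExpSum.dyadic L) ((a : ℝ) / (r * q))
          ≤ K * (X ^ ε * (X ^ (2 / 3 : ℝ) * (max L R * R)
              + X ^ (11 / 12 : ℝ) * (max L R * R) ^ (1 / 2 : ℝ)))) := by
  exact ⟨fun _ _ _ hρ hη hα hρη => PrimeExpSum.exists_sum_div_mul_maxS_le C hc hρ hη hα hρη,
    fun _ hε => PrimeExpSum.exists_sum_dyadic_maxS_le C hc hε⟩
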